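/- Let $d\ge 1$, $I=[0,1]$, $\mathcal H=L^2(I^d)$ with norm $\|\cdot\|$, and $T>0$. Let $K$ be a real measurable kernel on $I^d\times I^d$ with $$\operatorname*{ess\,sup}_{x}\int_{I^d}|K(x,y)|^2\,dy<\infty,\qquad \operatorname*{ess\,sup}_{y}\int_{I^d}|K(x,y)|^2\,dx<\infty .$$ Let $\mathbf Q$ be a positive self-adjoint trace class operator on $\mathcal H$ with eigenvalues $\lambda_1\ge\lambda_2\ge\dots$ (counted with multiplicity) and corresponding orthonormal eigenfunctions $e_k$. On a probability space with a normal filtration $(\mathcal F_t)_{t\ge0}$, let $W(t)=\sum_{k\ge1}\sqrt{\lambda_k}\,B_k(t)\,e_k$, with independent standard Brownian motions $B_k$, be a $\mathbf Q$-Wiener process with respect to $(\mathcal F_t)$. For $\phi\in L^2(I^m)$ and $\delta>0$ put $$\omega_2(\phi,\delta)=\sup_{|h|\le\delta}\|\phi(\cdot+h)-\phi\|_{L^2(\{x\in I^m:\,x+h\in I^m\})},$$ and write $\phi\in\operatorname{Lip}(\gamma,L^2(I^m))$ if $\phi\in L^2(I^m)$ and $\omega_2(\phi,\delta)\le C\delta^\gamma$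 for some $C$ and all $\delta>0$. Suppose that $g\in\operatorname{Lip}(\alpha,L^2(I^d))$ and $K\in\operatorname{Lip}(\beta,L^2(I^d\times I^d))$ with $\alpha,\beta\in(0,1]$. Let $u$ be the mild solution on $[0,T]$ of $$du=\mathbf K[u]\,dt+dW,\quad u(0)=g,\qquad \mathbf K[v](x)=\int_{I^d}K(x,y)\sin\bigl(2\pi(v(x)-v(y))\bigr)\,dy,$$ that is, the predictable $\mathcal H$-valued process with $\int_0^T\|u(t)\|^2dt<\infty$ a.s. and, a.s., $u(t)=g+\int_0^t\mathbf K[u(s)]\,ds+W(t)$ for all $t\in[0,T]$. For $n\ge1$ let $\mathbf P_n$ be the $L^2$-projection onto the functions that are constant on each of the $n^d$ congruent cells $\prod_{j=1}^d\bigl(\tfrac{i_j-1}{n},\tfrac{i_j}{n}\bigr]$, $i\in\{1,\dots,n\}^d$. Let $K^n$ be the kernel obtained from $K$ by averaging over the products of two cells, and let $\mathbf K^n$ be the operator $\mathbf K$ with $K^n$ in place of $K$. For $\Delta t=T/M$, $M\in\{1,2,\dots\}$, and $t_k=k\Delta t$, define $$u^{n,0}=\mathbf P_n g,\qquad u^{n,k+1}=u^{n,k}+\Delta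 t\,\mathbf K^n[u^{n,k}]+\mathbf P_n\bigl(W(t_{k+1})-W(t_k)\bigr).$$ Then there is a constant $C$, independent of $n$ and $\Delta t$, such that for all $n\ge1$ and $M\ge1$ $$\max_{0\le k\le M}\bigl(\mathbb E\|u(t_k)-u^{n,k}\|^2\bigr)^{1/2}\le C\bigl(\max\{n^{-\alpha},n^{-\beta},\Psi(n)\}+\Delta t\bigr),$$ where $$\Psi(n)=\Bigl(\inf_{m\ge1}\Bigl\{\sum_{k=1}^m\lambda_k\,\omega_2(e_k,n^{-1})^2+\sum_{k=m+1}^\infty\lambda_k\Bigr\}\Bigr)^{1/2}.$$ -/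

import Mathlib

open MeasureTheory ProbabilityTheory
open scoped NNReal ENNReal

noncomputable section

namespace KuramotoGalerkin

/-! ### The spatial domain and the state space -/

/-- The unit cube `I^ι`, `I = [0,1]`, in `ℝ^ι`. -/
def cube (ι : Type) : Set (ι → ℝ) := Set.Icc 0 1

/-- Lebesgue measure on the unit cube `I^d`. -/
abbrev cubeMeasure (d : ℕ) : Measure (Fin d → ℝ) := volume.restrict (cube (Fin d))

/-- The state space `L²(I^d)`. -/
abbrev StateSpace (d : ℕ) : Type := Lp ℝ 2 (cubeMeasure d)

/-! ### Generalized Lipschitz spaces -/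

/-- The `L²`-modulus of continuity of `φ` on the unit cube: the supremum over all `h` of Euclidean
length at most `δ` of the `L²`-norm of `φ(· + h) - φ` on `{x : x ∈ I^ι, x + h ∈ I^ι}`. -/
def l2Modulus {ι : Type} [Fintype ι] (φ : (ι → ℝ) → ℝ) (δ : ℝ) : ℝ≥0∞ :=
  ⨆ (h : ι → ℝ) (_ : ∑ i, h i ^ 2 ≤ δ ^ 2),
    eLpNorm (fun x => φ (x + h) - φ x) 2 (volume.restrict {x | x ∈ cube ι ∧ x + h ∈ cube ι})

/-- `φ ∈ Lip(α, L²(I^ι))`. -/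
def MemLipL2 {ι : Type} [Fintype ι] (α : ℝ) (φ : (ι → ℝ) → ℝ) : Prop :=
  MemLp φ 2 (volume.restrict (cube ι)) ∧
    ∃ C : ℝ≥0, ∀ δ : ℝ, 0 < δ → l2Modulus φ δ ≤ C * ENNReal.ofReal (δ ^ α)

/-- A kernel on `I^d × I^d`, viewed as a function on the unit cube of dimension `2d`. -/
def kernelOnCube {d : ℕ} (K : (Fin d → ℝ) → (Fin d → ℝ) → ℝ) : (Fin d ⊕ Fin d → ℝ) → ℝ :=
  fun z => K (fun i => z (Sum.inl i)) (fun i => z (Sum.inr i))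

/-! ### The interaction operator -/

/-- The standing assumptions on the interaction kernel: it is measurable and
`esssup_x ∫ |K(x,y)|² dy < ∞`, `esssup_y ∫ |K(x,y)|² dx < ∞`. -/
structure IsAdmissibleKernel {d : ℕ} (K : (Fin d → ℝ) → (Fin d → ℝ) → ℝ) : Prop where
  measurable : Measurable (Function.uncurry K)
  essSup_left :
    essSup (fun x => ∫⁻ y, ‖K x y‖ₑ ^ 2 ∂(cubeMeasure d)) (cubeMeasure d) < ∞
  essSup_right :
    essSup (fun y => ∫⁻ x, ‖K x y‖ₑ ^ 2 ∂(cubeMeasure d)) (cubeMeasure d) < ∞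

/-- The Kuramoto interaction function `S(u,v) = sin (2π (u - v))`. -/
def kuramotoS (u v : ℝ) : ℝ := Real.sin (2 * Real.pi * (u - v))

/-- The function `x ↦ ∫ K(x,y) S(v(x), v(y)) dy`. -/
def interactionFun {d : ℕ} (K : (Fin d → ℝ) → (Fin d → ℝ) → ℝ) (S : ℝ → ℝ → ℝ)
    (v : (Fin d → ℝ) → ℝ) : (Fin d → ℝ) → ℝ :=
  fun x => ∫ y, K x y * S (v x) (v y) ∂(cubeMeasure d)

open scoped Classical in
/-- The interaction operator `𝐊[v] = ∫ K(·,y) S(v(·), v(y)) dy` as a map of `L²(I^d)` to itself.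
The fallback value `0` is never taken for an admissible kernel and the Kuramoto interaction, see
`memLp_interactionFun`. -/
def interactionOp {d : ℕ} (K : (Fin d → ℝ) → (Fin d → ℝ) → ℝ) (S : ℝ → ℝ → ℝ)
    (v : StateSpace d) : StateSpace d :=
  if h : MemLp (interactionFun K S v) 2 (cubeMeasure d) then h.toLp else 0

/-! ### The driving noise -/

/-- `Q` is a positive self-adjoint trace class operator, `lam` is the decreasing sequence of its
eigenvalues counted with multiplicity, and `e` is a corresponding orthonormal sequence of
eigenfunctions. Indices start at `0`. The sequence exhausts the nonzero eigenvalues (`Q` vanishes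
on the orthogonal complement of the `e k`), so that the trace of `Q` is `∑ lam k`. -/
structure IsTraceClassSpectrum {d : ℕ} (Q : StateSpace d →L[ℝ] StateSpace d) (lam : ℕ → ℝ)
    (e : ℕ → StateSpace d) : Prop where
  isPositive : Q.IsPositive
  orthonormal : Orthonormal ℝ e
  eigen : ∀ k, Q (e k) = lam k • e k
  antitone : Antitone lam
  exhaust : ∀ v, (∀ k, inner ℝ (e k) v = 0) → Q v = 0
  summable : Summable lam

/-- A normal filtration: right-continuous, and its first member contains all null events. -/
structure IsNormalFiltration {Ω : Type*} {mΩ : MeasurableSpace Ω} (P : Measure Ω)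
    (𝓕 : Filtration ℝ≥0 mΩ) : Prop where
  rightContinuous : 𝓕.IsRightContinuous
  null_mem : ∀ A : Set Ω, MeasurableSet A → P A = 0 → MeasurableSet[𝓕 0] A

/-- `W` is the Wiener process with covariance spectrum `(lam, e)`, with respect to the filtration
`𝓕`: it has the Karhunen-Loève expansion `W(t) = ∑ √(lam k) B_k(t) e_k` with independent Brownian
motions `B_k`, it is adapted, and `W(t) - W(s)` is independent of `𝓕 s` for `s ≤ t`. -/
structure IsWienerProcess {d : ℕ} {Ω : Type*} {mΩ : MeasurableSpace Ω} (P : Measure Ω)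
    (𝓕 : Filtration ℝ≥0 mΩ) (lam : ℕ → ℝ) (e : ℕ → StateSpace d)
    (W : ℝ≥0 → Ω → StateSpace d) : Prop where
  expansion : ∃ B : ℕ → ℝ≥0 → Ω → ℝ,
    (∀ k, IsBrownianReal (B k) P) ∧
    iIndepFun (fun (k : ℕ) (ω : Ω) (t : ℝ≥0) => B k t ω) P ∧
    ∀ᵐ ω ∂P, ∀ t, HasSum (fun k => (√(lam k) * B k t ω) • e k) (W t ω)
  adapted : StronglyAdapted 𝓕 W
  indep_increments : ∀ s t, s ≤ t →
    Indep (MeasurableSpace.comap (fun ω => W t ω - W s ω) (borel (StateSpace d))) (𝓕 s) P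

/-! ### Mild solutions -/

/-- `u` is a mild solution on `[0,T]` of `du = 𝐊[u] dt + dW`, `u(0) = g`. -/
structure IsMildSolution {d : ℕ} {Ω : Type*} {mΩ : MeasurableSpace Ω} (P : Measure Ω)
    (𝓕 : Filtration ℝ≥0 mΩ) (T : ℝ≥0) (K : (Fin d → ℝ) → (Fin d → ℝ) → ℝ) (S : ℝ → ℝ → ℝ)
    (g : StateSpace d) (W u : ℝ≥0 → Ω → StateSpace d) : Prop where
  predictable : IsStronglyPredictable 𝓕 u
  sq_integrable : ∀ᵐ ω ∂P, ∫⁻ t in Set.Icc (0 : ℝ) T, ‖u t.toNNReal ω‖ₑ ^ 2 < ∞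
  eqn : ∀ᵐ ω ∂P, ∀ t ≤ T,
    u t ω = g + (∫ s in (0 : ℝ)..t, interactionOp K S (u s.toNNReal ω)) + W t ω

/-! ### The Galerkin projection and the fully discrete scheme -/

/-- The cell `∏_j (i_j / n, (i_j + 1) / n]` of the uniform partition, with `i_j ∈ {0, …, n-1}`. -/
def cell {d : ℕ} (n : ℕ) (i : Fin d → Fin n) : Set (Fin d → ℝ) :=
  Set.univ.pi fun j => Set.Ioc ((i j : ℝ) / n) (((i j : ℝ) + 1) / n)

lemma measurableSet_cell {d n : ℕ} (i : Fin d → Fin n) : MeasurableSet (cell n i) :=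
  MeasurableSet.univ_pi fun _ => measurableSet_Ioc

lemma cubeMeasure_cell_ne_top {d n : ℕ} (i : Fin d → Fin n) :
    cubeMeasure d (cell n i) ≠ ∞ := by
  have h : cubeMeasure d Set.univ < ∞ := by
    rw [Measure.restrict_apply_univ]
    exact isCompact_Icc.measure_lt_top
  exact ((measure_mono (Set.subset_univ _)).trans_lt h).ne

/-- The indicator function of a cell, as an element of `L²(I^d)`. -/
def cellInd {d : ℕ} (n : ℕ) (i : Fin d → Fin n) : StateSpace d :=
  indicatorConstLp 2 (measurableSet_cell i) (cubeMeasure_cell_ne_top i) (1 : ℝ)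

/-- The `L²`-projection onto the span of the cell indicators:
`𝐏_n φ = ∑_i n^d ⟨φ, χ_i⟩ χ_i`. -/
def galerkinProj {d : ℕ} (n : ℕ) (φ : StateSpace d) : StateSpace d :=
  ∑ i : Fin d → Fin n, ((n : ℝ) ^ d * inner ℝ φ (cellInd n i)) • cellInd n i

/-- The mean value `K^n_{ij} = n^{2d} ∫_{V_i} ∫_{V_j} K(x,y) dy dx` of the kernel. -/
def kernelCoeff {d : ℕ} (n : ℕ) (K : (Fin d → ℝ) → (Fin d → ℝ) → ℝ) (i j : Fin d → Fin n) : ℝ :=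
  (n : ℝ) ^ (2 * d) * ∫ x in cell n i, ∫ y in cell n j, K x y

/-- The projected kernel `K^n(x,y) = ∑_{i,j} K^n_{ij} χ_i(x) χ_j(y)`. -/
def kernelProj {d : ℕ} (n : ℕ) (K : (Fin d → ℝ) → (Fin d → ℝ) → ℝ) :
    (Fin d → ℝ) → (Fin d → ℝ) → ℝ :=
  fun x y => ∑ i : Fin d → Fin n, ∑ j : Fin d → Fin n,
    kernelCoeff n K i j * (cell n i).indicator 1 x * (cell n j).indicator 1 y

/-- The fully discrete Galerkin / Euler-Maruyama scheme with mesh parameter `n` and time step `τ`: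
`u^{n,0} = 𝐏_n g`, `u^{n,k+1} = u^{n,k} + τ 𝐊^n[u^{n,k}] + 𝐏_n (W(t_{k+1}) - W(t_k))`,
`t_k = k τ`. -/
def scheme {d : ℕ} {Ω : Type*} (K : (Fin d → ℝ) → (Fin d → ℝ) → ℝ) (S : ℝ → ℝ → ℝ)
    (g : StateSpace d) (W : ℝ≥0 → Ω → StateSpace d) (n : ℕ) (τ : ℝ≥0) : ℕ → Ω → StateSpace d
  | 0 => fun _ => galerkinProj n g
  | k + 1 => fun ω =>
      scheme K S g W n τ k ω
        + (τ : ℝ) • interactionOp (kernelProj n K) S (scheme K S g W n τ k ω)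
        + galerkinProj n (W ((k + 1 : ℕ) * τ) ω - W (k * τ) ω)

/-- `Ψ(n) = (inf_{m ≥ 1} {∑_{k ≤ m} λ_k ω₂(e_k, 1/n)² + ∑_{k > m} λ_k})^{1/2}`; the eigenvalues are
indexed from `0` here. -/
def Psi {d : ℕ} (lam : ℕ → ℝ) (e : ℕ → StateSpace d) (n : ℕ) : ℝ≥0∞ :=
  (⨅ (m : ℕ) (_ : 1 ≤ m),
    ((∑ k ∈ Finset.range m, ENNReal.ofReal (lam k) * l2Modulus (e k) (1 / n) ^ 2)
      + ∑' k, ENNReal.ofReal (lam (m + k)))) ^ (1 / 2 : ℝ)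

/-- For an admissible kernel the interaction operator is well defined on `L²(I^d)`. -/
lemma memLp_interactionFun {d : ℕ} {K : (Fin d → ℝ) → (Fin d → ℝ) → ℝ}
    (hK : IsAdmissibleKernel K) (v : StateSpace d) :
    MemLp (interactionFun K kuramotoS v) 2 (cubeMeasure d) := by
  have hfin : IsFiniteMeasure (cubeMeasure d) :=
    ⟨by rw [Measure.restrict_apply_univ]; exact isCompact_Icc.measure_lt_top⟩
  have hv : Measurable v := (Lp.stronglyMeasurable v).measurable
  have hm : Measurable fun p : (Fin d → ℝ) × (Fin d → ℝ) =>
      K p.1 p.2 * kuramotoS (v p.1) (v p.2) := by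
    have h1 : Measurable fun p : (Fin d → ℝ) × (Fin d → ℝ) => K p.1 p.2 := hK.measurable
    unfold kuramotoS
    fun_prop
  refine ⟨hm.stronglyMeasurable.integral_prod_right.aestronglyMeasurable, ?_⟩
  set c := essSup (fun x => ∫⁻ y, ‖K x y‖ₑ ^ 2 ∂(cubeMeasure d)) (cubeMeasure d) with hc
  rw [eLpNorm_lt_top_iff_lintegral_rpow_enorm_lt_top two_ne_zero ENNReal.ofNat_ne_top]
  calc ∫⁻ x, ‖interactionFun K kuramotoS v x‖ₑ ^ (2 : ℝ≥0∞).toReal ∂(cubeMeasure d)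
      ≤ ∫⁻ _, (cubeMeasure d Set.univ + c) ^ 2 ∂(cubeMeasure d) := by
        refine lintegral_mono_ae ?_
        filter_upwards [ENNReal.ae_le_essSup
          (fun x => ∫⁻ y, ‖K x y‖ₑ ^ 2 ∂(cubeMeasure d))] with x hx
        rw [ENNReal.toReal_ofNat, ENNReal.rpow_ofNat]
        gcongr
        calc ‖interactionFun K kuramotoS v x‖ₑ
            ≤ ∫⁻ y, ‖K x y * kuramotoS (v x) (v y)‖ₑ ∂(cubeMeasure d) :=
              enorm_integral_le_lintegral_enorm _
          _ ≤ ∫⁻ y, (1 + ‖K x y‖ₑ ^ 2) ∂(cubeMeasure d) := by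
              refine lintegral_mono fun y => ?_
              have hs : ‖kuramotoS (v x) (v y)‖ₑ ≤ 1 := by
                rw [← ofReal_norm, Real.norm_eq_abs]
                exact ENNReal.ofReal_le_one.2 (Real.abs_sin_le_one _)
              rw [enorm_mul]
              refine (mul_le_mul_right hs _).trans ?_
              rw [mul_one]
              rcases le_total ‖K x y‖ₑ 1 with h | h
              · exact h.trans le_self_add
              · exact (le_self_pow₀ h two_ne_zero).trans le_add_self
          _ = cubeMeasure d Set.univ + ∫⁻ y, ‖K x y‖ₑ ^ 2 ∂(cubeMeasure d) := by
              rw [lintegral_add_left measurable_const]; simp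
          _ ≤ cubeMeasure d Set.univ + c := by gcongr
    _ < ∞ := by
        rw [lintegral_const]
        refine ENNReal.mul_lt_top (ENNReal.pow_lt_top ?_) (measure_lt_top _ _)
        exact ENNReal.add_lt_top.2 ⟨measure_lt_top _ _, hK.essSup_left⟩

end KuramotoGalerkin

end

/-!
The scheme is Euler's method for the projected equation, and its error obeys a discrete Gronwall
inequality whose inhomogeneity consists of four terms: the projection error of `g`, that of `W`,
that of the kernel, and the local error of Euler's method along the exact solution.

*Projection errors.* On a cell, a function differs from its mean by at most the average over the
cell of its differences. After the substitution `y = x + h`, and with each `h` cut into `d` pieces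
of length at most `1 / n`, this bounds the projection error by a constant times the `L²`-modulus of
continuity at `1 / n` (`lintegral_sub_cellMean_sq_le`). The same argument in dimension `2 d` treats
the kernel. For the noise, the orthogonality of the coordinates gives
`E ‖A W(t)‖² ≤ t ∑ λ_k ‖A e_k‖²` for a bounded operator `A` (`lintegral_enorm_map_sq_le`); the
choice `A = 1 - 𝐏_n` leads to `Psi`. The interaction operator is Lipschitz on `L²`, with a constant
that depends only on the row bound of the kernel, and averaging the kernel preserves that bound.

*The local error* (`IsMildSolution.exists_eLpNorm_eulerDefect_le`). It is the integral over
`r ∈ [0, τ]` of `∑_j (𝐊[u(jτ + r)] - 𝐊[u(jτ)])`. A bound of the summands by the regularity of the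
paths of `u` would only yield the order `1/2`. First order in `τ` holds because for each fixed `r`
the sum over `j` is bounded in `L²(Ω)`, uniformly in `τ`
(`IsMildSolution.exists_lintegral_sum_drift_sub_sq_le`). By the Cauchy-Schwarz inequality in `y`
this is a statement about the scalar phase `θ_j = 2π (u(jτ, x) - u(jτ, y))`, which advances by
independent Gaussian increments up to a drift of size `O(τ)` (`lintegral_sum_sin_sub_le`). Put
`m = E exp (i (θ_{j+1} - θ_j))` and `m' = E exp (i (θ(jτ + r) - θ_j))`, drift omitted. Up to
martingales with variance `O(1)` and errors `O(T)`, the sum of `exp (i θ(jτ + r)) - exp (i θ_j)` is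
`(m' - 1) ∑_j exp (i θ_j)`, and the same computation with `r = τ`, where the sum telescopes to a
bounded quantity, shows that `(1 - m) ∑_j exp (i θ_j)` is bounded; moreover `1 - m' ≤ 1 - m`.
The variance of the increments at `(x, y)` is `4π² ∑ λ_k (e_k(x) - e_k(y))²` per unit of time,
which is integrable in `(x, y)` because `Q` has finite trace.

Elements of `L²` have no values at points, so the phases are formed with representatives that are
jointly measurable in the class and the point (`exists_measurable_eval`).
-/

namespace KuramotoGalerkin

/-! ### Euler sums of a phase driven by independent increments -/

section Phase

lemma norm_cexp_sub_cexp_le (a b : ℝ) :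
    ‖Complex.exp (a * Complex.I) - Complex.exp (b * Complex.I)‖ ≤ |a - b| := by
  have h : Complex.exp (a * Complex.I) - Complex.exp (b * Complex.I)
      = Complex.exp (b * Complex.I) * (Complex.exp ((a - b : ℝ) * Complex.I) - 1) := by
    rw [mul_sub, ← Complex.exp_add]
    push_cast
    ring_nf
  rw [h, norm_mul, Complex.norm_exp_ofReal_mul_I, one_mul]
  have := Real.norm_exp_I_mul_ofReal_sub_one_le (x := a - b)
  rwa [mul_comm, Real.norm_eq_abs] at this

variable {Ω : Type*} {mΩ : MeasurableSpace Ω} {P : Measure Ω} [IsProbabilityMeasure P]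
  {𝓖 : ℕ → MeasurableSpace Ω}

/-- Orthogonality of martingale differences: the multipliers `M j - m` are centred and independent
of the past, so the variances of the summands `z j * (M j - m)` add up. -/
lemma integral_norm_sq_sum_mul_sub (hmono : Monotone 𝓖) (hle : ∀ j, 𝓖 j ≤ mΩ)
    {z M : ℕ → Ω → ℂ} {m : ℝ}
    (hz : ∀ j, Measurable[𝓖 j] (z j)) (hz1 : ∀ j ω, ‖z j ω‖ = 1)
    (hM : ∀ j, Measurable[𝓖 (j + 1)] (M j)) (hM1 : ∀ j ω, ‖M j ω‖ = 1)
    (k : ℕ) (hind : ∀ j < k, Indep (MeasurableSpace.comap (M j) inferInstance) (𝓖 j) P)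
    (hm : ∀ j < k, ∫ ω, M j ω ∂P = m) :
    ∫ ω, ‖∑ j ∈ Finset.range k, z j ω * (M j ω - m)‖ ^ 2 ∂P = k * (1 - m ^ 2) := by
  have hzm : ∀ j, Measurable (z j) := fun j => (hz j).mono (hle j) le_rfl
  have hMm : ∀ j, Measurable (M j) := fun j => (hM j).mono (hle _) le_rfl
  have hMi : ∀ j, Integrable (M j) P := fun j =>
    Integrable.of_bound (hMm j).aestronglyMeasurable 1 (Filter.Eventually.of_forall fun ω =>
      (hM1 j ω).le)
  induction k with
  | zero => simp
  | succ k ih =>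
    specialize ih (fun j hj => hind j (by omega)) (fun j hj => hm j (by omega))
    set S : Ω → ℂ := fun ω => ∑ j ∈ Finset.range k, z j ω * (M j ω - m) with hS
    have hξb : ∀ j ω, ‖z j ω * (M j ω - m)‖ ≤ 1 + |m| := fun j ω => by
      rw [norm_mul, hz1, one_mul]
      refine (norm_sub_le _ _).trans ?_
      rw [hM1, Complex.norm_real, Real.norm_eq_abs]
    have hSb : ∀ ω, ‖S ω‖ ≤ k * (1 + |m|) := fun ω => by
      refine (norm_sum_le _ _).trans ((Finset.sum_le_sum fun j _ => hξb j ω).trans ?_)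
      rw [Finset.sum_const, Finset.card_range, nsmul_eq_mul]
    have hSk : Measurable[𝓖 k] S := by
      refine Finset.measurable_sum _ fun j hj => ?_
      have hj' : j < k := Finset.mem_range.1 hj
      exact ((hz j).mono (hmono hj'.le) le_rfl).mul
        (((hM j).mono (hmono hj') le_rfl).sub_const _)
    have hSm : Measurable S := hSk.mono (hle k) le_rfl
    have hX : Measurable[𝓖 k] fun ω => (starRingEnd ℂ) (S ω) * z k ω :=
      (Complex.continuous_conj.measurable.comp hSk).mul (hz k)
    have hcross : ∫ ω, (starRingEnd ℂ) (S ω) * z k ω * (M k ω - m) ∂P = 0 := by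
      have hI : IndepFun (fun ω => (starRingEnd ℂ) (S ω) * z k ω) (fun ω => M k ω - m) P := by
        have h1 : Indep (MeasurableSpace.comap (fun ω => (starRingEnd ℂ) (S ω) * z k ω)
            inferInstance) (MeasurableSpace.comap (fun ω => M k ω - m) inferInstance) P := by
          refine (indep_of_indep_of_le (hind k k.lt_succ_self) ?_ hX.comap_le).symm
          refine Measurable.comap_le ?_
          exact (comap_measurable (M k)).sub_const _
        exact (IndepFun_iff_Indep _ _ _).2 h1
      rw [hI.integral_fun_mul_eq_mul_integral
        (hX.mono (hle k) le_rfl).aestronglyMeasurable ((hMm k).sub_const _).aestronglyMeasurable,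
        integral_sub (hMi k) (integrable_const _), hm k k.lt_succ_self]
      simp
    have hci : Integrable (fun ω => (starRingEnd ℂ) (S ω) * z k ω * (M k ω - m)) P := by
      refine Integrable.of_bound (((hX.mono (hle k) le_rfl).mul
        ((hMm k).sub_const _)).aestronglyMeasurable) (k * (1 + |m|) * (1 + |m|))
        (Filter.Eventually.of_forall fun ω => ?_)
      rw [mul_assoc, norm_mul, RCLike.norm_conj]
      exact mul_le_mul (hSb ω) (hξb k ω) (norm_nonneg _) (by positivity)
    have hSi : Integrable (fun ω => ‖S ω‖ ^ 2) P := by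
      refine Integrable.of_bound (hSm.norm.pow_const 2).aestronglyMeasurable
        ((k * (1 + |m|)) ^ 2) (Filter.Eventually.of_forall fun ω => ?_)
      rw [Real.norm_of_nonneg (by positivity)]
      exact pow_le_pow_left₀ (norm_nonneg _) (hSb ω) 2
    have hexp : ∀ ω, ‖∑ j ∈ Finset.range (k + 1), z j ω * (M j ω - m)‖ ^ 2
        = ‖S ω‖ ^ 2 + 2 * ((starRingEnd ℂ) (S ω) * z k ω * (M k ω - m)).re
          + (1 + m ^ 2 - 2 * m * (M k ω).re) := fun ω => by
      rw [Finset.sum_range_succ, norm_add_sq_real, norm_mul, hz1, one_mul]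
      have h1 : ‖M k ω - m‖ ^ 2 = 1 + m ^ 2 - 2 * m * (M k ω).re := by
        have h2 : ‖M k ω‖ ^ 2 = 1 := by rw [hM1]; norm_num
        rw [← Complex.normSq_eq_norm_sq, Complex.normSq_apply] at h2 ⊢
        simp only [Complex.sub_re, Complex.sub_im, Complex.ofReal_re, Complex.ofReal_im]
        linear_combination h2
      rw [h1, mul_assoc ((starRingEnd ℂ) (S ω)), Complex.inner,
        mul_comm (z k ω * _)]
    simp_rw [hexp]
    have hre : ∫ ω, ((starRingEnd ℂ) (S ω) * z k ω * (M k ω - m)).re ∂P = 0 := by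
      have := integral_re hci
      simp only [RCLike.re_to_complex] at this
      rw [this, hcross, Complex.zero_re]
    have hMre : ∫ ω, (M k ω).re ∂P = m := by
      have := integral_re (hMi k)
      simp only [RCLike.re_to_complex] at this
      rw [this, hm k k.lt_succ_self, Complex.ofReal_re]
    have hMrei : Integrable (fun ω => (M k ω).re) P := (hMi k).re
    have hcre : Integrable (fun ω => ((starRingEnd ℂ) (S ω) * z k ω * (M k ω - m)).re) P := hci.re
    have h12 : Integrable (fun ω => ‖S ω‖ ^ 2
        + 2 * ((starRingEnd ℂ) (S ω) * z k ω * (M k ω - m)).re) P := hSi.add (hcre.const_mul 2)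
    have h3 : Integrable (fun ω => 1 + m ^ 2 - 2 * m * (M k ω).re) P :=
      (integrable_const _).sub (hMrei.const_mul _)
    rw [integral_add h12 h3, integral_add hSi (hcre.const_mul 2), integral_const_mul, hre, ih,
      integral_sub (integrable_const _) (hMrei.const_mul _), integral_const_mul, hMre]
    simp
    ring

/-- Uniform bound for the error of sampling a phase with bounded drift. The phase `θ j` at the
grid points advances by `η j` up to a drift of size `δ`, and `θ' j` is an intermediate value,
reached from `θ j` through `η' j`. The factor `1 - m'` that each step contributes on average is
beaten by the cancellation in `∑ exp (i θ j)`, which is of order `1 / (1 - m)`. -/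
lemma lintegral_sum_sin_sub_le (hmono : Monotone 𝓖) (hle : ∀ j, 𝓖 j ≤ mΩ)
    {θ θ' η η' : ℕ → Ω → ℝ} {m m' δ : ℝ} (k : ℕ)
    (hθ : ∀ j, Measurable[𝓖 j] (θ j)) (hη : ∀ j, Measurable[𝓖 (j + 1)] (η j))
    (hη' : ∀ j, Measurable[𝓖 (j + 1)] (η' j))
    (hind : ∀ j < k, Indep (MeasurableSpace.comap (η j) inferInstance) (𝓖 j) P)
    (hind' : ∀ j < k, Indep (MeasurableSpace.comap (η' j) inferInstance) (𝓖 j) P)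
    (hm : ∀ j < k, ∫ ω, Complex.exp (η j ω * Complex.I) ∂P = m)
    (hm' : ∀ j < k, ∫ ω, Complex.exp (η' j ω * Complex.I) ∂P = m')
    (hm1 : m' ≤ 1) (hmm : m ≤ m')
    (hstep : ∀ j < k, ∀ᵐ ω ∂P, |θ (j + 1) ω - (θ j ω + η j ω)| ≤ δ)
    (hstep' : ∀ j < k, ∀ᵐ ω ∂P, |θ' j ω - (θ j ω + η' j ω)| ≤ δ) (hδ : 0 ≤ δ) :
    ∫⁻ ω, ‖∑ j ∈ Finset.range k, (Real.sin (θ' j ω) - Real.sin (θ j ω))‖ₑ ^ 2 ∂P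
      ≤ ENNReal.ofReal (3 * ((2 + 2 * k * δ) ^ 2 + k * (1 - m ^ 2) + k * (1 - m' ^ 2))) := by
  set ex : ℝ → ℂ := fun a => Complex.exp (a * Complex.I) with hex
  have hexm : Measurable ex := by fun_prop
  have hex1 : ∀ a, ‖ex a‖ = 1 := fun a => Complex.norm_exp_ofReal_mul_I a
  have hexadd : ∀ a b, ex (a + b) = ex a * ex b := fun a b => by
    simp only [hex]; rw [← Complex.exp_add]; push_cast; ring_nf
  have hexlip : ∀ a b, ‖ex a - ex b‖ ≤ |a - b| := norm_cexp_sub_cexp_le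
  set S : Ω → ℂ := fun ω => ∑ j ∈ Finset.range k, ex (θ j ω) * (ex (η j ω) - m) with hS
  set S' : Ω → ℂ := fun ω => ∑ j ∈ Finset.range k, ex (θ j ω) * (ex (η' j ω) - m') with hS'
  have hE := integral_norm_sq_sum_mul_sub (P := P) hmono hle (z := fun j ω => ex (θ j ω))
    (M := fun j ω => ex (η j ω)) (m := m) (fun j => hexm.comp (hθ j)) (fun j ω => hex1 _)
    (fun j => hexm.comp (hη j)) (fun j ω => hex1 _) k
    (fun j hj => indep_of_indep_of_le_left (hind j hj)
      (hexm.comp (comap_measurable (η j))).comap_le) hm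
  have hE' := integral_norm_sq_sum_mul_sub (P := P) hmono hle (z := fun j ω => ex (θ j ω))
    (M := fun j ω => ex (η' j ω)) (m := m') (fun j => hexm.comp (hθ j)) (fun j ω => hex1 _)
    (fun j => hexm.comp (hη' j)) (fun j ω => hex1 _) k
    (fun j hj => indep_of_indep_of_le_left (hind' j hj)
      (hexm.comp (comap_measurable (η' j))).comap_le) hm'
  have hθm : ∀ j, Measurable (θ j) := fun j => (hθ j).mono (hle j) le_rfl
  have hηm : ∀ j, Measurable (η j) := fun j => (hη j).mono (hle _) le_rfl
  have hη'm : ∀ j, Measurable (η' j) := fun j => (hη' j).mono (hle _) le_rfl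
  have hint : ∀ (η : ℕ → Ω → ℝ) (m : ℝ), (∀ j, Measurable (η j)) → Integrable
      (fun ω => ‖∑ j ∈ Finset.range k, ex (θ j ω) * (ex (η j ω) - m)‖ ^ 2) P := by
    intro η m hηm
    refine Integrable.of_bound ((Measurable.norm (Finset.measurable_sum _ fun j _ =>
      (hexm.comp (hθm j)).mul ((hexm.comp (hηm j)).sub_const _))).pow_const
        2).aestronglyMeasurable ((k * (1 + |m|)) ^ 2) (Filter.Eventually.of_forall fun ω => ?_)
    rw [Real.norm_of_nonneg (by positivity)]
    refine pow_le_pow_left₀ (norm_nonneg _) ?_ 2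
    refine (norm_sum_le _ _).trans ((Finset.sum_le_sum (g := fun _ => 1 + |m|) fun j _ => ?_).trans
      (by rw [Finset.sum_const, Finset.card_range, nsmul_eq_mul]))
    rw [norm_mul, hex1, one_mul]
    refine (norm_sub_le _ _).trans ?_
    rw [hex1, Complex.norm_real, Real.norm_eq_abs]
  have hpt : ∀ᵐ ω ∂P, ‖∑ j ∈ Finset.range k, (Real.sin (θ' j ω) - Real.sin (θ j ω))‖
      ≤ (2 + 2 * k * δ) + ‖S ω‖ + ‖S' ω‖ := by
    have h1 : ∀ᵐ ω ∂P, ∀ j ∈ Finset.range k, |θ (j + 1) ω - (θ j ω + η j ω)| ≤ δ :=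
      (Finset.eventually_all _).2 fun j hj => hstep j (Finset.mem_range.1 hj)
    have h2 : ∀ᵐ ω ∂P, ∀ j ∈ Finset.range k, |θ' j ω - (θ j ω + η' j ω)| ≤ δ :=
      (Finset.eventually_all _).2 fun j hj => hstep' j (Finset.mem_range.1 hj)
    filter_upwards [h1, h2] with ω h1 h2
    set R : ℂ := ∑ j ∈ Finset.range k, (ex (θ (j + 1) ω) - ex (θ j ω + η j ω)) with hR
    set R' : ℂ := ∑ j ∈ Finset.range k, (ex (θ' j ω) - ex (θ j ω + η' j ω)) with hR'
    set Z : ℂ := ∑ j ∈ Finset.range k, ex (θ j ω) with hZ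
    have hRb : ‖R‖ ≤ k * δ := by
      refine (norm_sum_le _ _).trans ((Finset.sum_le_sum fun j hj =>
        (hexlip _ _).trans (h1 j hj)).trans (by simp))
    have hRb' : ‖R'‖ ≤ k * δ := by
      refine (norm_sum_le _ _).trans ((Finset.sum_le_sum fun j hj =>
        (hexlip _ _).trans (h2 j hj)).trans (by simp))
    -- telescoping shows that `(1 - m) * Z` is bounded up to the martingale `S`
    have htel : (1 - (m : ℂ)) * Z = ex (θ 0 ω) - ex (θ k ω) + R + S ω := by
      have h3 := Finset.sum_range_sub (fun j => ex (θ j ω)) k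
      have h4 : ∑ j ∈ Finset.range k, (ex (θ (j + 1) ω) - ex (θ j ω))
          = R + S ω + ((m : ℂ) - 1) * Z := by
        rw [hR, hZ, hS, ← Finset.sum_add_distrib, Finset.mul_sum, ← Finset.sum_add_distrib]
        refine Finset.sum_congr rfl fun j _ => ?_
        rw [hexadd]; ring
      linear_combination h4 - h3
    have hsplit : ∑ j ∈ Finset.range k, (ex (θ' j ω) - ex (θ j ω))
        = R' + S' ω + ((m' : ℂ) - 1) * Z := by
      rw [hR', hZ, hS', ← Finset.sum_add_distrib, Finset.mul_sum, ← Finset.sum_add_distrib]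
      refine Finset.sum_congr rfl fun j _ => ?_
      rw [hexadd]; ring
    have hZb : (1 - m) * ‖Z‖ ≤ 2 + k * δ + ‖S ω‖ := by
      have h5 : ‖(1 - (m : ℂ)) * Z‖ = (1 - m) * ‖Z‖ := by
        rw [norm_mul, ← Complex.ofReal_one, ← Complex.ofReal_sub, Complex.norm_real,
          Real.norm_of_nonneg (by linarith)]
      rw [← h5, htel]
      have h6 := norm_add_le (ex (θ 0 ω) - ex (θ k ω) + R) (S ω)
      have h7 := norm_add_le (ex (θ 0 ω) - ex (θ k ω)) R
      have h8 := norm_sub_le (ex (θ 0 ω)) (ex (θ k ω))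
      rw [hex1, hex1] at h8
      linarith
    have hmZ : ‖((m' : ℂ) - 1) * Z‖ ≤ (1 - m) * ‖Z‖ := by
      rw [norm_mul, ← Complex.ofReal_one, ← Complex.ofReal_sub, Complex.norm_real,
        Real.norm_eq_abs, abs_sub_comm, abs_of_nonneg (by linarith)]
      exact mul_le_mul_of_nonneg_right (by linarith) (norm_nonneg _)
    have him : ∑ j ∈ Finset.range k, (Real.sin (θ' j ω) - Real.sin (θ j ω))
        = (∑ j ∈ Finset.range k, (ex (θ' j ω) - ex (θ j ω))).im := by
      rw [Complex.im_sum]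
      refine Finset.sum_congr rfl fun j _ => ?_
      rw [Complex.sub_im, hex]
      simp only [Complex.exp_ofReal_mul_I_im]
    rw [him, Real.norm_eq_abs]
    refine (Complex.abs_im_le_norm _).trans ?_
    rw [hsplit]
    have h9 := norm_add_le (R' + S' ω) (((m' : ℂ) - 1) * Z)
    have h10 := norm_add_le R' (S' ω)
    linarith
  calc ∫⁻ ω, ‖∑ j ∈ Finset.range k, (Real.sin (θ' j ω) - Real.sin (θ j ω))‖ₑ ^ 2 ∂P
      ≤ ∫⁻ ω, ENNReal.ofReal (3 * ((2 + 2 * k * δ) ^ 2 + ‖S ω‖ ^ 2 + ‖S' ω‖ ^ 2)) ∂P := by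
        refine lintegral_mono_ae ?_
        filter_upwards [hpt] with ω hω
        rw [← ofReal_norm, ← ENNReal.ofReal_pow (norm_nonneg _)]
        refine ENNReal.ofReal_le_ofReal ((pow_le_pow_left₀ (norm_nonneg _) hω 2).trans ?_)
        nlinarith [sq_nonneg (2 + 2 * k * δ - ‖S ω‖), sq_nonneg (2 + 2 * k * δ - ‖S' ω‖),
          sq_nonneg (‖S ω‖ - ‖S' ω‖)]
    _ = ENNReal.ofReal (∫ ω, 3 * ((2 + 2 * k * δ) ^ 2 + ‖S ω‖ ^ 2 + ‖S' ω‖ ^ 2) ∂P) := by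
        rw [ofReal_integral_eq_lintegral_ofReal]
        · exact (((integrable_const _).add (hint η m hηm)).add (hint η' m' hη'm)).const_mul 3
        · exact Filter.Eventually.of_forall fun ω => by positivity
    _ = _ := by
        have h12 : Integrable (fun ω => (2 + 2 * k * δ) ^ 2 + ‖S ω‖ ^ 2) P :=
          (integrable_const _).add (hint η m hηm)
        rw [integral_const_mul, integral_add h12 (hint η' m' hη'm),
          integral_add (integrable_const _) (hint η m hηm)]
        rw [hE, hE']
        simp

end Phase

/-! ### A jointly measurable evaluation on `L²` -/

section Eval

variable {X : Type*} {mX : MeasurableSpace X} {μ : Measure X}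

/-- The space `L²(μ)` carries its Borel `σ`-algebra. -/
noncomputable instance instMeasurableSpaceLp : MeasurableSpace (Lp ℝ 2 μ) := borel _

instance instBorelSpaceLp : BorelSpace (Lp ℝ 2 μ) := ⟨rfl⟩

/-- On a separable `L²` space, representatives can be chosen jointly measurably in the class and
the point. -/
lemma exists_measurable_eval [TopologicalSpace.SeparableSpace (Lp ℝ 2 μ)] :
    ∃ ev : Lp ℝ 2 μ → X → ℝ, Measurable (Function.uncurry ev) ∧ ∀ v, ev v =ᵐ[μ] v := by
  classical
  let f : ℕ → Lp ℝ 2 μ := TopologicalSpace.denseSeq _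
  have hex : ∀ (m : ℕ) (v : Lp ℝ 2 μ), ∃ n, dist v (f n) < (1 / 2) ^ m := fun m v =>
    (TopologicalSpace.denseRange_denseSeq (Lp ℝ 2 μ)).exists_dist_lt v (by positivity)
  let N : ℕ → Lp ℝ 2 μ → ℕ := fun m v => Nat.find (hex m v)
  have hN : ∀ m, Measurable (N m) := fun m => measurable_find (hex m) fun n =>
    (isOpen_lt (by fun_prop) (by fun_prop)).measurableSet
  have hNspec : ∀ m v, dist v (f (N m v)) < (1 / 2) ^ m := fun m v => Nat.find_spec (hex m v)
  have hf : Measurable fun p : ℕ × X => f p.1 p.2 :=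
    measurable_from_prod_countable_right fun n => (Lp.stronglyMeasurable (f n)).measurable
  have hg : ∀ m, Measurable fun p : Lp ℝ 2 μ × X => f (N m p.1) p.2 := fun m =>
    hf.comp (((hN m).comp measurable_fst).prodMk measurable_snd)
  refine ⟨fun v x => Filter.limUnder Filter.atTop fun m => f (N m v) x, ?_, fun v => ?_⟩
  · exact (StronglyMeasurable.limUnder fun m => (hg m).stronglyMeasurable).measurable
  · have htend : Filter.Tendsto (fun m => f (N m v)) Filter.atTop (nhds v) := by
      rw [tendsto_iff_dist_tendsto_zero]
      refine squeeze_zero (fun _ => dist_nonneg) (fun m => ?_)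
        (tendsto_pow_atTop_nhds_zero_of_lt_one (by norm_num) (by norm_num : (1 / 2 : ℝ) < 1))
      rw [dist_comm]
      exact (hNspec m v).le
    have hcau : ∀ᵐ x ∂μ, ∃ l : ℝ,
        Filter.Tendsto (fun m => f (N m v) x) Filter.atTop (nhds l) := by
      refine Lp.ae_tendsto_of_cauchy_eLpNorm (p := 2) (f := fun m => f (N m v))
        (B := fun m => ENNReal.ofReal (2 * (1 / 2) ^ m))
        (fun n => (Lp.stronglyMeasurable _).aestronglyMeasurable) one_le_two ?_ ?_
      · rw [← ENNReal.ofReal_tsum_of_nonneg (fun _ => by positivity)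
          ((summable_geometric_of_lt_one (by norm_num) (by norm_num)).mul_left 2)]
        exact ENNReal.ofReal_ne_top
      · intro L n m hn hm
        rw [← eLpNorm_congr_ae (Lp.coeFn_sub (f (N n v)) (f (N m v))), ← Lp.enorm_def,
          ← ofReal_norm, ← dist_eq_norm]
        refine (ENNReal.ofReal_lt_ofReal_iff (by positivity)).2 ?_
        have h1 := dist_triangle_left (f (N n v)) (f (N m v)) v
        have h2 := hNspec n v
        have h3 := hNspec m v
        have h4 : (1 / 2 : ℝ) ^ n ≤ (1 / 2) ^ L :=
          pow_le_pow_of_le_one (by norm_num) (by norm_num) hn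
        have h5 : (1 / 2 : ℝ) ^ m ≤ (1 / 2) ^ L :=
          pow_le_pow_of_le_one (by norm_num) (by norm_num) hm
        linarith
    obtain ⟨ns, hns, hlim⟩ := (tendstoInMeasure_of_tendsto_Lp htend).exists_seq_tendsto_ae
    filter_upwards [hcau, hlim] with x ⟨l, hl⟩ hx
    rw [hl.limUnder_eq]
    exact tendsto_nhds_unique (hl.comp hns.tendsto_atTop) hx

end Eval

/-! ### Estimates for the interaction operator -/

instance instIsProbabilityMeasureCube (d : ℕ) : IsProbabilityMeasure (cubeMeasure d) := by
  refine ⟨?_⟩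
  rw [Measure.restrict_apply_univ, cube, Real.volume_Icc_pi]
  simp

section CauchySchwarz

variable {X : Type*} {mX : MeasurableSpace X} {μ : Measure X}

lemma lintegral_mul_sq_le {f g : X → ℝ≥0∞} (hf : AEMeasurable f μ) (hg : AEMeasurable g μ) :
    (∫⁻ x, f x * g x ∂μ) ^ 2 ≤ (∫⁻ x, f x ^ 2 ∂μ) * ∫⁻ x, g x ^ 2 ∂μ := by
  have h := ENNReal.lintegral_mul_le_Lp_mul_Lq μ Real.HolderConjugate.two_two hf hg
  simp only [Pi.mul_apply, ENNReal.rpow_ofNat] at h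
  refine (pow_le_pow_left₀ zero_le h 2).trans_eq ?_
  rw [mul_pow, ← ENNReal.rpow_natCast, ← ENNReal.rpow_natCast, ← ENNReal.rpow_mul,
    ← ENNReal.rpow_mul]
  norm_num

lemma enorm_integral_mul_sq_le {a b : X → ℝ} (ha : AEMeasurable a μ) (hb : AEMeasurable b μ) :
    ‖∫ x, a x * b x ∂μ‖ₑ ^ 2 ≤ (∫⁻ x, ‖a x‖ₑ ^ 2 ∂μ) * ∫⁻ x, ‖b x‖ₑ ^ 2 ∂μ := by
  refine le_trans (pow_le_pow_left₀ zero_le ((enorm_integral_le_lintegral_enorm _).trans_eq ?_) 2)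
    (lintegral_mul_sq_le ha.enorm hb.enorm)
  simp_rw [enorm_mul]

lemma eLpNorm_two_sq {E : Type*} [NormedAddCommGroup E] (f : X → E) :
    eLpNorm f 2 μ ^ 2 = ∫⁻ x, ‖f x‖ₑ ^ 2 ∂μ := by
  have h := eLpNorm_nnreal_pow_eq_lintegral (f := f) (μ := μ) (p := 2) two_ne_zero
  simpa using h

lemma enorm_Lp_sq (f : Lp ℝ 2 μ) : ‖f‖ₑ ^ 2 = ∫⁻ x, ‖f x‖ₑ ^ 2 ∂μ := by
  rw [Lp.enorm_def, eLpNorm_two_sq]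

lemma enorm_Lp_sub_sq (f g : Lp ℝ 2 μ) : ‖f - g‖ₑ ^ 2 = ∫⁻ x, ‖f x - g x‖ₑ ^ 2 ∂μ := by
  rw [enorm_Lp_sq]
  refine lintegral_congr_ae ?_
  filter_upwards [Lp.coeFn_sub f g] with x hx
  rw [hx, Pi.sub_apply]

lemma measurable_Lp (f : Lp ℝ 2 μ) : Measurable f := (Lp.stronglyMeasurable f).measurable

lemma le_sqrt_mul_of_sq_le {a b : ℝ≥0∞} {c : ℝ≥0} (h : a ^ 2 ≤ c * b ^ 2) :
    a ≤ (NNReal.sqrt c : ℝ≥0) * b := by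
  refine (ENNReal.pow_le_pow_left_iff two_ne_zero).1 (h.trans_eq ?_)
  rw [mul_pow, ← ENNReal.coe_pow, NNReal.sq_sqrt]

end CauchySchwarz

lemma abs_kuramotoS_le (a b : ℝ) : |kuramotoS a b| ≤ 1 := Real.abs_sin_le_one _

lemma enorm_kuramotoS_le (a b : ℝ) : ‖kuramotoS a b‖ₑ ≤ 1 := by
  rw [← ofReal_norm, Real.norm_eq_abs]
  exact ENNReal.ofReal_le_one.2 (abs_kuramotoS_le a b)

lemma abs_kuramotoS_sub_le (a b a' b' : ℝ) :
    |kuramotoS a b - kuramotoS a' b'| ≤ 2 * Real.pi * (|a - a'| + |b - b'|) := by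
  have hlip : ∀ s t : ℝ, |Real.sin s - Real.sin t| ≤ |s - t| := fun s t => by
    have := Real.lipschitzWith_sin.dist_le_mul s t
    simpa [Real.dist_eq] using this
  refine (hlip _ _).trans ?_
  rw [← mul_sub, abs_mul, abs_of_pos (by positivity)]
  refine mul_le_mul_of_nonneg_left ?_ (by positivity)
  have : a - b - (a' - b') = (a - a') - (b - b') := by ring
  rw [this]
  exact abs_sub _ _

lemma Measurable.kuramotoS {X : Type*} [MeasurableSpace X] {f g : X → ℝ} (hf : Measurable f)
    (hg : Measurable g) : Measurable fun x => kuramotoS (f x) (g x) := by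
  unfold KuramotoGalerkin.kuramotoS
  fun_prop

lemma measurable_kuramotoS_coeFn {d : ℕ} (u : StateSpace d) (a : ℝ) :
    Measurable fun y => kuramotoS a (u y) :=
  Measurable.kuramotoS measurable_const (measurable_Lp u)

section Kernel

variable {d : ℕ} {K : (Fin d → ℝ) → (Fin d → ℝ) → ℝ} {κ : ℝ≥0}

/-- `∫ |K(x,y)|² dy ≤ κ` for almost every `x`. -/
def RowBound (K : (Fin d → ℝ) → (Fin d → ℝ) → ℝ) (κ : ℝ≥0) : Prop :=
  ∀ᵐ x ∂(cubeMeasure d), ∫⁻ y, ‖K x y‖ₑ ^ 2 ∂(cubeMeasure d) ≤ κ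

lemma IsAdmissibleKernel.exists_rowBound (hK : IsAdmissibleKernel K) : ∃ κ, RowBound K κ := by
  refine ⟨(essSup (fun x => ∫⁻ y, ‖K x y‖ₑ ^ 2 ∂(cubeMeasure d)) (cubeMeasure d)).toNNReal, ?_⟩
  rw [RowBound, ENNReal.coe_toNNReal hK.essSup_left.ne]
  exact ENNReal.ae_le_essSup _

lemma coeFn_interactionOp (hK : IsAdmissibleKernel K) (v : StateSpace d) :
    interactionOp K kuramotoS v =ᵐ[cubeMeasure d] interactionFun K kuramotoS v := by
  rw [interactionOp, dif_pos (memLp_interactionFun hK v)]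
  exact MemLp.coeFn_toLp _

lemma IsAdmissibleKernel.measurable_row (hK : IsAdmissibleKernel K) (x : Fin d → ℝ) :
    Measurable (K x) :=
  hK.measurable.comp measurable_prodMk_left

lemma integrable_row_mul (hK : IsAdmissibleKernel K) {x : Fin d → ℝ}
    (hx : ∫⁻ y, ‖K x y‖ₑ ^ 2 ∂(cubeMeasure d) ≤ κ) {G : (Fin d → ℝ) → ℝ} (hG : Measurable G)
    (hG1 : ∀ y, |G y| ≤ 1) : Integrable (fun y => K x y * G y) (cubeMeasure d) := by
  have h2 : MemLp (K x) 2 (cubeMeasure d) := by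
    refine ⟨(hK.measurable_row x).aestronglyMeasurable, ?_⟩
    refine (ENNReal.pow_lt_top_iff (n := 2)).1 ?_ |>.resolve_right two_ne_zero
    rw [eLpNorm_two_sq]
    exact hx.trans_lt ENNReal.coe_lt_top
  exact (h2.integrable one_le_two).mul_bdd (c := 1) hG.aestronglyMeasurable
    (Filter.Eventually.of_forall hG1)

lemma ae_abs_interactionOp_le (hK : IsAdmissibleKernel K) (hκ : RowBound K κ) (v : StateSpace d) :
    ∀ᵐ x ∂(cubeMeasure d), |interactionOp K kuramotoS v x| ≤ NNReal.sqrt κ := by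
  filter_upwards [coeFn_interactionOp hK v, hκ] with x hx hxκ
  rw [hx, interactionFun]
  have h1 : Measurable fun y => kuramotoS (v x) (v y) :=
    measurable_kuramotoS_coeFn v _
  have h := enorm_integral_mul_sq_le (μ := cubeMeasure d) (hK.measurable_row x).aemeasurable
    h1.aemeasurable
  have h2 : ∫⁻ y, ‖kuramotoS (v x) (v y)‖ₑ ^ 2 ∂(cubeMeasure d) ≤ 1 := by
    refine (lintegral_mono fun y => pow_le_one₀ zero_le (enorm_kuramotoS_le _ _)).trans ?_
    simp
  have h3 := le_sqrt_mul_of_sq_le (b := 1) (c := κ)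
    (h.trans ((mul_le_mul' hxκ h2).trans_eq (by simp)))
  rw [mul_one] at h3
  have h4 : ‖∫ y, K x y * kuramotoS (v x) (v y) ∂(cubeMeasure d)‖₊ ≤ NNReal.sqrt κ :=
    ENNReal.coe_le_coe.1 h3
  exact h4

lemma norm_interactionOp_le (hK : IsAdmissibleKernel K) (hκ : RowBound K κ) (v : StateSpace d) :
    ‖interactionOp K kuramotoS v‖ ≤ NNReal.sqrt κ := by
  have h := Lp.norm_le_of_ae_bound (f := interactionOp K kuramotoS v) (NNReal.sqrt κ).coe_nonneg
    (ae_abs_interactionOp_le hK hκ v)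
  have h1 : measureUnivNNReal (cubeMeasure d) = 1 := by
    rw [← ENNReal.coe_inj, coe_measureUnivNNReal, measure_univ, ENNReal.coe_one]
  simpa [h1] using h

/-- Differences of the interaction operator are controlled by differences of the interaction
function, in `L²` of both variables. -/
lemma enorm_sum_interactionOp_sub_sq_le (hK : IsAdmissibleKernel K) (hκ : RowBound K κ)
    {ι : Type*} (s : Finset ι) (v w : ι → StateSpace d) :
    ‖∑ i ∈ s, (interactionOp K kuramotoS (v i) - interactionOp K kuramotoS (w i))‖ₑ ^ 2
      ≤ κ * ∫⁻ x, ∫⁻ y, ‖∑ i ∈ s, (kuramotoS (v i x) (v i y)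
        - kuramotoS (w i x) (w i y))‖ₑ ^ 2 ∂(cubeMeasure d) ∂(cubeMeasure d) := by
  have hS : ∀ (u : StateSpace d) (x : Fin d → ℝ), Measurable fun y => kuramotoS (u x) (u y) :=
    fun u x => measurable_kuramotoS_coeFn u _
  rw [enorm_Lp_sq, ← lintegral_const_mul' _ _ ENNReal.coe_ne_top]
  refine lintegral_mono_ae ?_
  have h1 : ∀ᵐ x ∂(cubeMeasure d), ∀ i ∈ s, interactionOp K kuramotoS (v i) x
      = interactionFun K kuramotoS (v i) x :=
    (Finset.eventually_all _).2 fun i _ => coeFn_interactionOp hK (v i)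
  have h2 : ∀ᵐ x ∂(cubeMeasure d), ∀ i ∈ s, interactionOp K kuramotoS (w i) x
      = interactionFun K kuramotoS (w i) x :=
    (Finset.eventually_all _).2 fun i _ => coeFn_interactionOp hK (w i)
  have h3 : ∀ᵐ x ∂(cubeMeasure d), ∀ i ∈ s,
      (interactionOp K kuramotoS (v i) - interactionOp K kuramotoS (w i)) x
      = interactionOp K kuramotoS (v i) x - interactionOp K kuramotoS (w i) x :=
    (Finset.eventually_all _).2 fun i _ => Lp.coeFn_sub _ _
  filter_upwards [hκ, h1, h2, h3, Lp.coeFn_finsetSum s fun i =>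
    interactionOp K kuramotoS (v i) - interactionOp K kuramotoS (w i)] with x hx h1 h2 h3 h4
  have hi : ∀ u : StateSpace d,
      Integrable (fun y => K x y * kuramotoS (u x) (u y)) (cubeMeasure d) := fun u =>
    integrable_row_mul hK hx (hS u x) fun y => abs_kuramotoS_le _ _
  have his : ∀ i ∈ s, Integrable (fun y => K x y * kuramotoS (v i x) (v i y)
      - K x y * kuramotoS (w i x) (w i y)) (cubeMeasure d) := fun i _ => (hi _).sub (hi _)
  have heq : (∑ i ∈ s, (interactionOp K kuramotoS (v i) - interactionOp K kuramotoS (w i)) :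
      StateSpace d) x = ∫ y, K x y * ∑ i ∈ s, (kuramotoS (v i x) (v i y)
        - kuramotoS (w i x) (w i y)) ∂(cubeMeasure d) := by
    rw [h4]
    simp_rw [Finset.mul_sum, mul_sub]
    rw [integral_finsetSum _ his]
    simp only [Finset.sum_apply]
    refine Finset.sum_congr rfl fun i his => ?_
    rw [h3 i his, h1 i his, h2 i his, integral_sub (hi _) (hi _)]
    rfl
  rw [heq]
  refine (enorm_integral_mul_sq_le (hK.measurable_row x).aemeasurable ?_).trans
    (mul_le_mul_left hx _)
  exact (Finset.measurable_sum _ fun i _ => (hS (v i) x).sub (hS (w i) x)).aemeasurable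

lemma enorm_interactionOp_sub_le (hK : IsAdmissibleKernel K) (hκ : RowBound K κ)
    (v w : StateSpace d) :
    ‖interactionOp K kuramotoS v - interactionOp K kuramotoS w‖ₑ
      ≤ (NNReal.sqrt (κ * (16 * NNReal.pi ^ 2)) : ℝ≥0) * ‖v - w‖ₑ := by
  refine le_sqrt_mul_of_sq_le ?_
  have h := enorm_sum_interactionOp_sub_sq_le hK hκ ({()} : Finset Unit) (fun _ => v) (fun _ => w)
  simp only [Finset.sum_singleton] at h
  refine h.trans ?_
  rw [ENNReal.coe_mul, mul_assoc]
  refine mul_le_mul_right ?_ _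
  have hpt : ∀ x y, ‖kuramotoS (v x) (v y) - kuramotoS (w x) (w y)‖ₑ ^ 2
      ≤ ((8 * NNReal.pi ^ 2 : ℝ≥0) : ℝ≥0∞) * (‖v x - w x‖ₑ ^ 2 + ‖v y - w y‖ₑ ^ 2) := by
    intro x y
    simp only [enorm_eq_nnnorm]
    norm_cast
    rw [← NNReal.coe_le_coe]
    push_cast
    simp only [Real.norm_eq_abs]
    refine (pow_le_pow_left₀ (abs_nonneg _) (abs_kuramotoS_sub_le _ _ _ _) 2).trans ?_
    rw [mul_pow, show (8 : ℝ) * NNReal.pi ^ 2 * (|v x - w x| ^ 2 + |v y - w y| ^ 2)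
      = (2 * Real.pi) ^ 2 * (2 * (|v x - w x| ^ 2 + |v y - w y| ^ 2)) by
        rw [NNReal.coe_real_pi]; ring]
    refine mul_le_mul_of_nonneg_left ?_ (by positivity)
    nlinarith [sq_nonneg (|v x - w x| - |v y - w y|)]
  have hδ : Measurable fun x => ‖v x - w x‖ₑ ^ 2 :=
    ((measurable_Lp v).sub (measurable_Lp w)).enorm.pow_const 2
  calc _ ≤ ∫⁻ x, ∫⁻ y, ((8 * NNReal.pi ^ 2 : ℝ≥0) : ℝ≥0∞)
        * (‖v x - w x‖ₑ ^ 2 + ‖v y - w y‖ₑ ^ 2) ∂(cubeMeasure d) ∂(cubeMeasure d) :=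
        lintegral_mono fun x => lintegral_mono fun y => hpt x y
    _ = ((8 * NNReal.pi ^ 2 : ℝ≥0) : ℝ≥0∞) * (‖v - w‖ₑ ^ 2 + ‖v - w‖ₑ ^ 2) := by
        simp_rw [lintegral_const_mul' _ _ ENNReal.coe_ne_top, lintegral_add_left measurable_const,
          lintegral_const, measure_univ, mul_one, ← enorm_Lp_sub_sq]
        rw [lintegral_add_left hδ, ← enorm_Lp_sub_sq]
        simp
    _ = _ := by push_cast; ring

lemma continuous_interactionOp (hK : IsAdmissibleKernel K) :
    Continuous (interactionOp K kuramotoS) := by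
  obtain ⟨κ, hκ⟩ := hK.exists_rowBound
  refine LipschitzWith.continuous (K := NNReal.sqrt (κ * (16 * NNReal.pi ^ 2))) fun v w => ?_
  rw [edist_eq_enorm_sub, edist_eq_enorm_sub]
  exact enorm_interactionOp_sub_le hK hκ v w

lemma enorm_interactionOp_sub_kernel_sq_le {K' : (Fin d → ℝ) → (Fin d → ℝ) → ℝ}
    (hK : IsAdmissibleKernel K) (hK' : IsAdmissibleKernel K') (v : StateSpace d) :
    ‖interactionOp K kuramotoS v - interactionOp K' kuramotoS v‖ₑ ^ 2
      ≤ ∫⁻ x, ∫⁻ y, ‖K x y - K' x y‖ₑ ^ 2 ∂(cubeMeasure d) ∂(cubeMeasure d) := by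
  obtain ⟨κ, hκ⟩ := hK.exists_rowBound
  obtain ⟨κ', hκ'⟩ := hK'.exists_rowBound
  rw [enorm_Lp_sub_sq]
  refine lintegral_mono_ae ?_
  filter_upwards [hκ, hκ', coeFn_interactionOp hK v, coeFn_interactionOp hK' v] with x h1 h2 h3 h4
  have hS : Measurable fun y => kuramotoS (v x) (v y) :=
    measurable_kuramotoS_coeFn v _
  rw [h3, h4, interactionFun, interactionFun, ← integral_sub
    (integrable_row_mul hK h1 hS fun y => abs_kuramotoS_le _ _)
    (integrable_row_mul hK' h2 hS fun y => abs_kuramotoS_le _ _)]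
  simp_rw [← sub_mul]
  refine (enorm_integral_mul_sq_le
    ((hK.measurable_row x).sub (hK'.measurable_row x)).aemeasurable hS.aemeasurable).trans ?_
  refine (mul_le_mul_right (?_ : _ ≤ (1 : ℝ≥0∞)) _).trans_eq (mul_one _)
  refine (lintegral_mono fun y => pow_le_one₀ zero_le (enorm_kuramotoS_le _ _)).trans ?_
  simp

end Kernel

/-! ### Cell averages and the modulus of continuity -/

section Modulus

variable {ι : Type}

lemma mem_cube {x : ι → ℝ} : x ∈ cube ι ↔ ∀ j, 0 ≤ x j ∧ x j ≤ 1 := by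
  simp only [cube, Set.mem_Icc, Pi.le_def, Pi.zero_apply, Pi.one_apply, forall_and]

/-- The cell of the uniform partition of mesh `1 / n` that contains `x`. -/
def cellAt (n : ℕ) (x : ι → ℝ) : Set (ι → ℝ) :=
  Set.univ.pi fun j => Set.Ioc (((⌈n * x j⌉ : ℝ) - 1) / n) ((⌈n * x j⌉ : ℝ) / n)

lemma mem_cellAt {n : ℕ} (hn : 1 ≤ n) {x y : ι → ℝ} :
    y ∈ cellAt n x ↔ ∀ j, ⌈n * y j⌉ = ⌈n * x j⌉ := by
  have hn0 : (0 : ℝ) < n := by exact_mod_cast hn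
  simp only [cellAt, Set.mem_univ_pi, Set.mem_Ioc]
  refine forall_congr' fun j => ?_
  rw [Int.ceil_eq_iff, div_lt_iff₀' hn0, le_div_iff₀' hn0]

lemma abs_sub_le_of_mem_cellAt {n : ℕ} (hn : 1 ≤ n) {x y : ι → ℝ} (hy : y ∈ cellAt n x) (j : ι) :
    |y j - x j| ≤ 1 / n := by
  have hn0 : (0 : ℝ) < n := by exact_mod_cast hn
  have h := (mem_cellAt hn).1 hy j
  have h1 := Int.le_ceil ((n : ℝ) * y j)
  have h2 := Int.ceil_lt_add_one ((n : ℝ) * y j)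
  have h3 := Int.le_ceil ((n : ℝ) * x j)
  have h4 := Int.ceil_lt_add_one ((n : ℝ) * x j)
  rw [h] at h1 h2
  have h5 : |(n : ℝ) * (y j - x j)| ≤ 1 := by rw [abs_le]; constructor <;> nlinarith
  rwa [abs_mul, abs_of_pos hn0, ← le_div_iff₀' hn0] at h5

lemma cellAt_subset_cube {n : ℕ} (hn : 1 ≤ n) {x : ι → ℝ} (hx : ∀ j, 0 < x j ∧ x j ≤ 1) :
    cellAt n x ⊆ cube ι := by
  intro y hy
  rw [mem_cube]
  intro j
  have hn0 : (0 : ℝ) < n := by exact_mod_cast hn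
  have h1 : 0 < ⌈n * x j⌉ := Int.ceil_pos.2 (mul_pos hn0 (hx j).1)
  have h2 : ⌈n * x j⌉ ≤ n := Int.ceil_le.2 (by
    push_cast
    exact mul_le_of_le_one_right hn0.le (hx j).2)
  obtain ⟨h3, h4⟩ := hy j (Set.mem_univ j)
  have h5 : (1 : ℝ) ≤ ⌈n * x j⌉ := by exact_mod_cast h1
  have h6 : (⌈n * x j⌉ : ℝ) ≤ n := by exact_mod_cast h2
  refine ⟨(lt_of_le_of_lt (div_nonneg (by linarith) hn0.le) h3).le, h4.trans ?_⟩
  rw [div_le_one hn0]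
  exact h6

variable [Fintype ι]

lemma measurableSet_cube : MeasurableSet (cube ι) := measurableSet_Icc

lemma measurableSet_cube_shift (h : ι → ℝ) :
    MeasurableSet {x | x ∈ cube ι ∧ x + h ∈ cube ι} :=
  measurableSet_cube.inter (measurableSet_cube.preimage (measurable_add_const h))

lemma eLpNorm_shift_le_l2Modulus (φ : (ι → ℝ) → ℝ) {δ : ℝ} {h : ι → ℝ}
    (hh : ∑ i, h i ^ 2 ≤ δ ^ 2) :
    eLpNorm (fun x => φ (x + h) - φ x) 2 (volume.restrict {x | x ∈ cube ι ∧ x + h ∈ cube ι})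
      ≤ l2Modulus φ δ :=
  le_iSup₂ (f := fun (h : ι → ℝ) (_ : ∑ i, h i ^ 2 ≤ δ ^ 2) =>
    eLpNorm (fun x => φ (x + h) - φ x) 2 (volume.restrict {x | x ∈ cube ι ∧ x + h ∈ cube ι})) h hh

/-- A shift by `h` is the composition of `N` shifts by `h / N`, and the intermediate points stay in
the cube by convexity. -/
lemma l2Modulus_nat_mul_le {φ : (ι → ℝ) → ℝ} (hφ : Measurable φ) (δ : ℝ) {N : ℕ} (hN : N ≠ 0) :
    l2Modulus φ (N * δ) ≤ N * l2Modulus φ δ := by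
  refine iSup₂_le fun h hh => ?_
  have hN0 : (N : ℝ) ≠ 0 := Nat.cast_ne_zero.2 hN
  set p : ι → ℝ := (N : ℝ)⁻¹ • h with hp
  have hpN : (N : ℝ) • p = h := by rw [hp, smul_smul, mul_inv_cancel₀ hN0, one_smul]
  have hpδ : ∑ i, p i ^ 2 ≤ δ ^ 2 := by
    have h1 : ∑ i, h i ^ 2 = (N : ℝ) ^ 2 * ∑ i, p i ^ 2 := by
      rw [Finset.mul_sum]
      refine Finset.sum_congr rfl fun i _ => ?_
      rw [← hpN, Pi.smul_apply, smul_eq_mul, mul_pow]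
    rw [h1, mul_pow] at hh
    exact le_of_mul_le_mul_left hh (by positivity)
  have htel : (fun x => φ (x + h) - φ x) = ∑ j ∈ Finset.range N,
      fun x => φ (x + (j : ℝ) • p + p) - φ (x + (j : ℝ) • p) := by
    funext x
    have h1 := Finset.sum_range_sub (fun j : ℕ => φ (x + (j : ℝ) • p)) N
    rw [Finset.sum_apply, ← hpN]
    simp only [Nat.cast_zero, zero_smul, add_zero] at h1
    rw [← h1]
    refine Finset.sum_congr rfl fun j _ => ?_
    rw [add_assoc x, Nat.cast_succ, add_smul, one_smul]
  rw [htel]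
  refine (eLpNorm_sum_le (fun j _ => ?_) one_le_two).trans ?_
  · exact Measurable.aestronglyMeasurable (by fun_prop)
  · refine (Finset.sum_le_sum (g := fun _ => l2Modulus φ δ) fun j hj => ?_).trans (by simp)
    refine le_trans ?_ (eLpNorm_shift_le_l2Modulus φ hpδ)
    have hmp : MeasurePreserving (fun x : ι → ℝ => x + (j : ℝ) • p) volume volume :=
      measurePreserving_add_right volume _
    have hmp' := hmp.restrict_preimage (measurableSet_cube_shift p)
    have hcomp := eLpNorm_comp_measurePreserving (p := 2)
      (g := fun x => φ (x + p) - φ x) (Measurable.aestronglyMeasurable (by fun_prop)) hmp'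
    rw [← hcomp]
    refine eLpNorm_mono_measure _ (Measure.restrict_mono ?_ le_rfl)
    rintro x ⟨hx, hxh⟩
    have hjN : (j : ℝ) + 1 ≤ N := by exact_mod_cast Finset.mem_range.1 hj
    have hconv : ∀ s : ℝ, 0 ≤ s → s ≤ N → x + s • p ∈ cube ι := fun s hs0 hsN => by
      have h1 : x + s • p = (1 - s / N) • x + (s / N) • (x + h) := by
        rw [hp, smul_add, smul_smul, sub_smul, one_smul, div_eq_mul_inv]
        abel
      rw [h1]
      refine (convex_Icc 0 1) hx hxh ?_ (by positivity) (by ring)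
      rw [sub_nonneg, div_le_one (by positivity)]
      exact hsN
    refine ⟨hconv j (by positivity) (by linarith), ?_⟩
    have h2 := hconv (j + 1) (by positivity) hjN
    rwa [add_smul, one_smul, ← add_assoc] at h2

/-- The mean value of `φ` over the cell containing `x`. -/
noncomputable def cellMean (n : ℕ) (φ : (ι → ℝ) → ℝ) (x : ι → ℝ) : ℝ :=
  (n : ℝ) ^ Fintype.card ι * ∫ y in cellAt n x, φ y

lemma measurableSet_cellAt (n : ℕ) (x : ι → ℝ) : MeasurableSet (cellAt n x) :=
  MeasurableSet.univ_pi fun _ => measurableSet_Ioc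

lemma volume_cellAt {n : ℕ} (hn : 1 ≤ n) (x : ι → ℝ) :
    volume (cellAt n x) = ((n : ℝ≥0∞) ^ Fintype.card ι)⁻¹ := by
  have hn0 : (0 : ℝ) < n := by exact_mod_cast hn
  rw [cellAt, Real.volume_pi_Ioc]
  have h1 : ∀ j, ENNReal.ofReal ((⌈n * x j⌉ : ℝ) / n - ((⌈n * x j⌉ : ℝ) - 1) / n)
      = (n : ℝ≥0∞)⁻¹ := fun j => by
    rw [← sub_div, sub_sub_cancel, one_div, ENNReal.ofReal_inv_of_pos hn0, ENNReal.ofReal_natCast]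
  simp [h1, ENNReal.inv_pow]

lemma ae_cube_pos :
    ∀ᵐ x ∂(volume.restrict (cube ι)), ∀ j, 0 < x j ∧ x j ≤ 1 := by
  have h : (Set.univ.pi fun _ : ι => Set.Ioc (0 : ℝ) 1) =ᵐ[volume] cube ι :=
    Measure.univ_pi_Ioc_ae_eq_Icc
  rw [← Measure.restrict_congr_set h]
  filter_upwards [ae_restrict_mem (MeasurableSet.univ_pi fun _ => measurableSet_Ioc)] with x hx j
  exact hx j (Set.mem_univ j)

lemma enorm_sub_cellMean_sq_le {n : ℕ} (hn : 1 ≤ n) {φ : (ι → ℝ) → ℝ} (hφ : Measurable φ)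
    (hφi : IntegrableOn φ (cube ι)) {x : ι → ℝ} (hx : ∀ j, 0 < x j ∧ x j ≤ 1) :
    ‖φ x - cellMean n φ x‖ₑ ^ 2
      ≤ (n : ℝ≥0∞) ^ Fintype.card ι * ∫⁻ y in cellAt n x, ‖φ y - φ x‖ₑ ^ 2 := by
  have hn0 : (n : ℝ≥0∞) ^ Fintype.card ι ≠ 0 := pow_ne_zero _ (by exact_mod_cast (by omega))
  have hnt : (n : ℝ≥0∞) ^ Fintype.card ι ≠ ∞ := ENNReal.pow_ne_top (ENNReal.natCast_ne_top n)
  have hv := volume_cellAt hn x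
  have hvr : volume.real (cellAt n x) = ((n : ℝ) ^ Fintype.card ι)⁻¹ := by
    rw [measureReal_def, hv]; simp
  have hfin : volume (cellAt n x) ≠ ∞ := by
    rw [hv]
    exact ENNReal.inv_ne_top.2 hn0
  have hi : IntegrableOn φ (cellAt n x) := hφi.mono_set (cellAt_subset_cube hn hx)
  have hc : IntegrableOn (fun _ => φ x) (cellAt n x) := integrableOn_const hfin
  have heq : φ x - cellMean n φ x
      = -∫ y in cellAt n x, (n : ℝ) ^ Fintype.card ι * (φ y - φ x) := by
    rw [integral_const_mul, integral_sub hi hc, setIntegral_const, hvr, cellMean, smul_eq_mul]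
    have : (n : ℝ) ^ Fintype.card ι ≠ 0 := pow_ne_zero _ (by exact_mod_cast (by omega))
    field_simp
    ring
  rw [heq, enorm_neg]
  refine (enorm_integral_mul_sq_le aemeasurable_const
    (hφ.sub_const _).aemeasurable).trans (mul_le_mul_left (le_of_eq ?_) _)
  rw [setLIntegral_const, hv, enorm_pow, ← ofReal_norm, Real.norm_natCast,
    ENNReal.ofReal_natCast, sq, mul_assoc, ENNReal.mul_inv_cancel hn0 hnt,
    mul_one]

/-- Averaging over cells: the `L²`-error is controlled by the modulus of continuity at the mesh
size, with a constant depending on the dimension only. -/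
lemma lintegral_sub_cellMean_sq_le [Nonempty ι] {n : ℕ} (hn : 1 ≤ n) {φ : (ι → ℝ) → ℝ}
    (hφ : Measurable φ) (hφi : IntegrableOn φ (cube ι)) :
    ∫⁻ x in cube ι, ‖φ x - cellMean n φ x‖ₑ ^ 2
      ≤ 2 ^ Fintype.card ι * (Fintype.card ι * l2Modulus φ (1 / n)) ^ 2 := by
  have hnpos : (0 : ℝ) < n := by exact_mod_cast hn
  have hn0 : (n : ℝ≥0∞) ^ Fintype.card ι ≠ 0 := pow_ne_zero _ (by exact_mod_cast (by omega))
  have hnt : (n : ℝ≥0∞) ^ Fintype.card ι ≠ ∞ := ENNReal.pow_ne_top (ENNReal.natCast_ne_top n)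
  set D := Fintype.card ι with hD
  have hD0 : D ≠ 0 := Fintype.card_ne_zero
  set box : Set (ι → ℝ) := Set.Icc (fun _ => -(1 / (n : ℝ))) (fun _ => 1 / n) with hbox
  have hboxm : MeasurableSet box := measurableSet_Icc
  have hboxv : volume box = 2 ^ D * ((n : ℝ≥0∞) ^ D)⁻¹ := by
    rw [hbox, Real.volume_Icc_pi]
    simp only [sub_neg_eq_add, Finset.prod_const, Finset.card_univ]
    rw [← two_mul, ENNReal.ofReal_mul zero_le_two, one_div, ENNReal.ofReal_inv_of_pos hnpos,
      ENNReal.ofReal_natCast, mul_pow, ENNReal.inv_pow]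
    simp [hD]
  set A : Set ((ι → ℝ) × (ι → ℝ)) := {q | q.1 ∈ cube ι ∧ q.1 + q.2 ∈ cube ι} with hA
  have hAm : MeasurableSet A :=
    (measurableSet_cube.preimage measurable_fst).inter
      (measurableSet_cube.preimage (measurable_fst.add measurable_snd))
  set G : (ι → ℝ) × (ι → ℝ) → ℝ≥0∞ := fun q =>
    box.indicator 1 q.2 * A.indicator (fun q => ‖φ (q.1 + q.2) - φ q.1‖ₑ ^ 2) q with hG
  have hGm : Measurable G := by
    refine Measurable.mul ((measurable_one.indicator hboxm).comp measurable_snd) ?_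
    refine Measurable.indicator ?_ hAm
    fun_prop
  have hmod : ∀ h ∈ box, ∫⁻ x, A.indicator (fun q => ‖φ (q.1 + q.2) - φ q.1‖ₑ ^ 2) (x, h)
      ≤ (D * l2Modulus φ (1 / n)) ^ 2 := by
    intro h hh
    have h1 : ∀ x, A.indicator (fun q => ‖φ (q.1 + q.2) - φ q.1‖ₑ ^ 2) (x, h)
        = {x | x ∈ cube ι ∧ x + h ∈ cube ι}.indicator (fun x => ‖φ (x + h) - φ x‖ₑ ^ 2) x :=
      fun x => rfl
    simp_rw [h1]
    rw [lintegral_indicator (measurableSet_cube_shift h), ← eLpNorm_two_sq]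
    refine pow_le_pow_left₀ zero_le ?_ 2
    refine (eLpNorm_shift_le_l2Modulus φ ?_).trans (l2Modulus_nat_mul_le hφ _ hD0)
    -- the Euclidean length of a vector with entries at most `1 / n` is at most `√D / n ≤ D / n`
    calc ∑ i, h i ^ 2 ≤ ∑ _i : ι, (1 / (n : ℝ)) ^ 2 := by
          refine Finset.sum_le_sum fun i _ => ?_
          rw [sq_le_sq, abs_of_pos (by positivity : 0 < 1 / (n : ℝ)), abs_le]
          exact ⟨hh.1 i, hh.2 i⟩
      _ = D * (1 / (n : ℝ)) ^ 2 := by simp [hD]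
      _ ≤ (D * (1 / n)) ^ 2 := by
          rw [mul_pow]
          refine mul_le_mul_of_nonneg_right ?_ (by positivity)
          have : (1 : ℝ) ≤ D := by exact_mod_cast Nat.one_le_iff_ne_zero.2 hD0
          nlinarith
  have hpt : ∀ x, (∀ j, 0 < x j ∧ x j ≤ 1) → x ∈ cube ι →
      ∫⁻ y in cellAt n x, ‖φ y - φ x‖ₑ ^ 2 ≤ ∫⁻ h, G (x, h) := by
    intro x hx hxc
    rw [← lintegral_indicator (measurableSet_cellAt n x),
      ← lintegral_sub_right_eq_self (fun h => G (x, h)) x]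
    refine lintegral_mono fun y => ?_
    by_cases hy : y ∈ cellAt n x
    · have hb : y - x ∈ box := by
        have h1 := fun j => abs_le.1 (abs_sub_le_of_mem_cellAt hn hy j)
        exact ⟨fun j => (h1 j).1, fun j => (h1 j).2⟩
      have hq : (x, y - x) ∈ A := by
        refine ⟨hxc, ?_⟩
        simp only [add_sub_cancel]
        exact cellAt_subset_cube hn hx hy
      simp only [hG, Set.indicator_of_mem hy, Set.indicator_of_mem hb, Set.indicator_of_mem hq,
        Pi.one_apply, one_mul, add_sub_cancel, le_refl]
    · rw [Set.indicator_of_notMem hy]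
      exact zero_le
  calc ∫⁻ x in cube ι, ‖φ x - cellMean n φ x‖ₑ ^ 2
      ≤ ∫⁻ x in cube ι, (n : ℝ≥0∞) ^ D * ∫⁻ h, G (x, h) := by
        refine lintegral_mono_ae ?_
        filter_upwards [ae_cube_pos, ae_restrict_mem measurableSet_cube] with x hx hxc
        exact (enorm_sub_cellMean_sq_le hn hφ hφi hx).trans (mul_le_mul_right (hpt x hx hxc) _)
    _ ≤ ∫⁻ x, (n : ℝ≥0∞) ^ D * ∫⁻ h, G (x, h) := setLIntegral_le_lintegral _ _
    _ = (n : ℝ≥0∞) ^ D * ∫⁻ h, ∫⁻ x, G (x, h) := by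
        rw [lintegral_const_mul' _ _ hnt, lintegral_lintegral_swap hGm.aemeasurable]
    _ ≤ (n : ℝ≥0∞) ^ D * ∫⁻ h, box.indicator 1 h * (D * l2Modulus φ (1 / n)) ^ 2 := by
        refine mul_le_mul_right (lintegral_mono fun h => ?_) _
        by_cases hh : h ∈ box
        · simp only [hG, Set.indicator_of_mem hh, Pi.one_apply, one_mul]
          exact hmod h hh
        · simp [hG, Set.indicator_of_notMem hh]
    _ = (n : ℝ≥0∞) ^ D * (volume box * (D * l2Modulus φ (1 / n)) ^ 2) := by
        rw [lintegral_mul_const _ (measurable_one.indicator hboxm), lintegral_indicator_one hboxm]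
    _ = _ := by
        rw [hboxv, ← mul_assoc, mul_comm (2 ^ D), ← mul_assoc, ENNReal.mul_inv_cancel hn0 hnt,
          one_mul]

end Modulus

/-! ### The Galerkin projection -/

section Galerkin

variable {d : ℕ}

lemma mem_cell_iff {n : ℕ} (hn : 1 ≤ n) {i : Fin d → Fin n} {x : Fin d → ℝ} :
    x ∈ cell n i ↔ ∀ j, ⌈n * x j⌉ = (i j : ℤ) + 1 := by
  have hn0 : (0 : ℝ) < n := by exact_mod_cast hn
  simp only [cell, Set.mem_univ_pi, Set.mem_Ioc]
  refine forall_congr' fun j => ?_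
  rw [Int.ceil_eq_iff, div_lt_iff₀' hn0, le_div_iff₀' hn0]
  push_cast
  rw [add_sub_cancel_right]

lemma cell_eq_cellAt {n : ℕ} (hn : 1 ≤ n) {i : Fin d → Fin n} {x : Fin d → ℝ}
    (hx : x ∈ cell n i) : cell n i = cellAt n x := by
  ext y
  rw [mem_cell_iff hn, mem_cellAt hn]
  refine forall_congr' fun j => ?_
  rw [(mem_cell_iff hn).1 hx j]

lemma exists_mem_cell {n : ℕ} (hn : 1 ≤ n) {x : Fin d → ℝ} (hx : ∀ j, 0 < x j ∧ x j ≤ 1) :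
    ∃ i : Fin d → Fin n, x ∈ cell n i := by
  have hn0 : (0 : ℝ) < n := by exact_mod_cast hn
  have h1 : ∀ j, 0 < ⌈n * x j⌉ := fun j => Int.ceil_pos.2 (mul_pos hn0 (hx j).1)
  have h2 : ∀ j, ⌈n * x j⌉ ≤ n := fun j => Int.ceil_le.2 (by
    push_cast
    exact mul_le_of_le_one_right hn0.le (hx j).2)
  refine ⟨fun j => ⟨(⌈n * x j⌉ - 1).toNat, by have := h1 j; have := h2 j; omega⟩, ?_⟩
  rw [mem_cell_iff hn]
  intro j
  have := h1 j
  simp only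
  omega

lemma disjoint_cell {n : ℕ} (hn : 1 ≤ n) {i i' : Fin d → Fin n} (hi : i ≠ i') :
    Disjoint (cell n i) (cell n i') := by
  rw [Set.disjoint_left]
  intro x hx hx'
  refine hi (funext fun j => Fin.ext ?_)
  have h1 := (mem_cell_iff hn).1 hx j
  have h2 := (mem_cell_iff hn).1 hx' j
  omega

lemma indicator_cell_eq_zero {n : ℕ} (hn : 1 ≤ n) {i i' : Fin d → Fin n} (hi : i' ≠ i)
    {x : Fin d → ℝ} (hx : x ∈ cell n i) : (cell n i').indicator (1 : (Fin d → ℝ) → ℝ) x = 0 :=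
  Set.indicator_of_notMem (fun h => Set.disjoint_left.1 (disjoint_cell hn hi) h hx) _

lemma cell_subset_cube {n : ℕ} (hn : 1 ≤ n) (i : Fin d → Fin n) : cell n i ⊆ cube (Fin d) := by
  intro y hy
  rw [mem_cube]
  intro j
  have hn0 : (0 : ℝ) < n := by exact_mod_cast hn
  obtain ⟨h1, h2⟩ := hy j (Set.mem_univ j)
  have h3 : ((i j : ℕ) : ℝ) + 1 ≤ n := by exact_mod_cast (i j).2
  refine ⟨(lt_of_le_of_lt (by positivity) h1).le, h2.trans ?_⟩
  rw [div_le_one hn0]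
  exact h3

lemma volume_cell {n : ℕ} (hn : 1 ≤ n) (i : Fin d → Fin n) :
    volume (cell n i) = ((n : ℝ≥0∞) ^ d)⁻¹ := by
  have hn0 : (0 : ℝ) < n := by exact_mod_cast hn
  rw [cell, Real.volume_pi_Ioc]
  have h1 : ∀ j, ENNReal.ofReal (((i j : ℝ) + 1) / n - (i j : ℝ) / n) = (n : ℝ≥0∞)⁻¹ := fun j => by
    rw [← sub_div, add_sub_cancel_left, one_div, ENNReal.ofReal_inv_of_pos hn0,
      ENNReal.ofReal_natCast]
  simp [h1, ENNReal.inv_pow]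

lemma cubeMeasure_restrict_cell {n : ℕ} (hn : 1 ≤ n) (i : Fin d → Fin n) :
    (cubeMeasure d).restrict (cell n i) = volume.restrict (cell n i) := by
  rw [Measure.restrict_restrict (measurableSet_cell i),
    Set.inter_eq_self_of_subset_left (cell_subset_cube hn i)]

lemma lintegral_cube_eq_sum {n : ℕ} (hn : 1 ≤ n) (f : (Fin d → ℝ) → ℝ≥0∞) :
    ∫⁻ x, f x ∂(cubeMeasure d) = ∑ i : Fin d → Fin n, ∫⁻ x in cell n i, f x := by
  have h : ∀ᵐ x ∂(cubeMeasure d), x ∈ ⋃ i : Fin d → Fin n, cell n i := by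
    filter_upwards [ae_cube_pos] with x hx
    exact Set.mem_iUnion.2 (exists_mem_cell hn hx)
  rw [← Measure.restrict_eq_self_of_ae_mem h, lintegral_iUnion measurableSet_cell
    (fun i i' hi => disjoint_cell hn hi), tsum_fintype]
  simp_rw [cubeMeasure_restrict_cell hn]

lemma integrableOn_cube_Lp (φ : StateSpace d) : IntegrableOn φ (cube (Fin d)) :=
  (Lp.memLp φ).integrable one_le_two

lemma inner_cellInd {n : ℕ} (hn : 1 ≤ n) (φ : StateSpace d) (i : Fin d → Fin n) :
    inner ℝ φ (cellInd n i) = ∫ x in cell n i, φ x := by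
  rw [real_inner_comm, cellInd, L2.inner_indicatorConstLp_one, cubeMeasure_restrict_cell hn]

lemma galerkinProj_ae_eq {n : ℕ} (hn : 1 ≤ n) (φ : StateSpace d) :
    galerkinProj n φ =ᵐ[cubeMeasure d] cellMean n φ := by
  have h1 : ∀ᵐ x ∂(cubeMeasure d), ∀ i ∈ (Finset.univ : Finset (Fin d → Fin n)),
      (((n : ℝ) ^ d * inner ℝ φ (cellInd n i)) • cellInd n i : StateSpace d) x
        = ((n : ℝ) ^ d * inner ℝ φ (cellInd n i)) * (cell n i).indicator 1 x := by
    refine (Finset.eventually_all _).2 fun i _ => ?_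
    filter_upwards [Lp.coeFn_smul ((n : ℝ) ^ d * inner ℝ φ (cellInd n i)) (cellInd n i),
      indicatorConstLp_coeFn (p := 2) (hs := measurableSet_cell i)
        (hμs := cubeMeasure_cell_ne_top i) (c := (1 : ℝ))] with x hx hx'
    rw [hx, Pi.smul_apply, smul_eq_mul, cellInd, hx']
    rfl
  filter_upwards [h1, ae_cube_pos, Lp.coeFn_finsetSum Finset.univ fun i : Fin d → Fin n =>
    (((n : ℝ) ^ d * inner ℝ φ (cellInd n i)) • cellInd n i : StateSpace d)] with x h1 hx h2
  obtain ⟨i, hi⟩ := exists_mem_cell hn hx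
  rw [galerkinProj, h2, Finset.sum_apply, Finset.sum_congr rfl h1, Finset.sum_eq_single i]
  · rw [Set.indicator_of_mem hi, Pi.one_apply, mul_one, inner_cellInd hn, cellMean,
      cell_eq_cellAt hn hi, Fintype.card_fin]
  · intro i' _ hi'
    rw [indicator_cell_eq_zero hn hi' hi, mul_zero]
  · exact fun h => absurd (Finset.mem_univ i) h

lemma enorm_sub_galerkinProj_sq_le (hd : 0 < d) {n : ℕ} (hn : 1 ≤ n) (φ : StateSpace d) :
    ‖φ - galerkinProj n φ‖ₑ ^ 2 ≤ 2 ^ d * (d * l2Modulus φ (1 / n)) ^ 2 := by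
  have : Nonempty (Fin d) := ⟨⟨0, hd⟩⟩
  have h := lintegral_sub_cellMean_sq_le hn (measurable_Lp φ) (integrableOn_cube_Lp φ)
  rw [Fintype.card_fin] at h
  rw [enorm_Lp_sub_sq]
  refine le_trans (le_of_eq (lintegral_congr_ae ?_)) h
  filter_upwards [galerkinProj_ae_eq hn φ] with x hx
  rw [hx]

variable (d) in
/-- The error `φ ↦ φ - 𝐏_n φ` of the Galerkin projection as a continuous linear map. -/
noncomputable def galerkinErr (n : ℕ) : StateSpace d →L[ℝ] StateSpace d :=
  ContinuousLinearMap.id ℝ _ - ∑ i : Fin d → Fin n,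
    ((n : ℝ) ^ d) • (innerSL ℝ (cellInd n i)).smulRight (cellInd n i)

lemma galerkinErr_apply (n : ℕ) (φ : StateSpace d) : galerkinErr d n φ = φ - galerkinProj n φ := by
  simp [galerkinErr, galerkinProj, smul_smul, real_inner_comm]

lemma galerkinProj_eq_sub (n : ℕ) (φ : StateSpace d) :
    galerkinProj n φ = φ - galerkinErr d n φ := by
  rw [galerkinErr_apply, sub_sub_cancel]

lemma galerkinProj_sub (n : ℕ) (φ ψ : StateSpace d) :
    galerkinProj n (φ - ψ) = galerkinProj n φ - galerkinProj n ψ := by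
  simp only [galerkinProj_eq_sub, map_sub]
  abel

lemma galerkinProj_zero (n : ℕ) : galerkinProj n (0 : StateSpace d) = 0 := by
  simp [galerkinProj_eq_sub]

lemma continuous_galerkinProj (n : ℕ) :
    Continuous (galerkinProj n : StateSpace d → StateSpace d) := by
  have : (galerkinProj n : StateSpace d → StateSpace d) = fun φ => φ - galerkinErr d n φ :=
    funext (galerkinProj_eq_sub n)
  rw [this]
  fun_prop

/-- `𝐏_n` is the orthogonal projection onto the span of the cell indicators, so its error is a
contraction. -/
lemma norm_sub_galerkinProj_le {n : ℕ} (hn : 1 ≤ n) (φ : StateSpace d) :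
    ‖φ - galerkinProj n φ‖ ≤ ‖φ‖ := by
  have hn0 : (n : ℝ) ^ d ≠ 0 := pow_ne_zero _ (by exact_mod_cast (by omega))
  have hself : ∀ i : Fin d → Fin n, inner ℝ (cellInd (d := d) n i) (cellInd n i)
      = ((n : ℝ) ^ d)⁻¹ := fun i => by
    rw [cellInd, L2.inner_indicatorConstLp_one_indicatorConstLp_one, Set.inter_self,
      measureReal_def, Measure.restrict_eq_self _ (cell_subset_cube hn i), volume_cell hn]
    simp
  have hne : ∀ i j : Fin d → Fin n, j ≠ i → inner ℝ (cellInd (d := d) n i) (cellInd n j) = 0 :=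
    fun i j hij => by
    rw [cellInd, cellInd, L2.inner_indicatorConstLp_one_indicatorConstLp_one,
      (disjoint_cell hn hij.symm).inter_eq]
    simp
  have h1 : inner ℝ (galerkinProj n φ) (galerkinProj n φ) = inner ℝ φ (galerkinProj n φ) := by
    rw [galerkinProj, sum_inner, inner_sum]
    refine Finset.sum_congr rfl fun i _ => ?_
    rw [inner_sum, Finset.sum_eq_single i]
    · rw [inner_smul_left, inner_smul_right, inner_smul_right, hself]
      simp only [conj_trivial]
      field_simp
    · intro j _ hj
      rw [inner_smul_left, inner_smul_right, hne i j hj, mul_zero, mul_zero]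
    · exact fun h => absurd (Finset.mem_univ i) h
  have h2 := norm_sub_sq_real φ (galerkinProj n φ)
  rw [real_inner_self_eq_norm_sq] at h1
  rw [← h1] at h2
  refine le_of_sq_le_sq ?_ (norm_nonneg _)
  nlinarith [sq_nonneg ‖galerkinProj n φ‖]

end Galerkin

/-! ### The projected kernel -/

section KernelProj

variable {d : ℕ} {K : (Fin d → ℝ) → (Fin d → ℝ) → ℝ} {κ : ℝ≥0}

lemma kernelProj_eq_kernelCoeff {n : ℕ} (hn : 1 ≤ n) {x y : Fin d → ℝ} {i j : Fin d → Fin n}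
    (hx : x ∈ cell n i) (hy : y ∈ cell n j) : kernelProj n K x y = kernelCoeff n K i j := by
  rw [kernelProj, Finset.sum_eq_single i, Finset.sum_eq_single j]
  · rw [Set.indicator_of_mem hx, Set.indicator_of_mem hy]
    simp
  · intro j' _ hj'
    rw [indicator_cell_eq_zero hn hj' hy, mul_zero]
  · exact fun h => absurd (Finset.mem_univ j) h
  · intro i' _ hi'
    refine Finset.sum_eq_zero fun j' _ => ?_
    rw [indicator_cell_eq_zero hn hi' hx, mul_zero, zero_mul]
  · exact fun h => absurd (Finset.mem_univ i) h

lemma measurable_kernelProj (n : ℕ) : Measurable (Function.uncurry (kernelProj n K)) := by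
  refine Finset.measurable_sum _ fun i _ => Finset.measurable_sum _ fun j _ => ?_
  exact (measurable_const.mul ((measurable_one.indicator (measurableSet_cell i)).comp
    measurable_fst)).mul ((measurable_one.indicator (measurableSet_cell j)).comp measurable_snd)

lemma abs_kernelProj_le (n : ℕ) (x y : Fin d → ℝ) :
    |kernelProj n K x y| ≤ ∑ i : Fin d → Fin n, ∑ j : Fin d → Fin n, |kernelCoeff n K i j| := by
  refine (Finset.abs_sum_le_sum_abs _ _).trans (Finset.sum_le_sum fun i _ =>
    (Finset.abs_sum_le_sum_abs _ _).trans (Finset.sum_le_sum fun j _ => ?_))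
  rw [abs_mul, abs_mul]
  have h : ∀ (i : Fin d → Fin n) (z : Fin d → ℝ),
      |(cell n i).indicator (1 : (Fin d → ℝ) → ℝ) z| ≤ 1 :=
    fun i z => by
    by_cases hz : z ∈ cell n i <;> simp [hz]
  exact mul_le_of_le_one_right (by positivity) (h j y) |>.trans
    (mul_le_of_le_one_right (abs_nonneg _) (h i x))

lemma isAdmissibleKernel_kernelProj (n : ℕ) : IsAdmissibleKernel (kernelProj n K) := by
  set c := ∑ i : Fin d → Fin n, ∑ j : Fin d → Fin n, |kernelCoeff n K i j| with hc
  have hb : ∀ x y, ‖kernelProj n K x y‖ₑ ^ 2 ≤ ENNReal.ofReal c ^ 2 := fun x y => by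
    rw [← ofReal_norm]
    exact pow_le_pow_left₀ zero_le (ENNReal.ofReal_le_ofReal (abs_kernelProj_le n x y)) 2
  have hlt : ENNReal.ofReal c ^ 2 < ∞ := ENNReal.pow_lt_top ENNReal.ofReal_lt_top
  refine ⟨measurable_kernelProj n, lt_of_le_of_lt (essSup_le_of_ae_le _ ?_) hlt,
    lt_of_le_of_lt (essSup_le_of_ae_le _ ?_) hlt⟩
  · exact Filter.Eventually.of_forall fun x => (lintegral_mono fun y => hb x y).trans (by simp)
  · exact Filter.Eventually.of_forall fun y => (lintegral_mono fun x => hb x y).trans (by simp)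

/-- By Jensen's inequality, averaging over cells does not increase the row bound. -/
lemma rowBound_kernelProj (hK : IsAdmissibleKernel K) (hκ : RowBound K κ) {n : ℕ} (hn : 1 ≤ n) :
    RowBound (kernelProj n K) κ := by
  have hn0 : (n : ℝ≥0∞) ^ d ≠ 0 := pow_ne_zero _ (by exact_mod_cast (by omega))
  have hnt : (n : ℝ≥0∞) ^ d ≠ ∞ := ENNReal.pow_ne_top (ENNReal.natCast_ne_top n)
  set c := (n : ℝ≥0∞) ^ d with hc
  have hone : ∀ i : Fin d → Fin n, ∫⁻ _ in cell n i, ‖(1 : ℝ)‖ₑ ^ 2 = c⁻¹ := fun i => by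
    rw [setLIntegral_const, volume_cell hn]; simp [hc]
  have hcoef : ∀ i j : Fin d → Fin n, ‖kernelCoeff n K i j‖ₑ ^ 2
      ≤ c ^ 2 * ∫⁻ x in cell n i, ∫⁻ y in cell n j, ‖K x y‖ₑ ^ 2 := by
    intro i j
    have hm : AEMeasurable (fun x => ∫ y in cell n j, K x y) (volume.restrict (cell n i)) :=
      (hK.measurable.stronglyMeasurable.integral_prod_right).aestronglyMeasurable.aemeasurable
    have h1 := enorm_integral_mul_sq_le (μ := volume.restrict (cell n i))
      (aemeasurable_const (b := (1 : ℝ))) hm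
    rw [hone] at h1
    simp only [one_mul] at h1
    have h2 : ∀ x, ‖∫ y in cell n j, K x y‖ₑ ^ 2 ≤ c⁻¹ * ∫⁻ y in cell n j, ‖K x y‖ₑ ^ 2 :=
      fun x => by
      have h3 := enorm_integral_mul_sq_le (μ := volume.restrict (cell n j))
        (aemeasurable_const (b := (1 : ℝ))) (hK.measurable_row x).aemeasurable
      rw [hone] at h3
      simpa only [one_mul] using h3
    have h4 : ‖(n : ℝ) ^ (2 * d)‖ₑ ^ 2 = c ^ 4 := by
      rw [enorm_pow, ← ofReal_norm, Real.norm_natCast, ENNReal.ofReal_natCast, hc, ← pow_mul,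
        ← pow_mul]
      congr 1
      ring
    rw [kernelCoeff, enorm_mul, mul_pow, h4]
    calc c ^ 4 * ‖∫ x in cell n i, ∫ y in cell n j, K x y‖ₑ ^ 2
        ≤ c ^ 4 * (c⁻¹ * ∫⁻ x in cell n i, c⁻¹ * ∫⁻ y in cell n j, ‖K x y‖ₑ ^ 2) :=
          mul_le_mul_right (h1.trans (mul_le_mul_right (lintegral_mono h2) _)) _
      _ = c ^ 2 * (c * c⁻¹) * (c * c⁻¹) * ∫⁻ x in cell n i, ∫⁻ y in cell n j, ‖K x y‖ₑ ^ 2 := by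
          rw [lintegral_const_mul' _ _ (ENNReal.inv_ne_top.2 hn0)]
          ring
      _ = _ := by rw [ENNReal.mul_inv_cancel hn0 hnt, mul_one, mul_one]
  filter_upwards [ae_cube_pos] with x hx
  obtain ⟨i, hi⟩ := exists_mem_cell hn hx
  have hrow : ∀ᵐ x ∂(volume.restrict (cell n i)), ∫⁻ y, ‖K x y‖ₑ ^ 2 ∂(cubeMeasure d) ≤ κ := by
    rw [← cubeMeasure_restrict_cell hn]
    exact ae_restrict_of_ae hκ
  calc ∫⁻ y, ‖kernelProj n K x y‖ₑ ^ 2 ∂(cubeMeasure d)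
      = ∑ j : Fin d → Fin n, ∫⁻ y in cell n j, ‖kernelProj n K x y‖ₑ ^ 2 :=
        lintegral_cube_eq_sum hn _
    _ = ∑ j : Fin d → Fin n, ‖kernelCoeff n K i j‖ₑ ^ 2 * c⁻¹ := by
        refine Finset.sum_congr rfl fun j _ => ?_
        rw [setLIntegral_congr_fun (measurableSet_cell j)
          (fun y hy => by rw [kernelProj_eq_kernelCoeff hn hi hy]), setLIntegral_const,
          volume_cell hn]
    _ ≤ ∑ j : Fin d → Fin n, c ^ 2 * (∫⁻ x in cell n i, ∫⁻ y in cell n j, ‖K x y‖ₑ ^ 2) * c⁻¹ :=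
        Finset.sum_le_sum fun j _ => mul_le_mul_left (hcoef i j) _
    _ = c ^ 2 * (∫⁻ x in cell n i, ∫⁻ y, ‖K x y‖ₑ ^ 2 ∂(cubeMeasure d)) * c⁻¹ := by
        rw [← Finset.sum_mul, ← Finset.mul_sum, ← lintegral_finsetSum]
        · simp_rw [lintegral_cube_eq_sum hn]
        · intro j _
          exact Measurable.lintegral_prod_right (hK.measurable.enorm.pow_const 2)
    _ ≤ c ^ 2 * (κ * c⁻¹) * c⁻¹ := by
        refine mul_le_mul_left (mul_le_mul_right ((lintegral_mono_ae hrow).trans_eq ?_) _) _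
        rw [setLIntegral_const, volume_cell hn]
    _ = (c * c⁻¹) * (c * c⁻¹) * κ := by ring
    _ = κ := by rw [ENNReal.mul_inv_cancel hn0 hnt, one_mul, one_mul]

/-- Splitting the coordinates of `I^{2d}` identifies it with `I^d × I^d`. -/
lemma measurePreserving_sumPi :
    MeasurePreserving (MeasurableEquiv.sumPiEquivProdPi fun _ : Fin d ⊕ Fin d => ℝ)
      (volume.restrict (cube (Fin d ⊕ Fin d))) ((cubeMeasure d).prod (cubeMeasure d)) := by
  have h := (volume_measurePreserving_sumPiEquivProdPi fun _ : Fin d ⊕ Fin d => ℝ).restrict_preimage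
    (s := cube (Fin d) ×ˢ cube (Fin d)) (measurableSet_cube.prod measurableSet_cube)
  have h1 : (MeasurableEquiv.sumPiEquivProdPi fun _ : Fin d ⊕ Fin d => ℝ) ⁻¹'
      (cube (Fin d) ×ˢ cube (Fin d)) = cube (Fin d ⊕ Fin d) := by
    ext z
    simp only [Set.mem_preimage, Set.mem_prod, mem_cube, Sum.forall]
    rfl
  rw [h1, Measure.volume_eq_prod, ← Measure.prod_restrict] at h
  exact h

lemma measurable_kernelOnCube (hK : IsAdmissibleKernel K) : Measurable (kernelOnCube K) := by
  have h : Measurable fun z : Fin d ⊕ Fin d → ℝ =>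
      ((fun i => z (Sum.inl i), fun i => z (Sum.inr i)) : (Fin d → ℝ) × (Fin d → ℝ)) := by
    fun_prop
  exact hK.measurable.comp h

lemma cellMean_kernelOnCube (hKi : IntegrableOn (kernelOnCube K) (cube (Fin d ⊕ Fin d)))
    {n : ℕ} (hn : 1 ≤ n) {z : Fin d ⊕ Fin d → ℝ} (hz : ∀ j, 0 < z j ∧ z j ≤ 1) :
    cellMean n (kernelOnCube K) z
      = kernelProj n K (fun i => z (Sum.inl i)) (fun i => z (Sum.inr i)) := by
  obtain ⟨i, hi⟩ := exists_mem_cell hn (x := fun i => z (Sum.inl i)) fun j => hz _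
  obtain ⟨j, hj⟩ := exists_mem_cell hn (x := fun i => z (Sum.inr i)) fun j => hz _
  set e := MeasurableEquiv.sumPiEquivProdPi fun _ : Fin d ⊕ Fin d => ℝ with he
  have hpre : e ⁻¹' (cell n i ×ˢ cell n j) = cellAt n z := by
    ext w
    rw [Set.mem_preimage, Set.mem_prod, mem_cellAt hn, mem_cell_iff hn, mem_cell_iff hn, Sum.forall]
    rw [mem_cell_iff hn] at hi hj
    simp_rw [hi, hj]
    rfl
  have hmp : MeasurePreserving e volume volume := volume_measurePreserving_sumPiEquivProdPi _
  have hcomp : ∀ w, kernelOnCube K w = Function.uncurry K (e w) := fun w => rfl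
  have hint : IntegrableOn (Function.uncurry K) (cell n i ×ˢ cell n j)
      ((volume : Measure (Fin d → ℝ)).prod volume) := by
    have h1 : IntegrableOn (kernelOnCube K) (cellAt n z) :=
      hKi.mono_set (cellAt_subset_cube hn hz)
    rw [← hpre] at h1
    exact (hmp.integrableOn_comp_preimage e.measurableEmbedding).1 h1
  rw [kernelProj_eq_kernelCoeff hn hi hj, cellMean, kernelCoeff, Fintype.card_sum, Fintype.card_fin,
    ← two_mul]
  congr 1
  rw [← hpre]
  simp_rw [hcomp]
  rw [hmp.setIntegral_preimage_emb e.measurableEmbedding, Measure.volume_eq_prod,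
    setIntegral_prod _ hint]
  rfl

lemma lintegral_sub_kernelProj_sq_le (hd : 0 < d) (hK : IsAdmissibleKernel K)
    (hKi : IntegrableOn (kernelOnCube K) (cube (Fin d ⊕ Fin d))) {n : ℕ} (hn : 1 ≤ n) :
    ∫⁻ x, ∫⁻ y, ‖K x y - kernelProj n K x y‖ₑ ^ 2 ∂(cubeMeasure d) ∂(cubeMeasure d)
      ≤ 2 ^ (2 * d) * ((2 * d : ℕ) * l2Modulus (kernelOnCube K) (1 / n)) ^ 2 := by
  have : Nonempty (Fin d ⊕ Fin d) := ⟨Sum.inl ⟨0, hd⟩⟩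
  have h := lintegral_sub_cellMean_sq_le hn (measurable_kernelOnCube hK) hKi
  rw [Fintype.card_sum, Fintype.card_fin, ← two_mul] at h
  refine le_trans (le_of_eq ?_) h
  have hm : Measurable fun q : (Fin d → ℝ) × (Fin d → ℝ) =>
      ‖K q.1 q.2 - kernelProj n K q.1 q.2‖ₑ ^ 2 :=
    (Measurable.sub hK.measurable (measurable_kernelProj n)).enorm.pow_const 2
  rw [← lintegral_prod _ hm.aemeasurable, ← measurePreserving_sumPi.lintegral_comp hm]
  refine lintegral_congr_ae ?_
  filter_upwards [ae_cube_pos] with z hz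
  rw [cellMean_kernelOnCube hKi hn hz]
  rfl

end KernelProj

/-! ### Gaussian series in `L²` -/

section GaussianSeries

variable {Ω : Type*} {mΩ : MeasurableSpace Ω} {P : Measure Ω}
  {X : ℕ → Ω → ℝ} {v : ℝ≥0}

lemma integral_cexp_sum_mul (hX : ∀ k, HasLaw (X k) (gaussianReal 0 v) P) (hind : iIndepFun X P)
    (c : ℕ → ℝ) (N : ℕ) :
    ∫ ω, Complex.exp ((∑ k ∈ Finset.range N, c k * X k ω : ℝ) * Complex.I) ∂P
      = (Real.exp (-(v * ∑ k ∈ Finset.range N, c k ^ 2) / 2) : ℝ) := by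
  have hlaw : ∀ k, HasLaw (fun ω => c k * X k ω)
      (gaussianReal (c k * 0) (.mk (c k ^ 2) (sq_nonneg _) * v)) P :=
    fun k => gaussianReal_const_mul (hX k) (c k)
  have hindc : iIndepFun (fun k ω => c k * X k ω) P :=
    hind.comp (fun k x => c k * x) fun k => by fun_prop
  have h := (hindc.restrict (Finset.range N)).charFun_map_fun_finsetSum_eq_prod
    fun k _ => (hlaw k).aemeasurable
  have h1 := congrFun h 1
  have hm : AEMeasurable (fun ω => ∑ k ∈ Finset.range N, c k * X k ω) P :=
    Finset.aemeasurable_fun_sum _ fun k _ => (hlaw k).aemeasurable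
  rw [charFun_apply_real, integral_map hm (by fun_prop), Finset.prod_apply] at h1
  simp only [Complex.ofReal_one, one_mul] at h1
  rw [h1, Finset.prod_congr rfl fun k _ => by rw [(hlaw k).map_eq, charFun_gaussianReal],
    ← Complex.exp_sum, Complex.ofReal_exp]
  congr 1
  push_cast
  simp only [mul_zero, zero_mul, zero_sub, Finset.sum_neg_distrib]
  rw [neg_div, Finset.mul_sum, Finset.sum_div]
  congr 1
  refine Finset.sum_congr rfl fun k _ => ?_
  ring

variable [IsProbabilityMeasure P]

lemma integral_mul_eq_of_hasLaw_gaussianReal (hX : ∀ k, HasLaw (X k) (gaussianReal 0 v) P)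
    (hind : iIndepFun X P) (i j : ℕ) :
    ∫ ω, X i ω * X j ω ∂P = if i = j then (v : ℝ) else 0 := by
  have h2 : ∀ k, MemLp (X k) 2 P := fun k => (hX k).hasGaussianLaw.memLp_two
  have h0 : ∀ k, ∫ ω, X k ω ∂P = 0 := fun k => by
    rw [(hX k).integral_eq, integral_id_gaussianReal]
  have hc := covariance_eq_sub (h2 i) (h2 j)
  rw [h0, h0, mul_zero, sub_zero] at hc
  change ∫ ω, (X i * X j) ω ∂P = _
  rw [← hc]
  split_ifs with hij
  · rw [hij, covariance_self (h2 j).aemeasurable, (hX j).variance_eq, variance_id_gaussianReal]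
  · exact (hind.indepFun hij).covariance_eq_zero (h2 i) (h2 j)

lemma lintegral_enorm_sum_sq_eq {E : Type*} [NormedAddCommGroup E] [InnerProductSpace ℝ E]
    (hX : ∀ k, HasLaw (X k) (gaussianReal 0 v) P) (hind : iIndepFun X P)
    {lam : ℕ → ℝ} (hlam : ∀ k, 0 ≤ lam k) (f : ℕ → E) (N : ℕ) :
    ∫⁻ ω, ‖∑ k ∈ Finset.range N, (√(lam k) * X k ω) • f k‖ₑ ^ 2 ∂P
      = v * ∑ k ∈ Finset.range N, ENNReal.ofReal (lam k) * ‖f k‖ₑ ^ 2 := by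
  have h2 : ∀ k, MemLp (X k) 2 P := fun k => (hX k).hasGaussianLaw.memLp_two
  have hi : ∀ i j, Integrable (fun ω => X i ω * X j ω) P := fun i j => (h2 i).integrable_mul (h2 j)
  have hexp : ∀ ω, ‖∑ k ∈ Finset.range N, (√(lam k) * X k ω) • f k‖ ^ 2
      = ∑ i ∈ Finset.range N, ∑ j ∈ Finset.range N,
        (√(lam i) * √(lam j) * inner ℝ (f i) (f j)) * (X i ω * X j ω) := fun ω => by
    rw [← real_inner_self_eq_norm_sq, sum_inner]
    refine Finset.sum_congr rfl fun i _ => ?_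
    rw [inner_sum]
    refine Finset.sum_congr rfl fun j _ => ?_
    rw [inner_smul_left, inner_smul_right]
    simp only [conj_trivial]
    ring
  have hint : Integrable (fun ω => ‖∑ k ∈ Finset.range N, (√(lam k) * X k ω) • f k‖ ^ 2) P := by
    simp_rw [hexp]
    exact integrable_finsetSum _ fun i _ => integrable_finsetSum _ fun j _ => (hi i j).const_mul _
  have hval : ∫ ω, ‖∑ k ∈ Finset.range N, (√(lam k) * X k ω) • f k‖ ^ 2 ∂P
      = v * ∑ k ∈ Finset.range N, lam k * ‖f k‖ ^ 2 := by
    simp_rw [hexp]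
    rw [integral_finsetSum _ fun i _ => integrable_finsetSum _ fun j _ => (hi i j).const_mul _,
      Finset.mul_sum]
    refine Finset.sum_congr rfl fun i his => ?_
    rw [integral_finsetSum _ fun j _ => (hi i j).const_mul _, Finset.sum_eq_single i]
    · rw [integral_const_mul, integral_mul_eq_of_hasLaw_gaussianReal hX hind, if_pos rfl,
        Real.mul_self_sqrt (hlam i), real_inner_self_eq_norm_sq]
      ring
    · intro j _ hj
      rw [integral_const_mul, integral_mul_eq_of_hasLaw_gaussianReal hX hind, if_neg hj.symm,
        mul_zero]
    · exact fun h => absurd his h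
  have hpt : ∀ ω, ‖∑ k ∈ Finset.range N, (√(lam k) * X k ω) • f k‖ₑ ^ 2
      = ENNReal.ofReal (‖∑ k ∈ Finset.range N, (√(lam k) * X k ω) • f k‖ ^ 2) := fun ω => by
    rw [← ofReal_norm, ENNReal.ofReal_pow (norm_nonneg _)]
  simp_rw [hpt]
  rw [← ofReal_integral_eq_lintegral_ofReal hint
    (Filter.Eventually.of_forall fun ω => by positivity),
    hval, ENNReal.ofReal_mul v.coe_nonneg, ENNReal.ofReal_coe_nnreal,
    ENNReal.ofReal_sum_of_nonneg fun k _ => mul_nonneg (hlam k) (by positivity)]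
  congr 1
  refine Finset.sum_congr rfl fun k _ => ?_
  rw [ENNReal.ofReal_mul (hlam k), ENNReal.ofReal_pow (norm_nonneg _), ofReal_norm]

/-- Second moment of the image of a Gaussian series under a continuous linear map. -/
lemma lintegral_enorm_map_sq_le {E F : Type*} [NormedAddCommGroup E] [NormedSpace ℝ E]
    [NormedAddCommGroup F] [InnerProductSpace ℝ F]
    (hX : ∀ k, HasLaw (X k) (gaussianReal 0 v) P) (hind : iIndepFun X P)
    {lam : ℕ → ℝ} (hlam : ∀ k, 0 ≤ lam k) {e : ℕ → E} {D : Ω → E}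
    (hD : ∀ᵐ ω ∂P, HasSum (fun k => (√(lam k) * X k ω) • e k) (D ω)) (A : E →L[ℝ] F) :
    ∫⁻ ω, ‖A (D ω)‖ₑ ^ 2 ∂P ≤ v * ∑' k, ENNReal.ofReal (lam k) * ‖A (e k)‖ₑ ^ 2 := by
  set B : ℝ≥0∞ := v * ∑' k, ENNReal.ofReal (lam k) * ‖A (e k)‖ₑ ^ 2 with hB
  have hsq : (B ^ (1 / 2 : ℝ)) ^ 2 = B := by
    rw [← ENNReal.rpow_natCast, ← ENNReal.rpow_mul]
    norm_num
  have hN : ∀ N, eLpNorm (fun ω => ∑ k ∈ Finset.range N, (√(lam k) * X k ω) • A (e k)) 2 P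
      ≤ B ^ (1 / 2 : ℝ) := fun N => by
    refine (ENNReal.pow_le_pow_left_iff two_ne_zero).1 ?_
    rw [hsq, eLpNorm_two_sq, lintegral_enorm_sum_sq_eq hX hind hlam]
    exact mul_le_mul_right (ENNReal.sum_le_tsum _) _
  have hlim : ∀ᵐ ω ∂P, Filter.Tendsto
      (fun N => ∑ k ∈ Finset.range N, (√(lam k) * X k ω) • A (e k)) Filter.atTop
      (nhds (A (D ω))) := by
    filter_upwards [hD] with ω hω
    have h := (hω.mapL A).tendsto_sum_nat
    simpa only [map_smul] using h
  have h := Lp.eLpNorm_le_of_ae_tendsto (Filter.Eventually.of_forall hN) (fun N => ?_) hlim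
  · rw [← eLpNorm_two_sq, ← hsq]
    exact pow_le_pow_left₀ zero_le h 2
  · refine Finset.aestronglyMeasurable_fun_sum _ fun k _ => ?_
    exact ((hX k).aemeasurable.const_mul _).aestronglyMeasurable.smul_const _

/-- The variance density `∑ λ_k (e_k(x) - e_k(y))²` of the spatial increments of the noise. -/
noncomputable def incrVar {d : ℕ} (lam : ℕ → ℝ) (e : ℕ → StateSpace d)
    (q : (Fin d → ℝ) × (Fin d → ℝ)) : ℝ≥0∞ :=
  ∑' k, ENNReal.ofReal (lam k) * ‖e k q.1 - e k q.2‖ₑ ^ 2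

variable {d : ℕ} {lam : ℕ → ℝ} {e : ℕ → StateSpace d}

lemma measurable_incrVar (lam : ℕ → ℝ) (e : ℕ → StateSpace d) : Measurable (incrVar lam e) := by
  refine Measurable.tsum fun k => Measurable.const_mul ?_ _
  exact (((measurable_Lp (e k)).comp measurable_fst).sub
    ((measurable_Lp (e k)).comp measurable_snd)).enorm.pow_const 2

lemma lintegral_incrVar_le (he : ∀ k, ‖e k‖ = 1) :
    ∫⁻ q, incrVar lam e q ∂((cubeMeasure d).prod (cubeMeasure d))
      ≤ 4 * ∑' k, ENNReal.ofReal (lam k) := by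
  have hmk : ∀ k, Measurable fun q : (Fin d → ℝ) × (Fin d → ℝ) => ‖e k q.1 - e k q.2‖ₑ ^ 2 :=
    fun k => (((measurable_Lp (e k)).comp measurable_fst).sub
      ((measurable_Lp (e k)).comp measurable_snd)).enorm.pow_const 2
  have h1 : ∀ k, ∫⁻ q, ‖e k q.1 - e k q.2‖ₑ ^ 2 ∂((cubeMeasure d).prod (cubeMeasure d)) ≤ 4 := by
    intro k
    have hpt : ∀ a b : ℝ, ‖a - b‖ₑ ^ 2 ≤ 2 * (‖a‖ₑ ^ 2 + ‖b‖ₑ ^ 2) := fun a b => by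
      simp only [enorm_eq_nnnorm]
      norm_cast
      rw [← NNReal.coe_le_coe]
      push_cast
      simp only [Real.norm_eq_abs, sq_abs]
      nlinarith [sq_nonneg (a + b)]
    have hn : ∫⁻ x, ‖e k x‖ₑ ^ 2 ∂(cubeMeasure d) = 1 := by
      rw [← enorm_Lp_sq, ← ofReal_norm, he]; simp
    rw [lintegral_prod _ (hmk k).aemeasurable]
    refine (lintegral_mono fun x => lintegral_mono fun y => hpt _ _).trans ?_
    have hm : Measurable fun x => ‖e k x‖ₑ ^ 2 := (measurable_Lp (e k)).enorm.pow_const 2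
    simp_rw [lintegral_const_mul' _ _ ENNReal.ofNat_ne_top, lintegral_add_left measurable_const,
      lintegral_const, measure_univ, mul_one, hn]
    rw [lintegral_add_left hm, hn, lintegral_const, measure_univ]
    norm_num
  unfold incrVar
  rw [lintegral_tsum fun k => ((hmk k).const_mul _).aemeasurable, mul_comm,
    ← ENNReal.tsum_mul_right]
  refine ENNReal.tsum_le_tsum fun k => ?_
  rw [lintegral_const_mul' _ _ ENNReal.ofReal_ne_top]
  exact mul_le_mul_right (h1 k) _

/-- The characteristic function of the spatial increments of a Gaussian series. It is known for
the partial sums; their convergence in `L²`, almost surely, gives convergence in `L¹(dx dy)` of the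
characteristic functions. -/
lemma ae_integral_cexp_eq_of_measurable (hXm : ∀ k, Measurable (X k))
    (hX : ∀ k, HasLaw (X k) (gaussianReal 0 v) P) (hind : iIndepFun X P)
    (hlam : ∀ k, 0 ≤ lam k) (hs : Summable lam) (he : ∀ k, ‖e k‖ = 1)
    {D : Ω → StateSpace d} (hDm : Measurable D)
    (hD : ∀ᵐ ω ∂P, HasSum (fun k => (√(lam k) * X k ω) • e k) (D ω))
    {ev : StateSpace d → (Fin d → ℝ) → ℝ} (hev : Measurable (Function.uncurry ev))
    (hev' : ∀ v, ev v =ᵐ[cubeMeasure d] v) :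
    ∀ᵐ q ∂((cubeMeasure d).prod (cubeMeasure d)),
      ∫ ω, Complex.exp ((2 * Real.pi * (ev (D ω) q.1 - ev (D ω) q.2) : ℝ) * Complex.I) ∂P
        = (Real.exp (-(v * (4 * Real.pi ^ 2 * (incrVar lam e q).toReal)) / 2) : ℝ) := by
  set μ := cubeMeasure d with hμ
  set s : ℕ → Ω → (Fin d → ℝ) → ℝ := fun N ω x =>
    ∑ k ∈ Finset.range N, (√(lam k) * X k ω) * e k x with hsdef
  have hsm : ∀ N, Measurable fun p : Ω × (Fin d → ℝ) => s N p.1 p.2 := fun N =>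
    Finset.measurable_sum _ fun k _ => (((hXm k).comp measurable_fst).const_mul _).mul
      ((measurable_Lp (e k)).comp measurable_snd)
  have hevm : Measurable fun p : Ω × (Fin d → ℝ) => ev (D p.1) p.2 :=
    hev.comp ((hDm.comp measurable_fst).prodMk measurable_snd)
  set F : ℕ → Ω × ((Fin d → ℝ) × (Fin d → ℝ)) → ℂ := fun N p =>
    Complex.exp ((2 * Real.pi * (s N p.1 p.2.1 - s N p.1 p.2.2) : ℝ) * Complex.I) with hF
  set G : Ω × ((Fin d → ℝ) × (Fin d → ℝ)) → ℂ := fun p =>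
    Complex.exp ((2 * Real.pi * (ev (D p.1) p.2.1 - ev (D p.1) p.2.2) : ℝ) * Complex.I) with hG
  have hp1 : Measurable fun p : Ω × ((Fin d → ℝ) × (Fin d → ℝ)) => (p.1, p.2.1) := by fun_prop
  have hp2 : Measurable fun p : Ω × ((Fin d → ℝ) × (Fin d → ℝ)) => (p.1, p.2.2) := by fun_prop
  have hcis : Measurable fun a : ℝ => Complex.exp (a * Complex.I) := by fun_prop
  have hFm : ∀ N, Measurable (F N) := fun N =>
    hcis.comp ((((hsm N).comp hp1).sub ((hsm N).comp hp2)).const_mul _)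
  have hGm : Measurable G := hcis.comp (((hevm.comp hp1).sub (hevm.comp hp2)).const_mul _)
  have hF1 : ∀ N p, ‖F N p‖ = 1 := fun N p => Complex.norm_exp_ofReal_mul_I _
  have hG1 : ∀ p, ‖G p‖ = 1 := fun p => Complex.norm_exp_ofReal_mul_I _
  have hFGm : ∀ N, Measurable fun p => ‖F N p - G p‖ₑ := fun N => ((hFm N).sub hGm).enorm
  -- the partial sums as elements of `L²`
  set S : ℕ → Ω → StateSpace d := fun N ω =>
    ∑ k ∈ Finset.range N, (√(lam k) * X k ω) • e k with hS
  have hsS : ∀ N ω, s N ω =ᵐ[μ] S N ω := fun N ω => by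
    have h1 : ∀ᵐ x ∂μ, ∀ k ∈ Finset.range N, ((√(lam k) * X k ω) • e k : StateSpace d) x
        = (√(lam k) * X k ω) * e k x :=
      (Finset.eventually_all _).2 fun k _ => by
        filter_upwards [Lp.coeFn_smul (√(lam k) * X k ω) (e k)] with x hx
        rw [hx, Pi.smul_apply, smul_eq_mul]
    filter_upwards [h1, Lp.coeFn_finsetSum (Finset.range N)
      fun k => ((√(lam k) * X k ω) • e k : StateSpace d)] with x h1 h2
    rw [h2, Finset.sum_apply, Finset.sum_congr rfl h1]
  have hbound : ∀ N ω, ∫⁻ q, ‖F N (ω, q) - G (ω, q)‖ₑ ∂(μ.prod μ)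
      ≤ ENNReal.ofReal (4 * Real.pi) * ‖S N ω - D ω‖ₑ := fun N ω => by
    set δ : (Fin d → ℝ) → ℝ≥0∞ := fun x => ‖s N ω x - ev (D ω) x‖ₑ with hδ
    have hδm : Measurable δ :=
      (((hsm N).comp measurable_prodMk_left).sub (hevm.comp measurable_prodMk_left)).enorm
    have hδle : ∫⁻ x, δ x ∂μ ≤ ‖S N ω - D ω‖ₑ := by
      have h1 : ∫⁻ x, δ x ∂μ = eLpNorm (S N ω - D ω : StateSpace d) 1 μ := by
        rw [eLpNorm_one_eq_lintegral_enorm]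
        refine lintegral_congr_ae ?_
        filter_upwards [hsS N ω, hev' (D ω), Lp.coeFn_sub (S N ω) (D ω)] with x h1 h2 h3
        rw [h3, Pi.sub_apply, hδ, ← h1, ← h2]
      rw [h1, Lp.enorm_def]
      exact eLpNorm_le_eLpNorm_of_exponent_le one_le_two (Lp.aestronglyMeasurable _)
    have hpt : ∀ q : (Fin d → ℝ) × (Fin d → ℝ), ‖F N (ω, q) - G (ω, q)‖ₑ
        ≤ ENNReal.ofReal (2 * Real.pi) * (δ q.1 + δ q.2) := fun q => by
      rw [← ofReal_norm]
      refine (ENNReal.ofReal_le_ofReal (norm_cexp_sub_cexp_le _ _)).trans ?_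
      have h2 : 2 * Real.pi * (s N ω q.1 - s N ω q.2)
          - 2 * Real.pi * (ev (D ω) q.1 - ev (D ω) q.2)
          = 2 * Real.pi * ((s N ω q.1 - ev (D ω) q.1) - (s N ω q.2 - ev (D ω) q.2)) := by ring
      simp only
      rw [h2, abs_mul, abs_of_pos (by positivity : 0 < 2 * Real.pi),
        ENNReal.ofReal_mul (by positivity)]
      refine mul_le_mul_right ?_ _
      rw [← Real.norm_eq_abs, ofReal_norm]
      exact enorm_sub_le
    have hδ2 : Measurable fun q : (Fin d → ℝ) × (Fin d → ℝ) => δ q.1 + δ q.2 :=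
      (hδm.comp measurable_fst).add (hδm.comp measurable_snd)
    refine (lintegral_mono hpt).trans ?_
    rw [lintegral_const_mul' _ _ ENNReal.ofReal_ne_top, lintegral_prod _ hδ2.aemeasurable]
    simp_rw [lintegral_add_left measurable_const, lintegral_const, measure_univ, mul_one]
    rw [lintegral_add_right _ measurable_const, lintegral_const, measure_univ, mul_one, ← two_mul,
      ← mul_assoc]
    refine mul_le_mul' (le_of_eq ?_) hδle
    rw [← ENNReal.ofReal_ofNat 2, ← ENNReal.ofReal_mul (by positivity)]
    congr 1
    ring
  have htend : Filter.Tendsto (fun N => ∫⁻ ω, ∫⁻ q, ‖F N (ω, q) - G (ω, q)‖ₑ ∂(μ.prod μ) ∂P)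
      Filter.atTop (nhds 0) := by
    have h0 : ∫⁻ _ω, (0 : ℝ≥0∞) ∂P = 0 := lintegral_zero
    rw [← h0]
    refine tendsto_lintegral_of_dominated_convergence (fun _ => 2)
      (fun N => (hFGm N).lintegral_prod_right') (fun N => Filter.Eventually.of_forall fun ω => ?_)
      (by simp) ?_
    · refine (lintegral_mono (g := fun _ => (2 : ℝ≥0∞)) fun q => ?_).trans (by simp)
      rw [← ofReal_norm, ← ENNReal.ofReal_ofNat 2]
      refine ENNReal.ofReal_le_ofReal ((norm_sub_le _ _).trans ?_)
      rw [hF1, hG1]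
      norm_num
    · filter_upwards [hD] with ω hω
      have h1 : Filter.Tendsto (fun N => ‖S N ω - D ω‖ₑ) Filter.atTop (nhds 0) := by
        have h2 := (hω.tendsto_sum_nat.sub_const (D ω)).enorm
        simpa using h2
      have h3 := ENNReal.Tendsto.const_mul (a := ENNReal.ofReal (4 * Real.pi)) h1
        (Or.inr ENNReal.ofReal_ne_top)
      rw [mul_zero] at h3
      exact tendsto_of_tendsto_of_tendsto_of_le_of_le tendsto_const_nhds h3 (fun _ => zero_le)
        fun N => hbound N ω
  have hFi : ∀ N q, Integrable (fun ω => F N (ω, q)) P := fun N q =>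
    Integrable.of_bound ((hFm N).comp measurable_prodMk_right).aestronglyMeasurable 1
      (Filter.Eventually.of_forall fun ω => (hF1 N _).le)
  have hGi : ∀ q, Integrable (fun ω => G (ω, q)) P := fun q =>
    Integrable.of_bound (hGm.comp measurable_prodMk_right).aestronglyMeasurable 1
      (Filter.Eventually.of_forall fun ω => (hG1 _).le)
  have hL1 : Filter.Tendsto (fun N => eLpNorm ((fun q => ∫ ω, F N (ω, q) ∂P)
      - fun q => ∫ ω, G (ω, q) ∂P) 1 (μ.prod μ)) Filter.atTop (nhds 0) := by
    refine tendsto_of_tendsto_of_tendsto_of_le_of_le tendsto_const_nhds htend (fun _ => zero_le)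
      fun N => ?_
    rw [eLpNorm_one_eq_lintegral_enorm]
    simp only
    rw [lintegral_lintegral_swap (hFGm N).aemeasurable]
    refine lintegral_mono fun q => ?_
    rw [Pi.sub_apply, ← integral_sub (hFi N q) (hGi q)]
    exact enorm_integral_le_lintegral_enorm _
  have hmeas := tendstoInMeasure_of_tendsto_eLpNorm one_ne_zero (fun N =>
    ((hFm N).comp measurable_swap).stronglyMeasurable.integral_prod_right'.aestronglyMeasurable)
    ((hGm.comp measurable_swap).stronglyMeasurable.integral_prod_right'.aestronglyMeasurable) hL1
  obtain ⟨ns, hns, hlim⟩ := hmeas.exists_seq_tendsto_ae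
  have hfin : ∀ᵐ q ∂(μ.prod μ), incrVar lam e q < ∞ := by
    refine ae_lt_top (measurable_incrVar lam e) ((lintegral_incrVar_le he).trans_lt ?_).ne
    refine ENNReal.mul_lt_top (by simp) ?_
    rw [← ENNReal.ofReal_tsum_of_nonneg hlam hs]
    exact ENNReal.ofReal_lt_top
  filter_upwards [hlim, hfin] with q hq hfinq
  have hpart : ∀ N, ∫ ω, F N (ω, q) ∂P = (Real.exp (-(v * (4 * Real.pi ^ 2
      * (∑ k ∈ Finset.range N, ENNReal.ofReal (lam k)
        * ‖e k q.1 - e k q.2‖ₑ ^ 2).toReal)) / 2) : ℝ) := fun N => by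
    have h := integral_cexp_sum_mul hX hind
      (fun k => 2 * Real.pi * √(lam k) * (e k q.1 - e k q.2)) N
    have h1 : ∀ ω, 2 * Real.pi * (s N ω q.1 - s N ω q.2) = ∑ k ∈ Finset.range N,
        2 * Real.pi * √(lam k) * (e k q.1 - e k q.2) * X k ω := fun ω => by
      rw [hsdef, ← Finset.sum_sub_distrib, Finset.mul_sum]
      refine Finset.sum_congr rfl fun k _ => ?_
      ring
    have h2 : (∑ k ∈ Finset.range N, ENNReal.ofReal (lam k) * ‖e k q.1 - e k q.2‖ₑ ^ 2).toReal
        = ∑ k ∈ Finset.range N, lam k * (e k q.1 - e k q.2) ^ 2 := by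
      rw [ENNReal.toReal_sum fun k _ => ENNReal.mul_ne_top ENNReal.ofReal_ne_top
        (ENNReal.pow_ne_top enorm_ne_top)]
      refine Finset.sum_congr rfl fun k _ => ?_
      rw [ENNReal.toReal_mul, ENNReal.toReal_ofReal (hlam k), ENNReal.toReal_pow, toReal_enorm,
        Real.norm_eq_abs, sq_abs]
    simp only [hF, h1]
    have h3 : ∑ k ∈ Finset.range N, (2 * Real.pi * √(lam k) * (e k q.1 - e k q.2)) ^ 2
        = 4 * Real.pi ^ 2 * ∑ k ∈ Finset.range N, lam k * (e k q.1 - e k q.2) ^ 2 := by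
      rw [Finset.mul_sum]
      refine Finset.sum_congr rfl fun k _ => ?_
      rw [mul_pow, mul_pow, Real.sq_sqrt (hlam k)]
      ring
    rw [h, h2, h3]
  have hlim2 : Filter.Tendsto (fun N => ∫ ω, F N (ω, q) ∂P) Filter.atTop
      (nhds ((Real.exp (-(v * (4 * Real.pi ^ 2 * (incrVar lam e q).toReal)) / 2) : ℝ) : ℂ)) := by
    simp_rw [hpart]
    have h1 : Filter.Tendsto (fun N => (∑ k ∈ Finset.range N, ENNReal.ofReal (lam k)
        * ‖e k q.1 - e k q.2‖ₑ ^ 2).toReal) Filter.atTop (nhds (incrVar lam e q).toReal) :=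
      (ENNReal.tendsto_toReal hfinq.ne).comp (ENNReal.tendsto_nat_tsum _)
    have hc : Continuous fun a : ℝ =>
        ((Real.exp (-(v * (4 * Real.pi ^ 2 * a)) / 2) : ℝ) : ℂ) := by fun_prop
    exact (hc.tendsto _).comp h1
  exact tendsto_nhds_unique hq (hlim2.comp hns.tendsto_atTop)

lemma ae_integral_cexp_eq
    (hX : ∀ k, HasLaw (X k) (gaussianReal 0 v) P) (hind : iIndepFun X P)
    (hlam : ∀ k, 0 ≤ lam k) (hs : Summable lam) (he : ∀ k, ‖e k‖ = 1)
    {D : Ω → StateSpace d} (hDm : Measurable D)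
    (hD : ∀ᵐ ω ∂P, HasSum (fun k => (√(lam k) * X k ω) • e k) (D ω))
    {ev : StateSpace d → (Fin d → ℝ) → ℝ} (hev : Measurable (Function.uncurry ev))
    (hev' : ∀ v, ev v =ᵐ[cubeMeasure d] v) :
    ∀ᵐ q ∂((cubeMeasure d).prod (cubeMeasure d)),
      ∫ ω, Complex.exp ((2 * Real.pi * (ev (D ω) q.1 - ev (D ω) q.2) : ℝ) * Complex.I) ∂P
        = (Real.exp (-(v * (4 * Real.pi ^ 2 * (incrVar lam e q).toReal)) / 2) : ℝ) := by
  have hmk : ∀ k, X k =ᵐ[P] (hX k).aemeasurable.mk := fun k => (hX k).aemeasurable.ae_eq_mk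
  refine ae_integral_cexp_eq_of_measurable (X := fun k => (hX k).aemeasurable.mk)
    (fun k => (hX k).aemeasurable.measurable_mk) (fun k => (hX k).congr (hmk k).symm)
    (hind.congr hmk) hlam hs he hDm ?_ hev hev'
  filter_upwards [hD, ae_all_iff.2 hmk] with ω hω h
  simpa only [← h] using hω

end GaussianSeries

/-! ### The driving Wiener process -/

section Wiener

variable {d : ℕ} {Ω : Type*} {mΩ : MeasurableSpace Ω} {P : Measure Ω}
  {𝓕 : Filtration ℝ≥0 mΩ} {lam : ℕ → ℝ} {e : ℕ → StateSpace d} {W : ℝ≥0 → Ω → StateSpace d}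

lemma IsTraceClassSpectrum.lam_nonneg {Q : StateSpace d →L[ℝ] StateSpace d}
    (hQ : IsTraceClassSpectrum Q lam e) (k : ℕ) : 0 ≤ lam k := by
  have h := hQ.isPositive.inner_nonneg_left (e k)
  rwa [hQ.eigen, inner_smul_left, real_inner_self_eq_norm_sq, hQ.orthonormal.1 k, one_pow, mul_one]
    at h

lemma IsWienerProcess.measurable (hW : IsWienerProcess P 𝓕 lam e W) (t : ℝ≥0) :
    Measurable[𝓕 t] (W t) :=
  (hW.adapted t).measurable

lemma IsWienerProcess.exists_increment (hW : IsWienerProcess P 𝓕 lam e W) {s t : ℝ≥0}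
    (hst : s ≤ t) :
    ∃ X : ℕ → Ω → ℝ, (∀ k, HasLaw (X k) (gaussianReal 0 (t - s)) P) ∧ iIndepFun X P ∧
      ∀ᵐ ω ∂P, HasSum (fun k => (√(lam k) * X k ω) • e k) (W t ω - W s ω) := by
  obtain ⟨B, hB, hind, hsum⟩ := hW.expansion
  refine ⟨fun k ω => B k t ω - B k s ω, fun k => ?_, ?_, ?_⟩
  · have h := (hB k).toIsPreBrownianReal.hasLaw_sub t s
    have h1 : nndist t.1 s.1 = t - s := by
      rw [← NNReal.coe_inj, coe_nndist, Real.dist_eq, NNReal.coe_sub hst]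
      exact abs_of_nonneg (sub_nonneg.2 hst)
    rw [h1] at h
    exact h
  · exact hind.comp (fun _ b => b t - b s) fun _ =>
      (measurable_pi_apply t).sub (measurable_pi_apply s)
  · filter_upwards [hsum] with ω hω
    have h := (hω t).sub (hω s)
    refine h.congr_fun fun k => ?_
    rw [← sub_smul, mul_sub]

lemma IsWienerProcess.ae_zero (hW : IsWienerProcess P 𝓕 lam e W) : ∀ᵐ ω ∂P, W 0 ω = 0 := by
  obtain ⟨B, hB, -, hsum⟩ := hW.expansion
  filter_upwards [hsum, ae_all_iff.2 fun k => (hB k).toIsPreBrownianReal.eval_zero_ae_eq_zero]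
    with ω hω h0
  have h := hω 0
  simp only [h0, mul_zero, zero_smul] at h
  exact h.unique hasSum_zero

lemma tsum_le_mul_Psi_sq (hd : 0 < d) (he : ∀ k, ‖e k‖ = 1) {n : ℕ} (hn : 1 ≤ n) :
    ∑' k, ENNReal.ofReal (lam k) * ‖galerkinErr d n (e k)‖ₑ ^ 2
      ≤ (2 ^ d * d ^ 2 : ℝ≥0) * Psi lam e n ^ 2 := by
  set c : ℝ≥0 := 2 ^ d * d ^ 2 with hc
  have hc1 : 1 ≤ c := by
    have h1 : (1 : ℝ≥0) ≤ d := by exact_mod_cast hd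
    exact one_le_mul (one_le_pow₀ one_le_two) (one_le_pow₀ h1)
  have hc0 : (c : ℝ≥0∞) ≠ 0 := by
    exact_mod_cast (zero_lt_one.trans_le hc1).ne'
  have hPsi : Psi lam e n ^ 2 = ⨅ (m : ℕ) (_ : 1 ≤ m),
      ((∑ k ∈ Finset.range m, ENNReal.ofReal (lam k) * l2Modulus (e k) (1 / n) ^ 2)
        + ∑' k, ENNReal.ofReal (lam (m + k))) := by
    rw [Psi, ← ENNReal.rpow_natCast, ← ENNReal.rpow_mul]
    norm_num
  rw [hPsi, ← ENNReal.div_le_iff' hc0 ENNReal.coe_ne_top]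
  refine le_iInf₂ fun m _ => ?_
  rw [ENNReal.div_le_iff' hc0 ENNReal.coe_ne_top,
    ← Summable.sum_add_tsum_nat_add' (k := m) ENNReal.summable, mul_add, Finset.mul_sum]
  refine add_le_add (Finset.sum_le_sum fun k _ => ?_) ?_
  · rw [mul_left_comm]
    refine mul_le_mul_right ?_ _
    rw [galerkinErr_apply]
    refine (enorm_sub_galerkinProj_sq_le hd hn (e k)).trans_eq ?_
    rw [hc]
    push_cast
    ring
  · -- beyond the index `m` the projection error of `e k` is only bounded by `‖e k‖ = 1`
    rw [← ENNReal.tsum_mul_left]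
    refine ENNReal.tsum_le_tsum fun k => ?_
    have h1 : ‖galerkinErr d n (e (k + m))‖ₑ ^ 2 ≤ 1 := by
      refine pow_le_one₀ zero_le ?_
      rw [galerkinErr_apply, ← ofReal_norm, ENNReal.ofReal_le_one, ← he (k + m)]
      exact norm_sub_galerkinProj_le hn _
    rw [add_comm m k, mul_comm (c : ℝ≥0∞)]
    exact mul_le_mul_right (h1.trans (by exact_mod_cast hc1)) _

lemma eLpNorm_sub_galerkinProj_le [IsProbabilityMeasure P] (hd : 0 < d)
    {Q : StateSpace d →L[ℝ] StateSpace d}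
    (hQ : IsTraceClassSpectrum Q lam e) (hW : IsWienerProcess P 𝓕 lam e W) {n : ℕ} (hn : 1 ≤ n)
    {t T : ℝ≥0} (ht : t ≤ T) :
    eLpNorm (fun ω => W t ω - galerkinProj n (W t ω)) 2 P
      ≤ NNReal.sqrt (T * (2 ^ d * d ^ 2)) * Psi lam e n := by
  refine le_sqrt_mul_of_sq_le ?_
  obtain ⟨X, hX, hind, hsum⟩ := hW.exists_increment (zero_le : 0 ≤ t)
  have hsum' : ∀ᵐ ω ∂P, HasSum (fun k => (√(lam k) * X k ω) • e k) (W t ω) := by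
    filter_upwards [hsum, hW.ae_zero] with ω h1 h2
    rwa [h2, sub_zero] at h1
  have h := lintegral_enorm_map_sq_le hX hind hQ.lam_nonneg hsum' (galerkinErr d n)
  rw [eLpNorm_two_sq]
  simp_rw [← galerkinErr_apply]
  refine h.trans ?_
  rw [ENNReal.coe_mul, mul_assoc]
  refine mul_le_mul' (ENNReal.coe_le_coe.2 (by simpa using ht))
    (tsum_le_mul_Psi_sq hd hQ.orthonormal.1 hn)

end Wiener

/-! ### Regularity of the mild solution -/

instance instSecondCountableStateSpace (d : ℕ) : SecondCountableTopology (StateSpace d) := by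
  have : Fact ((2 : ℝ≥0∞) ≠ ∞) := ⟨ENNReal.ofNat_ne_top⟩
  infer_instance

section Drift

lemma isClosed_abs_coeFn_le {X : Type*} {mX : MeasurableSpace X} {μ : Measure X} (c : ℝ) :
    IsClosed {v : Lp ℝ 2 μ | ∀ᵐ x ∂μ, |v x| ≤ c} := by
  refine IsSeqClosed.isClosed fun v w hv hw => ?_
  obtain ⟨ns, -, hlim⟩ := (tendstoInMeasure_of_tendsto_Lp hw).exists_seq_tendsto_ae
  filter_upwards [hlim, ae_all_iff.2 hv] with x hx hvx
  exact le_of_tendsto' hx.abs fun k => hvx _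

lemma convex_abs_coeFn_le {X : Type*} {mX : MeasurableSpace X} {μ : Measure X} (c : ℝ) :
    Convex ℝ {v : Lp ℝ 2 μ | ∀ᵐ x ∂μ, |v x| ≤ c} := by
  intro v hv w hw a b ha hb hab
  filter_upwards [hv, hw, Lp.coeFn_add (a • v) (b • w), Lp.coeFn_smul a v, Lp.coeFn_smul b w]
    with x h1 h2 h3 h4 h5
  rw [h3, Pi.add_apply, h4, h5, Pi.smul_apply, Pi.smul_apply, smul_eq_mul, smul_eq_mul]
  calc |a * v x + b * w x| ≤ a * |v x| + b * |w x| := by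
        refine (abs_add_le _ _).trans ?_
        rw [abs_mul, abs_mul, abs_of_nonneg ha, abs_of_nonneg hb]
    _ ≤ a * c + b * c := add_le_add (mul_le_mul_of_nonneg_left h1 ha)
        (mul_le_mul_of_nonneg_left h2 hb)
    _ = c := by rw [← add_mul, hab, one_mul]

/-- A pointwise bound passes through the Bochner integral, since it defines a closed convex set. -/
lemma ae_abs_intervalIntegral_le {X : Type*} {mX : MeasurableSpace X} {μ : Measure X} {c a b : ℝ}
    (hab : a ≤ b) {f : ℝ → Lp ℝ 2 μ} (hf : ∀ s, ∀ᵐ x ∂μ, |f s x| ≤ c)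
    (hfi : IntervalIntegrable f volume a b) :
    ∀ᵐ x ∂μ, |(∫ s in a..b, f s) x| ≤ (b - a) * c := by
  rcases hab.eq_or_lt with rfl | hlt
  · filter_upwards [Lp.coeFn_zero ℝ 2 μ] with x hx
    rw [intervalIntegral.integral_same, hx]
    simp
  · have hmem := (convex_abs_coeFn_le (μ := μ) c).set_average_mem (isClosed_abs_coeFn_le c)
      (μ := volume) (t := Set.Ioc a b) (f := f) (by simp [hlt]) (by simp)
      (Filter.Eventually.of_forall hf) hfi.1
    have heq : ∫ s in a..b, f s = (b - a) • ⨍ s in Set.Ioc a b, f s := by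
      rw [setAverage_eq, intervalIntegral.integral_of_le hab, smul_smul,
        Real.volume_real_Ioc_of_le hab,
        mul_inv_cancel₀ (sub_pos.2 hlt).ne', one_smul]
    rw [heq]
    filter_upwards [hmem, Lp.coeFn_smul (b - a) (⨍ s in Set.Ioc a b, f s)] with x h1 h2
    rw [h2, Pi.smul_apply, smul_eq_mul, abs_mul, abs_of_pos (sub_pos.2 hlt)]
    exact mul_le_mul_of_nonneg_left h1 (sub_pos.2 hlt).le

end Drift

section Solution

variable {d : ℕ} {Ω : Type*} {mΩ : MeasurableSpace Ω} {P : Measure Ω}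
  {𝓕 : Filtration ℝ≥0 mΩ} {T : ℝ≥0} {K : (Fin d → ℝ) → (Fin d → ℝ) → ℝ} {κ : ℝ≥0}
  {g : StateSpace d} {W u : ℝ≥0 → Ω → StateSpace d}

lemma IsMildSolution.measurable_uncurry (hu : IsMildSolution P 𝓕 T K kuramotoS g W u) :
    Measurable (Function.uncurry u) := by
  refine hu.predictable.measurable.mono ?_ le_rfl
  refine measurableSpace_le_predictable_of_measurableSet (fun A hA => ?_) fun i A hA => ?_
  · exact (measurableSet_singleton _).prod (𝓕.le _ _ hA)
  · exact measurableSet_Ioi.prod (𝓕.le _ _ hA)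

lemma IsMildSolution.measurable (hu : IsMildSolution P 𝓕 T K kuramotoS g W u) (t : ℝ≥0) :
    Measurable[𝓕 t] (u t) :=
  (hu.predictable.stronglyAdapted t).measurable

lemma IsMildSolution.measurable_drift (hK : IsAdmissibleKernel K)
    (hu : IsMildSolution P 𝓕 T K kuramotoS g W u) :
    Measurable fun p : ℝ × Ω => interactionOp K kuramotoS (u p.1.toNNReal p.2) := by
  refine (continuous_interactionOp hK).measurable.comp (hu.measurable_uncurry.comp
    (f := fun p : ℝ × Ω => (p.1.toNNReal, p.2)) ?_)
  fun_prop

lemma IsMildSolution.intervalIntegrable_drift (hK : IsAdmissibleKernel K)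
    (hu : IsMildSolution P 𝓕 T K kuramotoS g W u) (ω : Ω) (a b : ℝ) :
    IntervalIntegrable (fun s : ℝ => interactionOp K kuramotoS (u s.toNNReal ω)) volume a b := by
  obtain ⟨κ, hκ⟩ := hK.exists_rowBound
  have hm : Measurable fun s : ℝ => interactionOp K kuramotoS (u s.toNNReal ω) :=
    Measurable.comp (g := fun p : ℝ × Ω => interactionOp K kuramotoS (u p.1.toNNReal p.2))
      (f := fun s => (s, ω)) (hu.measurable_drift hK) measurable_prodMk_right
  have hc : IntervalIntegrable (fun _ : ℝ => (NNReal.sqrt κ : ℝ)) volume a b :=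
    intervalIntegrable_const
  refine hc.mono_fun' hm.aestronglyMeasurable (Filter.Eventually.of_forall fun s => ?_)
  exact norm_interactionOp_le hK hκ _

/-- Between two times, the solution moves with the noise up to a pointwise bounded drift. -/
lemma IsMildSolution.ae_abs_increment_le (hK : IsAdmissibleKernel K) (hκ : RowBound K κ)
    (hu : IsMildSolution P 𝓕 T K kuramotoS g W u) {s t : ℝ≥0} (hst : s ≤ t) (ht : t ≤ T) :
    ∀ᵐ ω ∂P, ∀ᵐ x ∂(cubeMeasure d),
      |u t ω x - (u s ω x + (W t ω - W s ω : StateSpace d) x)| ≤ (t - s) * NNReal.sqrt κ := by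
  filter_upwards [hu.eqn] with ω hω
  have h1 : u t ω - (u s ω + (W t ω - W s ω))
      = ∫ r in (s : ℝ)..t, interactionOp K kuramotoS (u r.toNNReal ω) := by
    rw [← intervalIntegral.integral_interval_sub_left
      (hu.intervalIntegrable_drift hK ω 0 t) (hu.intervalIntegrable_drift hK ω 0 s),
      hω t ht, hω s (hst.trans ht)]
    abel
  have h2 := ae_abs_intervalIntegral_le (NNReal.coe_le_coe.2 hst)
    (fun r => ae_abs_interactionOp_le hK hκ (u (Real.toNNReal r) ω))
    (hu.intervalIntegrable_drift hK ω s t)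
  rw [← h1] at h2
  filter_upwards [h2, Lp.coeFn_sub (u t ω) (u s ω + (W t ω - W s ω)),
    Lp.coeFn_add (u s ω) (W t ω - W s ω)] with x h3 h4 h5
  rwa [h4, Pi.sub_apply, h5, Pi.add_apply] at h3

end Solution

/-! ### The consistency error in time -/

section Grid

variable {Ω : Type*} {mΩ : MeasurableSpace Ω} {P : Measure Ω} [IsProbabilityMeasure P]
  {𝓕 : Filtration ℝ≥0 mΩ}

lemma mul_one_sub_exp_sq_le {a τ T v : ℝ} {k : ℕ} (hv : 0 ≤ v) (ha : a ≤ τ) (hk : k * τ ≤ T) :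
    k * (1 - Real.exp (-(a * v) / 2) ^ 2) ≤ T * v := by
  have h1 : Real.exp (-(a * v) / 2) ^ 2 = Real.exp (-(a * v)) := by
    rw [← Real.exp_nat_mul]
    congr 1
    push_cast
    ring
  have h2 := Real.add_one_le_exp (-(a * v))
  have h3 := mul_le_mul_of_nonneg_right ha hv
  rw [h1]
  calc k * (1 - Real.exp (-(a * v))) ≤ k * (τ * v) :=
        mul_le_mul_of_nonneg_left (by linarith) (Nat.cast_nonneg k)
    _ = k * τ * v := by ring
    _ ≤ T * v := mul_le_mul_of_nonneg_right hk hv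

/-- The phase lemma on a uniform time grid of step `τ`: `θ` is an adapted phase, `Δ s t` are its
Gaussian increments with variance rate `v`, and `b` bounds the drift. -/
lemma lintegral_sum_sin_sub_grid_le {θ : ℝ≥0 → Ω → ℝ} {Δ : ℝ≥0 → ℝ≥0 → Ω → ℝ} {v b : ℝ}
    {τ r T : ℝ≥0} {k : ℕ} (hv : 0 ≤ v) (hb : 0 ≤ b) (hr : r ≤ τ) (hk : k * τ ≤ T)
    (hθ : ∀ t, Measurable[𝓕 t] (θ t)) (hΔ : ∀ s t, s ≤ t → Measurable[𝓕 t] (Δ s t))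
    (hind : ∀ s t, s ≤ t → Indep (MeasurableSpace.comap (Δ s t) inferInstance) (𝓕 s) P)
    (hcf : ∀ ρ, ρ = τ ∨ ρ = r → ∀ j < k,
      ∫ ω, Complex.exp (Δ (j * τ) (j * τ + ρ) ω * Complex.I) ∂P = (Real.exp (-(ρ * v) / 2) : ℝ))
    (hstep : ∀ ρ, ρ = τ ∨ ρ = r → ∀ j < k,
      ∀ᵐ ω ∂P, |θ (j * τ + ρ) ω - (θ (j * τ) ω + Δ (j * τ) (j * τ + ρ) ω)| ≤ τ * b) :
    ∫⁻ ω, ‖∑ j ∈ Finset.range k, (Real.sin (θ (j * τ + r) ω) - Real.sin (θ (j * τ) ω))‖ₑ ^ 2 ∂P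
      ≤ ENNReal.ofReal (3 * ((2 + 2 * T * b) ^ 2 + 2 * T * v)) := by
  have hnext : ∀ j : ℕ, ((j + 1 : ℕ) : ℝ≥0) * τ = j * τ + τ := fun j => by push_cast; ring
  have hkT : (k : ℝ) * τ ≤ T := by exact_mod_cast hk
  have hrτ : (r : ℝ) ≤ τ := NNReal.coe_le_coe.2 hr
  refine (lintegral_sum_sin_sub_le (P := P) (𝓖 := fun j => 𝓕 (j * τ))
    (θ := fun j => θ (j * τ)) (θ' := fun j => θ (j * τ + r))
    (η := fun j => Δ (j * τ) (j * τ + τ)) (η' := fun j => Δ (j * τ) (j * τ + r))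
    (m := Real.exp (-(τ * v) / 2)) (m' := Real.exp (-(r * v) / 2)) (δ := τ * b)
    (fun i j hij => 𝓕.mono (by gcongr)) (fun j => 𝓕.le _) k (fun j => hθ _)
    (fun j => ?_) (fun j => ?_) (fun j _ => hind _ _ le_self_add) (fun j _ => hind _ _ le_self_add)
    (hcf τ (.inl rfl)) (hcf r (.inr rfl)) ?_ ?_ (fun j hj => ?_) (hstep r (.inr rfl))
    (by positivity)).trans ?_
  · rw [hnext]
    exact hΔ _ _ le_self_add
  · rw [hnext]
    exact (hΔ _ _ le_self_add).mono (𝓕.mono (add_le_add_right hr _)) le_rfl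
  · rw [Real.exp_le_one_iff]
    have : 0 ≤ (r : ℝ) * v := by positivity
    linarith
  · rw [Real.exp_le_exp]
    have := mul_le_mul_of_nonneg_right hrτ hv
    linarith
  · rw [hnext]
    exact hstep τ (.inl rfl) j hj
  · refine ENNReal.ofReal_le_ofReal ?_
    have h1 := mul_one_sub_exp_sq_le hv le_rfl hkT
    have h2 := mul_one_sub_exp_sq_le hv hrτ hkT
    have h3 : (2 + 2 * k * (τ * b)) ^ 2 ≤ (2 + 2 * T * b) ^ 2 := by
      refine pow_le_pow_left₀ (by positivity) ?_ 2
      have := mul_le_mul_of_nonneg_right hkT hb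
      linarith
    linarith

end Grid

section Consistency

variable {d : ℕ} {Ω : Type*} {mΩ : MeasurableSpace Ω} {P : Measure Ω}
  {𝓕 : Filtration ℝ≥0 mΩ} {T : ℝ≥0} {K : (Fin d → ℝ) → (Fin d → ℝ) → ℝ} {κ : ℝ≥0}
  {lam : ℕ → ℝ} {e : ℕ → StateSpace d} {Q : StateSpace d →L[ℝ] StateSpace d}
  {g : StateSpace d} {W u : ℝ≥0 → Ω → StateSpace d}

section Evaluation

variable {ev : StateSpace d → (Fin d → ℝ) → ℝ}

lemma measurable_eval_comp (hev : Measurable (Function.uncurry ev)) {m : MeasurableSpace Ω}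
    {f : Ω → StateSpace d} (hf : Measurable[m] f) (x : Fin d → ℝ) :
    Measurable[m] fun ω => ev (f ω) x := by
  have h : Measurable fun v => ev v x :=
    Measurable.comp (g := Function.uncurry ev) (f := fun v => (v, x)) hev measurable_prodMk_right
  exact Measurable.comp (g := fun v => ev v x) h hf

variable [IsProbabilityMeasure P]

lemma IsWienerProcess.ae_integral_cexp (hQ : IsTraceClassSpectrum Q lam e)
    (hW : IsWienerProcess P 𝓕 lam e W) (hev : Measurable (Function.uncurry ev))
    (hev' : ∀ v, ev v =ᵐ[cubeMeasure d] v) {s t r : ℝ≥0} (hst : s + r = t) :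
    ∀ᵐ q ∂((cubeMeasure d).prod (cubeMeasure d)),
      ∫ ω, Complex.exp ((2 * Real.pi * (ev (W t ω - W s ω) q.1 - ev (W t ω - W s ω) q.2) : ℝ)
          * Complex.I) ∂P
        = (Real.exp (-(r * (4 * Real.pi ^ 2 * (incrVar lam e q).toReal)) / 2) : ℝ) := by
  have hle : s ≤ t := hst ▸ le_self_add
  obtain ⟨X, hX, hind, hsum⟩ := hW.exists_increment hle
  have hr : t - s = r := by rw [← hst, add_tsub_cancel_left]
  rw [hr] at hX
  have hm : ∀ t, Measurable (W t) := fun t => (hW.measurable t).mono (𝓕.le t) le_rfl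
  exact ae_integral_cexp_eq hX hind hQ.lam_nonneg hQ.summable hQ.orthonormal.1
    ((hm t).sub (hm s)) hsum hev hev'

lemma IsMildSolution.ae_ae_abs_eval_increment_le (hK : IsAdmissibleKernel K) (hκ : RowBound K κ)
    (hW : IsWienerProcess P 𝓕 lam e W) (hu : IsMildSolution P 𝓕 T K kuramotoS g W u)
    (hev : Measurable (Function.uncurry ev)) (hev' : ∀ v, ev v =ᵐ[cubeMeasure d] v)
    {s t : ℝ≥0} (hst : s ≤ t) (ht : t ≤ T) :
    ∀ᵐ x ∂(cubeMeasure d), ∀ᵐ ω ∂P,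
      |ev (u t ω) x - (ev (u s ω) x + ev (W t ω - W s ω) x)| ≤ (t - s) * NNReal.sqrt κ := by
  have hWm : ∀ t, Measurable (W t) := fun t => (hW.measurable t).mono (𝓕.le t) le_rfl
  have hum : ∀ t, Measurable (u t) := fun t => (hu.measurable t).mono (𝓕.le t) le_rfl
  have hevm : ∀ f : Ω → StateSpace d, Measurable f →
      Measurable fun p : (Fin d → ℝ) × Ω => ev (f p.2) p.1 := fun f hf =>
    Measurable.comp (g := Function.uncurry ev) (f := fun p : (Fin d → ℝ) × Ω => (f p.2, p.1)) hev
      ((hf.comp measurable_snd).prodMk measurable_fst)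
  rw [Measure.ae_ae_comm]
  · filter_upwards [hu.ae_abs_increment_le hK hκ hst ht] with ω hω
    filter_upwards [hω, hev' (u t ω), hev' (u s ω), hev' (W t ω - W s ω)] with x h1 h2 h3 h4
    rwa [h2, h3, h4]
  · refine measurableSet_le (Measurable.abs ?_) measurable_const
    exact (hevm _ (hum t)).sub ((hevm _ (hum s)).add (hevm _ ((hWm t).sub (hWm s))))

/-- The pointwise form of the bound: the phase is `2π (u(x) - u(y))`. -/
lemma IsMildSolution.ae_lintegral_sum_kuramotoS_sub_sq_le (hK : IsAdmissibleKernel K)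
    (hκ : RowBound K κ) (hQ : IsTraceClassSpectrum Q lam e) (hW : IsWienerProcess P 𝓕 lam e W)
    (hu : IsMildSolution P 𝓕 T K kuramotoS g W u)
    (hev : Measurable (Function.uncurry ev)) (hev' : ∀ v, ev v =ᵐ[cubeMeasure d] v)
    {τ r : ℝ≥0} {k : ℕ} (hk : k * τ ≤ T) (hr : r ≤ τ) :
    ∀ᵐ q ∂((cubeMeasure d).prod (cubeMeasure d)), ∫⁻ ω, ‖∑ j ∈ Finset.range k,
      (kuramotoS (ev (u (j * τ + r) ω) q.1) (ev (u (j * τ + r) ω) q.2)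
        - kuramotoS (ev (u (j * τ) ω) q.1) (ev (u (j * τ) ω) q.2))‖ₑ ^ 2 ∂P
      ≤ ENNReal.ofReal (3 * (2 + 2 * T * (4 * Real.pi * NNReal.sqrt κ)) ^ 2)
        + ENNReal.ofReal (24 * Real.pi ^ 2 * T) * incrVar lam e q := by
  have hleT : ∀ j < k, (j : ℝ≥0) * τ + τ ≤ T := fun j hj => by
    refine le_trans ?_ hk
    rw [← add_one_mul]
    gcongr
    exact_mod_cast hj
  have hρτ : ∀ ρ, ρ = τ ∨ ρ = r → ρ ≤ τ := by rintro ρ (rfl | rfl) <;> simp [hr]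
  have hcf : ∀ ρ : ℝ≥0, ∀ᵐ q ∂((cubeMeasure d).prod (cubeMeasure d)), ∀ j ∈ Finset.range k,
      ∫ ω, Complex.exp ((2 * Real.pi * (ev (W (j * τ + ρ) ω - W (j * τ) ω) q.1
        - ev (W (j * τ + ρ) ω - W (j * τ) ω) q.2) : ℝ) * Complex.I) ∂P
      = (Real.exp (-(ρ * (4 * Real.pi ^ 2 * (incrVar lam e q).toReal)) / 2) : ℝ) := fun ρ =>
    (Finset.eventually_all _).2 fun j _ => hW.ae_integral_cexp hQ hev hev' rfl
  have hdr : ∀ ρ : ℝ≥0, ρ = τ ∨ ρ = r → ∀ᵐ x ∂(cubeMeasure d), ∀ j ∈ Finset.range k, ∀ᵐ ω ∂P,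
      |ev (u (j * τ + ρ) ω) x - (ev (u (j * τ) ω) x
        + ev (W (j * τ + ρ) ω - W (j * τ) ω) x)| ≤ τ * NNReal.sqrt κ := fun ρ hρ => by
    refine (Finset.eventually_all _).2 fun j hj => ?_
    have h := hu.ae_ae_abs_eval_increment_le hK hκ hW hev hev' (s := j * τ)
      (t := j * τ + ρ) le_self_add
      ((add_le_add_right (hρτ ρ hρ) _).trans (hleT j (Finset.mem_range.1 hj)))
    have h1 : ((j * τ + ρ : ℝ≥0) : ℝ) - ((j * τ : ℝ≥0) : ℝ) = ρ := by push_cast; ring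
    rw [h1] at h
    filter_upwards [h] with x hx
    filter_upwards [hx] with ω hω
    exact hω.trans (mul_le_mul_of_nonneg_right (NNReal.coe_le_coe.2 (hρτ ρ hρ))
      (NNReal.coe_nonneg _))
  filter_upwards [hcf τ, hcf r, Measure.quasiMeasurePreserving_fst.ae (hdr τ (.inl rfl)),
    Measure.quasiMeasurePreserving_snd.ae (hdr τ (.inl rfl)),
    Measure.quasiMeasurePreserving_fst.ae (hdr r (.inr rfl)),
    Measure.quasiMeasurePreserving_snd.ae (hdr r (.inr rfl))] with q hcτ hcr hxτ hyτ hxr hyr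
  have hσ0 : 0 ≤ (incrVar lam e q).toReal := ENNReal.toReal_nonneg
  have hpair : ∀ {m : MeasurableSpace Ω} {f : Ω → StateSpace d}, Measurable[m] f →
      Measurable[m] fun ω => 2 * Real.pi * (ev (f ω) q.1 - ev (f ω) q.2) := fun hf =>
    ((measurable_eval_comp hev hf q.1).sub (measurable_eval_comp hev hf q.2)).const_mul _
  have hcomb : ∀ {a a' b b' c c' : ℝ}, |a - (b + c)| ≤ τ * NNReal.sqrt κ →
      |a' - (b' + c')| ≤ τ * NNReal.sqrt κ →
      |2 * Real.pi * (a - a') - (2 * Real.pi * (b - b') + 2 * Real.pi * (c - c'))|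
        ≤ τ * (4 * Real.pi * NNReal.sqrt κ) := by
    intro a a' b b' c c' h1 h2
    have h3 : 2 * Real.pi * (a - a') - (2 * Real.pi * (b - b') + 2 * Real.pi * (c - c'))
        = 2 * Real.pi * ((a - (b + c)) - (a' - (b' + c'))) := by ring
    rw [h3, abs_mul, abs_of_pos Real.two_pi_pos,
      show (τ : ℝ) * (4 * Real.pi * NNReal.sqrt κ)
        = 2 * Real.pi * (τ * NNReal.sqrt κ + τ * NNReal.sqrt κ) by ring]
    exact mul_le_mul_of_nonneg_left ((abs_sub _ _).trans (add_le_add h1 h2)) Real.two_pi_pos.le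
  have hmain := lintegral_sum_sin_sub_grid_le (P := P) (𝓕 := 𝓕)
    (θ := fun t ω => 2 * Real.pi * (ev (u t ω) q.1 - ev (u t ω) q.2))
    (Δ := fun s t ω => 2 * Real.pi * (ev (W t ω - W s ω) q.1 - ev (W t ω - W s ω) q.2))
    (v := 4 * Real.pi ^ 2 * (incrVar lam e q).toReal) (b := 4 * Real.pi * NNReal.sqrt κ)
    (by positivity) (by positivity) hr hk (fun t => hpair (hu.measurable t))
    (fun s t hst => hpair ((hW.measurable t).sub ((hW.measurable s).mono (𝓕.mono hst) le_rfl)))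
    (fun s t hst => indep_of_indep_of_le_left (hW.indep_increments s t hst)
      (hpair (comap_measurable _)).comap_le)
    (by
      rintro ρ (rfl | rfl) j hj
      · exact hcτ j (Finset.mem_range.2 hj)
      · exact hcr j (Finset.mem_range.2 hj))
    (by
      rintro ρ (rfl | rfl) j hj
      · filter_upwards [hxτ j (Finset.mem_range.2 hj), hyτ j (Finset.mem_range.2 hj)] with ω h1 h2
        exact hcomb h1 h2
      · filter_upwards [hxr j (Finset.mem_range.2 hj), hyr j (Finset.mem_range.2 hj)] with ω h1 h2
        exact hcomb h1 h2)
  refine hmain.trans ?_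
  calc _ = ENNReal.ofReal (3 * (2 + 2 * T * (4 * Real.pi * NNReal.sqrt κ)) ^ 2
          + 24 * Real.pi ^ 2 * T * (incrVar lam e q).toReal) := by
        congr 1
        ring
    _ = ENNReal.ofReal (3 * (2 + 2 * T * (4 * Real.pi * NNReal.sqrt κ)) ^ 2)
          + ENNReal.ofReal (24 * Real.pi ^ 2 * T)
            * ENNReal.ofReal (incrVar lam e q).toReal := by
        rw [ENNReal.ofReal_add (by positivity) (by positivity),
          ENNReal.ofReal_mul (p := 24 * Real.pi ^ 2 * (T : ℝ)) (by positivity)]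
    _ ≤ _ := by
        gcongr
        exact ENNReal.ofReal_toReal_le

/-- Integration of a pointwise bound over `(x,y)`, with jointly measurable representatives. -/
lemma lintegral_enorm_sum_interactionOp_sub_sq_le (hK : IsAdmissibleKernel K)
    (hκ : RowBound K κ)
    (hev : Measurable (Function.uncurry ev)) (hev' : ∀ v, ev v =ᵐ[cubeMeasure d] v)
    {ι : Type*} (s : Finset ι) {v w : ι → Ω → StateSpace d} (hv : ∀ j, Measurable (v j))
    (hw : ∀ j, Measurable (w j)) {B : (Fin d → ℝ) × (Fin d → ℝ) → ℝ≥0∞}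
    (hB : ∀ᵐ q ∂((cubeMeasure d).prod (cubeMeasure d)), ∫⁻ ω, ‖∑ j ∈ s,
      (kuramotoS (ev (v j ω) q.1) (ev (v j ω) q.2)
        - kuramotoS (ev (w j ω) q.1) (ev (w j ω) q.2))‖ₑ ^ 2 ∂P ≤ B q) :
    ∫⁻ ω, ‖∑ j ∈ s, (interactionOp K kuramotoS (v j ω)
        - interactionOp K kuramotoS (w j ω))‖ₑ ^ 2 ∂P
      ≤ κ * ∫⁻ q, B q ∂((cubeMeasure d).prod (cubeMeasure d)) := by
  let H : Ω × ((Fin d → ℝ) × (Fin d → ℝ)) → ℝ≥0∞ := fun p => ‖∑ j ∈ s,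
    (kuramotoS (ev (v j p.1) p.2.1) (ev (v j p.1) p.2.2)
      - kuramotoS (ev (w j p.1) p.2.1) (ev (w j p.1) p.2.2))‖ₑ ^ 2
  have hevm : ∀ (h : Ω → StateSpace d) (f : Ω × ((Fin d → ℝ) × (Fin d → ℝ)) → Fin d → ℝ),
      Measurable h → Measurable f → Measurable fun p => ev (h p.1) (f p) := fun h f hh hf =>
    Measurable.comp (g := Function.uncurry ev)
      (f := fun p : Ω × ((Fin d → ℝ) × (Fin d → ℝ)) => (h p.1, f p)) hev
      ((hh.comp measurable_fst).prodMk hf)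
  have hHm : Measurable H := by
    have h1 : Measurable fun p : Ω × ((Fin d → ℝ) × (Fin d → ℝ)) => p.2.1 := by fun_prop
    have h2 : Measurable fun p : Ω × ((Fin d → ℝ) × (Fin d → ℝ)) => p.2.2 := by fun_prop
    refine (Measurable.enorm (Finset.measurable_sum _ fun j _ => ?_)).pow_const 2
    exact (Measurable.kuramotoS (hevm _ _ (hv j) h1) (hevm _ _ (hv j) h2)).sub
      (Measurable.kuramotoS (hevm _ _ (hw j) h1) (hevm _ _ (hw j) h2))
  have hω : ∀ ω, ‖∑ j ∈ s, (interactionOp K kuramotoS (v j ω)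
      - interactionOp K kuramotoS (w j ω))‖ₑ ^ 2
      ≤ κ * ∫⁻ q, H (ω, q) ∂((cubeMeasure d).prod (cubeMeasure d)) := fun ω => by
    refine (enorm_sum_interactionOp_sub_sq_le hK hκ s _ _).trans_eq ?_
    rw [lintegral_prod (fun q => H (ω, q)) (hHm.comp measurable_prodMk_left).aemeasurable]
    congr 1
    have h1 : ∀ᵐ x ∂(cubeMeasure d), ∀ j ∈ s, ev (v j ω) x = v j ω x ∧ ev (w j ω) x = w j ω x :=
      (Finset.eventually_all _).2 fun j _ => (hev' _).and (hev' _)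
    refine lintegral_congr_ae ?_
    filter_upwards [h1] with x hx
    refine lintegral_congr_ae ?_
    filter_upwards [h1] with y hy
    refine congrArg (fun a : ℝ => ‖a‖ₑ ^ 2) (Finset.sum_congr rfl fun j hj => ?_)
    rw [← (hx j hj).1, ← (hx j hj).2, ← (hy j hj).1, ← (hy j hj).2]
  calc _ ≤ ∫⁻ ω, κ * ∫⁻ q, H (ω, q) ∂((cubeMeasure d).prod (cubeMeasure d)) ∂P :=
        lintegral_mono hω
    _ = κ * ∫⁻ q, ∫⁻ ω, H (ω, q) ∂P ∂((cubeMeasure d).prod (cubeMeasure d)) := by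
        rw [lintegral_const_mul' _ _ ENNReal.coe_ne_top, lintegral_lintegral_swap hHm.aemeasurable]
    _ ≤ _ := mul_le_mul_right (lintegral_mono_ae hB) _

end Evaluation

/-- For a fixed offset `r` the sum over the grid of the drift increments is bounded in `L²`,
uniformly in the grid. -/
lemma IsMildSolution.exists_lintegral_sum_drift_sub_sq_le [IsProbabilityMeasure P]
    (hK : IsAdmissibleKernel K)
    (hQ : IsTraceClassSpectrum Q lam e) (hW : IsWienerProcess P 𝓕 lam e W)
    (hu : IsMildSolution P 𝓕 T K kuramotoS g W u) :
    ∃ C : ℝ≥0, ∀ (τ r : ℝ≥0) (k : ℕ), k * τ ≤ T → r ≤ τ →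
      ∫⁻ ω, ‖∑ j ∈ Finset.range k, (interactionOp K kuramotoS (u (j * τ + r) ω)
        - interactionOp K kuramotoS (u (j * τ) ω))‖ₑ ^ 2 ∂P ≤ C := by
  obtain ⟨κ, hκ⟩ := hK.exists_rowBound
  obtain ⟨ev, hev, hev'⟩ := exists_measurable_eval (μ := cubeMeasure d)
  obtain ⟨c₁, hc₁⟩ : ∃ c, c = 3 * (2 + 2 * T * (4 * Real.pi * NNReal.sqrt κ)) ^ 2 := ⟨_, rfl⟩
  obtain ⟨c₂, hc₂⟩ : ∃ c, c = 24 * Real.pi ^ 2 * T := ⟨_, rfl⟩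
  have hBtop : κ * (ENNReal.ofReal c₁
      + ENNReal.ofReal c₂ * (4 * ∑' k, ENNReal.ofReal (lam k))) ≠ ∞ := by
    refine ENNReal.mul_ne_top ENNReal.coe_ne_top (ENNReal.add_ne_top.2 ⟨ENNReal.ofReal_ne_top,
      ENNReal.mul_ne_top ENNReal.ofReal_ne_top (ENNReal.mul_ne_top ENNReal.ofNat_ne_top ?_)⟩)
    rw [← ENNReal.ofReal_tsum_of_nonneg hQ.lam_nonneg hQ.summable]
    exact ENNReal.ofReal_ne_top
  refine ⟨_, fun τ r k hk hr => le_of_le_of_eq ?_ (ENNReal.coe_toNNReal hBtop).symm⟩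
  have hum : ∀ t, Measurable (u t) := fun t => (hu.measurable t).mono (𝓕.le t) le_rfl
  refine (lintegral_enorm_sum_interactionOp_sub_sq_le hK hκ hev hev' (Finset.range k)
    (fun j => hum _) (fun j => hum _)
    (hu.ae_lintegral_sum_kuramotoS_sub_sq_le hK hκ hQ hW hev hev' hk hr)).trans ?_
  rw [← hc₁, ← hc₂, lintegral_add_left measurable_const, lintegral_const, measure_univ, mul_one,
    lintegral_const_mul' _ _ ENNReal.ofReal_ne_top]
  gcongr
  exact lintegral_incrVar_le hQ.orthonormal.1

end Consistency

section TimeStep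

variable {Ω : Type*} {mΩ : MeasurableSpace Ω} {P : Measure Ω}

lemma eLpNorm_intervalIntegral_le [SFinite P] {E : Type*} [NormedAddCommGroup E] [NormedSpace ℝ E]
    [MeasurableSpace E] [BorelSpace E] {G : ℝ → Ω → E} (hG : Measurable (Function.uncurry G))
    {τ C : ℝ≥0} (hC : ∀ r ∈ Set.Ioc (0 : ℝ) τ, ∫⁻ ω, ‖G r ω‖ₑ ^ 2 ∂P ≤ C) :
    eLpNorm (fun ω => ∫ r in (0 : ℝ)..τ, G r ω) 2 P ≤ NNReal.sqrt C * τ := by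
  refine le_sqrt_mul_of_sq_le ?_
  rw [eLpNorm_two_sq]
  have hvol : volume.restrict (Set.Ioc (0 : ℝ) τ) Set.univ = (τ : ℝ≥0∞) := by simp
  have hsq : ∀ ω, ‖∫ r in (0 : ℝ)..τ, G r ω‖ₑ ^ 2
      ≤ τ * ∫⁻ r in Set.Ioc (0 : ℝ) τ, ‖G r ω‖ₑ ^ 2 := fun ω => by
    rw [intervalIntegral.integral_of_le τ.coe_nonneg]
    have hm : Measurable fun r => ‖G r ω‖ₑ := (hG.comp measurable_prodMk_right).enorm
    have h := lintegral_mul_sq_le (μ := volume.restrict (Set.Ioc (0 : ℝ) τ))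
      (f := fun _ => 1) (g := fun r => ‖G r ω‖ₑ) aemeasurable_const hm.aemeasurable
    simp only [one_mul, one_pow, lintegral_const, hvol] at h
    exact (pow_le_pow_left₀ zero_le (enorm_integral_le_lintegral_enorm _) 2).trans h
  calc ∫⁻ ω, ‖∫ r in (0 : ℝ)..τ, G r ω‖ₑ ^ 2 ∂P
      ≤ ∫⁻ ω, (τ * ∫⁻ r in Set.Ioc (0 : ℝ) τ, ‖G r ω‖ₑ ^ 2) ∂P := lintegral_mono hsq
    _ = τ * ∫⁻ r in Set.Ioc (0 : ℝ) τ, ∫⁻ ω, ‖G r ω‖ₑ ^ 2 ∂P := by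
        rw [lintegral_const_mul' _ _ ENNReal.coe_ne_top, lintegral_lintegral_swap]
        exact ((hG.comp measurable_swap).enorm.pow_const 2).aemeasurable
    _ ≤ τ * ∫⁻ _ in Set.Ioc (0 : ℝ) τ, (C : ℝ≥0∞) :=
        mul_le_mul_right (setLIntegral_mono measurable_const hC) _
    _ = C * τ ^ 2 := by
        rw [lintegral_const, hvol]
        ring

end TimeStep

section TimeError

variable {d : ℕ} {Ω : Type*} {mΩ : MeasurableSpace Ω} {P : Measure Ω}
  {𝓕 : Filtration ℝ≥0 mΩ} {T : ℝ≥0} {K : (Fin d → ℝ) → (Fin d → ℝ) → ℝ}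
  {lam : ℕ → ℝ} {e : ℕ → StateSpace d} {Q : StateSpace d →L[ℝ] StateSpace d}
  {g : StateSpace d} {W u : ℝ≥0 → Ω → StateSpace d}

/-- The local error of the Euler scheme along the solution, accumulated over `k` steps of
length `τ`. -/
noncomputable def eulerDefect (K : (Fin d → ℝ) → (Fin d → ℝ) → ℝ) (u : ℝ≥0 → Ω → StateSpace d)
    (τ : ℝ≥0) (k : ℕ) (ω : Ω) : StateSpace d :=
  ∫ r in (0 : ℝ)..τ, ∑ j ∈ Finset.range k, (interactionOp K kuramotoS (u (j * τ + r.toNNReal) ω)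
    - interactionOp K kuramotoS (u (j * τ) ω))

lemma IsMildSolution.measurable_eulerDefect_integrand (hK : IsAdmissibleKernel K)
    (hu : IsMildSolution P 𝓕 T K kuramotoS g W u) (τ : ℝ≥0) (k : ℕ) :
    Measurable fun p : ℝ × Ω => ∑ j ∈ Finset.range k,
      (interactionOp K kuramotoS (u (j * τ + p.1.toNNReal) p.2)
        - interactionOp K kuramotoS (u (j * τ) p.2)) := by
  have h : ∀ f : ℝ × Ω → ℝ≥0, Measurable f →
      Measurable fun p : ℝ × Ω => interactionOp K kuramotoS (u (f p) p.2) := fun f hf =>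
    (continuous_interactionOp hK).measurable.comp (hu.measurable_uncurry.comp
      (f := fun p : ℝ × Ω => (f p, p.2)) (hf.prodMk measurable_snd))
  exact Finset.measurable_sum _ fun j _ =>
    (h _ (by fun_prop)).sub (h _ measurable_const)

/-- The time discretization is of first order: one factor `τ` comes from the integration over
`r ∈ [0, τ]`, and the integrand is bounded in `L²(Ω)`. -/
lemma IsMildSolution.exists_eLpNorm_eulerDefect_le [IsProbabilityMeasure P]
    (hK : IsAdmissibleKernel K) (hQ : IsTraceClassSpectrum Q lam e)
    (hW : IsWienerProcess P 𝓕 lam e W) (hu : IsMildSolution P 𝓕 T K kuramotoS g W u) :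
    ∃ C : ℝ≥0, ∀ (τ : ℝ≥0) (k : ℕ), k * τ ≤ T → eLpNorm (eulerDefect K u τ k) 2 P ≤ C * τ := by
  obtain ⟨C, hC⟩ := hu.exists_lintegral_sum_drift_sub_sq_le hK hQ hW
  refine ⟨NNReal.sqrt C, fun τ k hk => ?_⟩
  exact eLpNorm_intervalIntegral_le (hu.measurable_eulerDefect_integrand hK τ k) fun r hr =>
    hC τ r.toNNReal k hk (Real.toNNReal_le_iff_le_coe.2 hr.2)

lemma IsMildSolution.stronglyMeasurable_eulerDefect (hK : IsAdmissibleKernel K)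
    (hu : IsMildSolution P 𝓕 T K kuramotoS g W u) (τ : ℝ≥0) (k : ℕ) :
    StronglyMeasurable (eulerDefect K u τ k) := by
  have h := ((hu.measurable_eulerDefect_integrand hK τ k).comp
    measurable_swap).stronglyMeasurable.integral_prod_right'
    (ν := volume.restrict (Set.Ioc (0 : ℝ) τ))
  convert h using 2 with ω
  exact intervalIntegral.integral_of_le τ.coe_nonneg

lemma IsMildSolution.integral_drift_eq (hK : IsAdmissibleKernel K)
    (hu : IsMildSolution P 𝓕 T K kuramotoS g W u) (τ : ℝ≥0) (k : ℕ) (ω : Ω) :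
    ∫ s in (0 : ℝ)..(k * τ : ℝ≥0), interactionOp K kuramotoS (u s.toNNReal ω)
      = (τ : ℝ) • ∑ j ∈ Finset.range k, interactionOp K kuramotoS (u (j * τ) ω)
        + eulerDefect K u τ k ω := by
  set f : ℝ → StateSpace d := fun s => interactionOp K kuramotoS (u s.toNNReal ω) with hf
  have hfi : ∀ a b, IntervalIntegrable f volume a b := hu.intervalIntegrable_drift hK ω
  have hfj : ∀ (j : ℕ) (a b : ℝ), IntervalIntegrable (fun r => f (j * τ + r)) volume a b :=
    fun j a b => by
      have h := (hfi (j * τ + a) (j * τ + b)).comp_add_left (j * τ : ℝ)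
      simpa using h
  have h1 : ∫ s in (0 : ℝ)..(k * τ : ℝ≥0), f s
      = ∑ j ∈ Finset.range k, ∫ r in (0 : ℝ)..τ, f (j * τ + r) := by
    have h := intervalIntegral.sum_integral_adjacent_intervals (f := f) (μ := volume)
      (a := fun j : ℕ => (j * τ : ℝ)) (n := k) fun j _ => hfi _ _
    simp only [Nat.cast_zero, zero_mul] at h
    rw [NNReal.coe_mul, NNReal.coe_natCast, ← h]
    refine Finset.sum_congr rfl fun j _ => ?_
    rw [intervalIntegral.integral_comp_add_left]
    congr 1 <;> push_cast <;> ring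
  have h2 : eulerDefect K u τ k ω
      = ∫ r in (0 : ℝ)..τ, ∑ j ∈ Finset.range k, (f (j * τ + r) - f (j * τ)) := by
    refine intervalIntegral.integral_congr fun r hr => ?_
    rw [Set.uIcc_of_le τ.coe_nonneg] at hr
    refine Finset.sum_congr rfl fun j _ => ?_
    have h3 : ((j : ℝ) * τ).toNNReal = j * τ := by
      rw [← NNReal.coe_natCast, ← NNReal.coe_mul, Real.toNNReal_coe]
    simp only [hf]
    rw [Real.toNNReal_add (by positivity) hr.1, h3]
  rw [h1, h2, intervalIntegral.integral_finsetSum fun j _ =>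
    (hfj j 0 τ).sub intervalIntegrable_const, Finset.smul_sum, ← Finset.sum_add_distrib]
  refine Finset.sum_congr rfl fun j _ => ?_
  have h3 : ((j : ℝ) * τ).toNNReal = j * τ := by
    rw [← NNReal.coe_natCast, ← NNReal.coe_mul, Real.toNNReal_coe]
  rw [intervalIntegral.integral_sub (hfj j 0 τ) intervalIntegrable_const,
    intervalIntegral.integral_const, sub_zero]
  simp only [hf, h3]
  abel

end TimeError

/-! ### The error recursion -/

section Error

variable {d : ℕ} {Ω : Type*} {mΩ : MeasurableSpace Ω} {P : Measure Ω}
  {𝓕 : Filtration ℝ≥0 mΩ} {T : ℝ≥0} {K : (Fin d → ℝ) → (Fin d → ℝ) → ℝ} {κ : ℝ≥0}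
  {lam : ℕ → ℝ} {e : ℕ → StateSpace d} {Q : StateSpace d →L[ℝ] StateSpace d}
  {g : StateSpace d} {W u : ℝ≥0 → Ω → StateSpace d}

lemma scheme_eq (S : ℝ → ℝ → ℝ) (n : ℕ) (τ : ℝ≥0) (k : ℕ) (ω : Ω) :
    scheme K S g W n τ k ω = galerkinProj n g
      + (galerkinProj n (W (k * τ) ω) - galerkinProj n (W 0 ω))
      + (τ : ℝ) • ∑ j ∈ Finset.range k,
        interactionOp (kernelProj n K) S (scheme K S g W n τ j ω) := by
  induction k with
  | zero => simp [scheme]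
  | succ k ih =>
    have hs : scheme K S g W n τ (k + 1) ω = scheme K S g W n τ k ω
        + (τ : ℝ) • interactionOp (kernelProj n K) S (scheme K S g W n τ k ω)
        + galerkinProj n (W ((k + 1 : ℕ) * τ) ω - W (k * τ) ω) := rfl
    rw [hs, galerkinProj_sub, Finset.sum_range_succ, smul_add]
    nth_rewrite 1 [ih]
    abel

lemma measurable_scheme (hW : ∀ t, Measurable (W t)) (n : ℕ) (τ : ℝ≥0) (k : ℕ) :
    Measurable (scheme K kuramotoS g W n τ k) := by
  induction k with
  | zero => exact measurable_const
  | succ k ih =>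
    have h1 : Measurable fun ω => interactionOp (kernelProj n K) kuramotoS
        (scheme K kuramotoS g W n τ k ω) :=
      (continuous_interactionOp (isAdmissibleKernel_kernelProj n)).measurable.comp ih
    have h2 : Measurable fun ω => (τ : ℝ) • interactionOp (kernelProj n K) kuramotoS
        (scheme K kuramotoS g W n τ k ω) :=
      (continuous_const_smul (τ : ℝ)).measurable.comp h1
    have h3 : Measurable fun ω => galerkinProj n (W ((k + 1 : ℕ) * τ) ω - W (k * τ) ω) :=
      (continuous_galerkinProj n).measurable.comp ((hW _).sub (hW _))
    exact (ih.add h2).add h3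

/-- The error is the sum of the projection errors of the initial value and of the noise, of the
time discretization error, of the error of the kernel, and of a term that the error at the
preceding steps controls. -/
lemma IsMildSolution.ae_sub_scheme_eq (hK : IsAdmissibleKernel K)
    (hW : IsWienerProcess P 𝓕 lam e W) (hu : IsMildSolution P 𝓕 T K kuramotoS g W u)
    (n : ℕ) {τ : ℝ≥0} {k : ℕ} (hk : k * τ ≤ T) :
    ∀ᵐ ω ∂P, u (k * τ) ω - scheme K kuramotoS g W n τ k ω
      = (g - galerkinProj n g) + (W (k * τ) ω - galerkinProj n (W (k * τ) ω))
        + eulerDefect K u τ k ω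
        + (τ : ℝ) • ∑ j ∈ Finset.range k, (interactionOp K kuramotoS (u (j * τ) ω)
          - interactionOp (kernelProj n K) kuramotoS (scheme K kuramotoS g W n τ j ω)) := by
  filter_upwards [hu.eqn, hW.ae_zero] with ω h1 h2
  rw [h1 _ hk, hu.integral_drift_eq hK, scheme_eq, h2, galerkinProj_zero, Finset.sum_sub_distrib,
    smul_sub]
  abel

/-- Discrete Gronwall inequality. -/
lemma le_mul_one_add_pow_of_le_add_mul_sum {ε : ℕ → ℝ≥0∞} {a b : ℝ≥0∞} {M : ℕ}
    (h : ∀ k ≤ M, ε k ≤ a + b * ∑ j ∈ Finset.range k, ε j) {k : ℕ} (hk : k ≤ M) :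
    ε k ≤ a * (1 + b) ^ k := by
  have hsum : ∀ k ≤ M, a + b * ∑ j ∈ Finset.range k, ε j ≤ a * (1 + b) ^ k := by
    intro k
    induction k with
    | zero => simp
    | succ k ih =>
      intro hk
      have hk' := ih (by omega)
      rw [Finset.sum_range_succ, mul_add, ← add_assoc, pow_succ, ← mul_assoc, mul_add, mul_one,
        mul_comm _ b]
      exact add_le_add hk' (mul_le_mul_right ((h k (by omega)).trans hk') _)
  exact (h k hk).trans (hsum k hk)

lemma one_add_mul_pow_le_exp {L τ T : ℝ≥0} {k : ℕ} (hk : k * τ ≤ T) :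
    (1 + ((L * τ : ℝ≥0) : ℝ≥0∞)) ^ k ≤ ((Real.exp (L * T)).toNNReal : ℝ≥0) := by
  rw [← ENNReal.coe_one, ← ENNReal.coe_add, ← ENNReal.coe_pow, ENNReal.coe_le_coe,
    Real.le_toNNReal_iff_coe_le (Real.exp_pos _).le]
  have hk' : (k : ℝ) * τ ≤ T := by exact_mod_cast hk
  push_cast
  calc (1 + (L : ℝ) * τ) ^ k ≤ Real.exp (L * τ) ^ k := by
        refine pow_le_pow_left₀ (by positivity) ?_ k
        rw [add_comm]
        exact Real.add_one_le_exp _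
    _ = Real.exp (L * (k * τ)) := by
        rw [← Real.exp_nat_mul]
        congr 1
        ring
    _ ≤ Real.exp (L * T) := by gcongr

lemma MemLipL2.exists_l2Modulus_le {ι : Type} [Fintype ι] {γ : ℝ} {φ : (ι → ℝ) → ℝ}
    (h : MemLipL2 γ φ) :
    ∃ C : ℝ≥0, ∀ n : ℕ, 1 ≤ n → l2Modulus φ (1 / n) ≤ C * ENNReal.ofReal ((n : ℝ) ^ (-γ)) := by
  obtain ⟨-, C, hC⟩ := h
  refine ⟨C, fun n hn => (hC (1 / n) (by positivity)).trans_eq ?_⟩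
  rw [one_div, Real.inv_rpow n.cast_nonneg, Real.rpow_neg n.cast_nonneg]

lemma exists_enorm_sub_galerkinProj_le (hd : 0 < d) {α : ℝ}
    (hg : MemLipL2 α (g : (Fin d → ℝ) → ℝ)) :
    ∃ C : ℝ≥0, ∀ n : ℕ, 1 ≤ n →
      ‖g - galerkinProj n g‖ₑ ≤ C * ENNReal.ofReal ((n : ℝ) ^ (-α)) := by
  obtain ⟨C, hC⟩ := hg.exists_l2Modulus_le
  refine ⟨NNReal.sqrt (2 ^ d) * (d * C), fun n hn => ?_⟩
  have h := enorm_sub_galerkinProj_sq_le hd hn g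
  refine (le_sqrt_mul_of_sq_le (c := 2 ^ d) (by exact_mod_cast h)).trans ?_
  rw [ENNReal.coe_mul, mul_assoc, ENNReal.coe_mul, mul_assoc, ENNReal.coe_natCast]
  gcongr
  exact hC n hn

lemma exists_enorm_interactionOp_sub_kernelProj_le (hd : 0 < d) (hK : IsAdmissibleKernel K)
    {β : ℝ} (hKLip : MemLipL2 β (kernelOnCube K)) :
    ∃ C : ℝ≥0, ∀ n : ℕ, 1 ≤ n → ∀ v : StateSpace d,
      ‖interactionOp K kuramotoS v - interactionOp (kernelProj n K) kuramotoS v‖ₑ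
        ≤ C * ENNReal.ofReal ((n : ℝ) ^ (-β)) := by
  obtain ⟨C, hC⟩ := hKLip.exists_l2Modulus_le
  have hfin : IsFiniteMeasure (volume.restrict (cube (Fin d ⊕ Fin d))) :=
    ⟨by rw [Measure.restrict_apply_univ]; exact isCompact_Icc.measure_lt_top⟩
  have hKi : IntegrableOn (kernelOnCube K) (cube (Fin d ⊕ Fin d)) :=
    hKLip.1.integrable one_le_two
  refine ⟨NNReal.sqrt (2 ^ (2 * d)) * ((2 * d : ℕ) * C), fun n hn v => ?_⟩
  have h := (enorm_interactionOp_sub_kernel_sq_le hK (isAdmissibleKernel_kernelProj n) v).trans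
    (lintegral_sub_kernelProj_sq_le hd hK hKi hn)
  refine (le_sqrt_mul_of_sq_le (c := 2 ^ (2 * d)) (by exact_mod_cast h)).trans ?_
  rw [ENNReal.coe_mul, mul_assoc, ENNReal.coe_mul, mul_assoc, ENNReal.coe_natCast]
  gcongr
  exact hC n hn

/-- The inequality to which the discrete Gronwall lemma applies; `δ` bounds the effect of replacing
the kernel by its averages. -/
lemma IsMildSolution.eLpNorm_sub_scheme_le [IsProbabilityMeasure P] (hK : IsAdmissibleKernel K)
    (hκ : RowBound K κ) (hW : IsWienerProcess P 𝓕 lam e W)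
    (hu : IsMildSolution P 𝓕 T K kuramotoS g W u) {n : ℕ} (hn : 1 ≤ n) {δ : ℝ≥0∞}
    (hδ : ∀ v : StateSpace d,
      ‖interactionOp K kuramotoS v - interactionOp (kernelProj n K) kuramotoS v‖ₑ ≤ δ)
    {τ : ℝ≥0} {k : ℕ} (hk : k * τ ≤ T) :
    eLpNorm (fun ω => u (k * τ) ω - scheme K kuramotoS g W n τ k ω) 2 P
      ≤ ‖g - galerkinProj n g‖ₑ
        + eLpNorm (fun ω => W (k * τ) ω - galerkinProj n (W (k * τ) ω)) 2 P
        + eLpNorm (eulerDefect K u τ k) 2 P + T * δ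
        + (NNReal.sqrt (κ * (16 * NNReal.pi ^ 2)) * τ : ℝ≥0)
          * ∑ j ∈ Finset.range k,
            eLpNorm (fun ω => u (j * τ) ω - scheme K kuramotoS g W n τ j ω) 2 P := by
  set L := NNReal.sqrt (κ * (16 * NNReal.pi ^ 2)) with hL
  have hWm : ∀ t, Measurable (W t) := fun t => (hW.measurable t).mono (𝓕.le t) le_rfl
  have hum : ∀ t, Measurable (u t) := fun t => (hu.measurable t).mono (𝓕.le t) le_rfl
  have hsm : ∀ j, Measurable (scheme K kuramotoS g W n τ j) := measurable_scheme hWm n τ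
  have hdm : ∀ j : ℕ, Measurable fun ω => interactionOp K kuramotoS (u (j * τ) ω)
      - interactionOp (kernelProj n K) kuramotoS (scheme K kuramotoS g W n τ j ω) := fun j =>
    ((continuous_interactionOp hK).measurable.comp (hum _)).sub
      ((continuous_interactionOp (isAdmissibleKernel_kernelProj n)).measurable.comp (hsm j))
  have hstep : ∀ j : ℕ, eLpNorm (fun ω => interactionOp K kuramotoS (u (j * τ) ω)
      - interactionOp (kernelProj n K) kuramotoS (scheme K kuramotoS g W n τ j ω)) 2 P
      ≤ δ + L * eLpNorm (fun ω => u (j * τ) ω - scheme K kuramotoS g W n τ j ω) 2 P := fun j => by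
    have hF : (fun ω => interactionOp K kuramotoS (u (j * τ) ω)
        - interactionOp (kernelProj n K) kuramotoS (scheme K kuramotoS g W n τ j ω))
        = (fun ω => interactionOp K kuramotoS (u (j * τ) ω)
            - interactionOp (kernelProj n K) kuramotoS (u (j * τ) ω))
          + fun ω => interactionOp (kernelProj n K) kuramotoS (u (j * τ) ω)
            - interactionOp (kernelProj n K) kuramotoS (scheme K kuramotoS g W n τ j ω) := by
      ext1 ω
      simp only [Pi.add_apply]
      abel
    have hc := (continuous_interactionOp (isAdmissibleKernel_kernelProj (K := K) n)).measurable
    rw [hF]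
    refine (eLpNorm_add_le
      (((continuous_interactionOp hK).measurable.comp (hum _)).sub
        (hc.comp (hum _))).aestronglyMeasurable
      ((hc.comp (hum _)).sub (hc.comp (hsm j))).aestronglyMeasurable one_le_two).trans
      (add_le_add ?_ ?_)
    · refine (ENNReal.pow_le_pow_left_iff two_ne_zero).1 ?_
      rw [eLpNorm_two_sq]
      refine (lintegral_mono fun ω => pow_le_pow_left₀ zero_le (hδ (u (j * τ) ω)) 2).trans ?_
      rw [lintegral_const, measure_univ, mul_one]
    · exact eLpNorm_le_mul_eLpNorm_of_ae_le_mul' (Filter.Eventually.of_forall fun ω =>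
        enorm_interactionOp_sub_le (isAdmissibleKernel_kernelProj n)
          (rowBound_kernelProj hK hκ hn) _ _) 2
  rw [eLpNorm_congr_ae (hu.ae_sub_scheme_eq hK hW n hk)]
  have hm1 : Measurable fun ω => W (k * τ) ω - galerkinProj n (W (k * τ) ω) :=
    (hWm _).sub ((continuous_galerkinProj n).measurable.comp (hWm _))
  have hm2 := (hu.stronglyMeasurable_eulerDefect hK τ k).aestronglyMeasurable (μ := P)
  have hm3 : AEStronglyMeasurable (fun ω => (τ : ℝ) • ∑ j ∈ Finset.range k,
      (interactionOp K kuramotoS (u (j * τ) ω)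
        - interactionOp (kernelProj n K) kuramotoS (scheme K kuramotoS g W n τ j ω))) P :=
    (Finset.measurable_sum _ fun j _ => hdm j).aestronglyMeasurable.const_smul (τ : ℝ)
  have hm0 : AEStronglyMeasurable (fun _ : Ω => g - galerkinProj n g) P :=
    aestronglyMeasurable_const
  refine (eLpNorm_add_le ((hm0.add hm1.aestronglyMeasurable).add hm2) hm3 one_le_two).trans ?_
  rw [add_assoc _ (T * δ)]
  refine add_le_add ((eLpNorm_add_le (hm0.add hm1.aestronglyMeasurable) hm2 one_le_two).trans
    (add_le_add_left ((eLpNorm_add_le hm0 hm1.aestronglyMeasurable one_le_two).trans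
      (add_le_add_left ?_ _)) _)) ?_
  · rw [eLpNorm_const _ two_ne_zero (IsProbabilityMeasure.ne_zero P)]
    simp
  · have h1 := eLpNorm_const_smul (τ : ℝ) (fun ω => ∑ j ∈ Finset.range k,
      (interactionOp K kuramotoS (u (j * τ) ω)
        - interactionOp (kernelProj n K) kuramotoS (scheme K kuramotoS g W n τ j ω))) 2 P
    refine h1.le.trans ?_
    have h2 : ‖(τ : ℝ)‖ₑ = τ := by
      rw [Real.enorm_eq_ofReal τ.coe_nonneg, ENNReal.ofReal_coe_nnreal]
    rw [h2]
    calc (τ : ℝ≥0∞) * _ ≤ τ * ∑ j ∈ Finset.range k, (δ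
          + L * eLpNorm (fun ω => u (j * τ) ω - scheme K kuramotoS g W n τ j ω) 2 P) := by
          refine mul_le_mul_right ?_ _
          have h3 := eLpNorm_sum_le (p := 2) (μ := P) (s := Finset.range k)
            (f := fun (j : ℕ) ω => interactionOp K kuramotoS (u (j * τ) ω)
              - interactionOp (kernelProj n K) kuramotoS (scheme K kuramotoS g W n τ j ω))
            (fun j _ => (hdm j).aestronglyMeasurable) one_le_two
          refine le_trans (le_of_eq ?_) (h3.trans (Finset.sum_le_sum fun j _ => hstep j))
          congr 1
          ext1 ω
          simp
      _ = (k * τ : ℝ≥0) * δ + (L * τ : ℝ≥0) * ∑ j ∈ Finset.range k,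
            eLpNorm (fun ω => u (j * τ) ω - scheme K kuramotoS g W n τ j ω) 2 P := by
          rw [Finset.sum_add_distrib, Finset.sum_const, Finset.card_range, nsmul_eq_mul,
            ← Finset.mul_sum]
          push_cast
          ring
      _ ≤ _ := by gcongr

end Error

end KuramotoGalerkin

theorem theoremt {d : ℕ} (hd : 0 < d)
    {Ω : Type*} {mΩ : MeasurableSpace Ω} (P : Measure Ω) [IsProbabilityMeasure P]
    (𝓕 : Filtration ℝ≥0 mΩ) (h𝓕 : KuramotoGalerkin.IsNormalFiltration P 𝓕)
    (T : ℝ≥0) (hT : 0 < T)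
    (K : (Fin d → ℝ) → (Fin d → ℝ) → ℝ) (hK : KuramotoGalerkin.IsAdmissibleKernel K)
    (Q : KuramotoGalerkin.StateSpace d →L[ℝ] KuramotoGalerkin.StateSpace d)
    (lam : ℕ → ℝ) (e : ℕ → KuramotoGalerkin.StateSpace d)
    (hQ : KuramotoGalerkin.IsTraceClassSpectrum Q lam e)
    (W : ℝ≥0 → Ω → KuramotoGalerkin.StateSpace d)
    (hW : KuramotoGalerkin.IsWienerProcess P 𝓕 lam e W)
    (g : KuramotoGalerkin.StateSpace d)
    (α β : ℝ) (hα : α ∈ Set.Ioc (0 : ℝ) 1) (hβ : β ∈ Set.Ioc (0 : ℝ) 1)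
    (hg : KuramotoGalerkin.MemLipL2 α (g : (Fin d → ℝ) → ℝ))
    (hKLip : KuramotoGalerkin.MemLipL2 β (KuramotoGalerkin.kernelOnCube K))
    (u : ℝ≥0 → Ω → KuramotoGalerkin.StateSpace d)
    (hu : KuramotoGalerkin.IsMildSolution P 𝓕 T K KuramotoGalerkin.kuramotoS g W u) :
    ∃ C : ℝ≥0, ∀ n : ℕ, 1 ≤ n → ∀ M : ℕ, 1 ≤ M → ∀ k : ℕ, k ≤ M →
      eLpNorm (fun ω => u (k * (T / M)) ω
          - KuramotoGalerkin.scheme K KuramotoGalerkin.kuramotoS g W n (T / M) k ω) 2 P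
        ≤ C * (max (max (ENNReal.ofReal ((n : ℝ) ^ (-α))) (ENNReal.ofReal ((n : ℝ) ^ (-β))))
              (KuramotoGalerkin.Psi lam e n) + ((T / M : ℝ≥0) : ℝ≥0∞)) := by
  obtain ⟨κ, hκ⟩ := hK.exists_rowBound
  obtain ⟨cg, hcg⟩ := KuramotoGalerkin.exists_enorm_sub_galerkinProj_le hd hg
  obtain ⟨cK, hcK⟩ := KuramotoGalerkin.exists_enorm_interactionOp_sub_kernelProj_le hd hK hKLip
  obtain ⟨cA, hcA⟩ := hu.exists_eLpNorm_eulerDefect_le hK hQ hW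
  set cW : ℝ≥0 := NNReal.sqrt (T * (2 ^ d * d ^ 2)) with hcW
  set L : ℝ≥0 := NNReal.sqrt (κ * (16 * NNReal.pi ^ 2)) with hL
  refine ⟨(cg + cW + cA + T * cK) * (Real.exp (L * T)).toNNReal, fun n hn M hM k hk => ?_⟩
  set τ : ℝ≥0 := T / M with hτ
  have hkT : ∀ k ≤ M, k * τ ≤ T := fun k hk => by
    have hM0 : (M : ℝ≥0) ≠ 0 := by exact_mod_cast (by omega : M ≠ 0)
    calc (k : ℝ≥0) * τ ≤ M * τ := by gcongr
      _ = T := mul_div_cancel₀ T hM0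
  set R : ℝ≥0∞ := max (max (ENNReal.ofReal ((n : ℝ) ^ (-α))) (ENNReal.ofReal ((n : ℝ) ^ (-β))))
    (KuramotoGalerkin.Psi lam e n) with hR
  have hRα : ENNReal.ofReal ((n : ℝ) ^ (-α)) ≤ R := (le_max_left _ _).trans (le_max_left _ _)
  have hRβ : ENNReal.ofReal ((n : ℝ) ^ (-β)) ≤ R := (le_max_right _ _).trans (le_max_left _ _)
  have hRΨ : KuramotoGalerkin.Psi lam e n ≤ R := le_max_right _ _
  have hrec : ∀ k ≤ M, eLpNorm (fun ω => u (k * τ) ω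
      - KuramotoGalerkin.scheme K KuramotoGalerkin.kuramotoS g W n τ k ω) 2 P
      ≤ (cg + cW + cA + T * cK : ℝ≥0) * (R + τ) + (L * τ : ℝ≥0) * ∑ j ∈ Finset.range k,
        eLpNorm (fun ω => u (j * τ) ω
          - KuramotoGalerkin.scheme K KuramotoGalerkin.kuramotoS g W n τ j ω) 2 P := fun k hk => by
    refine (hu.eLpNorm_sub_scheme_le hK hκ hW hn (hcK n hn) (hkT k hk)).trans
      (add_le_add_left ?_ _)
    have h1 : ENNReal.ofReal ((n : ℝ) ^ (-α)) ≤ R + τ := hRα.trans le_self_add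
    have h2 : ENNReal.ofReal ((n : ℝ) ^ (-β)) ≤ R + τ := hRβ.trans le_self_add
    have h3 : KuramotoGalerkin.Psi lam e n ≤ R + τ := hRΨ.trans le_self_add
    have h4 : (τ : ℝ≥0∞) ≤ R + τ := le_add_self
    calc _ ≤ cg * (R + τ) + cW * (R + τ) + cA * (R + τ) + T * (cK * (R + τ)) := by
          refine add_le_add (add_le_add (add_le_add ?_ ?_) ?_) ?_
          · exact (hcg n hn).trans (mul_le_mul_right h1 _)
          · exact (KuramotoGalerkin.eLpNorm_sub_galerkinProj_le hd hQ hW hn (hkT k hk)).trans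
              (mul_le_mul_right h3 _)
          · exact (hcA τ k (hkT k hk)).trans (mul_le_mul_right h4 _)
          · exact mul_le_mul_right (mul_le_mul_right h2 _) _
      _ = _ := by
          push_cast
          ring
  refine (KuramotoGalerkin.le_mul_one_add_pow_of_le_add_mul_sum hrec hk).trans ?_
  rw [mul_right_comm, ENNReal.coe_mul (cg + cW + cA + T * cK)]
  gcongr
  exact KuramotoGalerkin.one_add_mul_pow_le_exp (hkT k hk)
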